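/- Setting. Let $\mathfrak g=\mathfrak{so}(3,1)$ act on $V=\mathbb R^{3,1}$ (Minkowski metric $\eta$) by the defining representation, and let $\mathfrak d=\mathfrak g^*\oplus V\oplus\mathfrak g$ be the trivial standard extension: the metric Lie algebra with inner product $\langle z_1+v_1+x_1,z_2+v_2+x_2\rangle=\eta(v_1,v_2)+z_1(x_2)+z_2(x_1)$ and bracket $$[z_1+v_1+x_1,z_2+v_2+x_2]=\big(\mathrm{ad}^*_{x_1}z_2-\mathrm{ad}^*_{x_2}z_1+[v_1,v_2]\big)+\big(x_1v_2-x_2v_1\big)+[x_1,x_2],\qquad [v,w](x)=\eta(xv,w).$$ Let $D$ be a Lie group with Lie algebra $\mathfrak d$ whose adjoint action preserves $\langle\cdot,\cdot\rangle$ (automatic if $D$ is connected), let $\Sigma$ be a closed oriented smooth $3$-manifold (the boundary of space-time) and $P\to\Sigma$ a principal $D$-bundle. Let $\beta\in\mathbb R$ and let $T$ be a linear automorphism of $\mathfrak g$, acting on $\mathfrak g^*$ through the Killing form. The boundary phase space of quadratically extended General Relativity (qeGR) is $\mathcal F^\partial=\mathcal A_P\times\Omega^2(\Sigma;\mathrm{ad}P)\ni(\mathbb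 A,\mathbb B)$, $\mathbb A=(A,e,S)$, $\mathbb B=(B,\tau,c)$ (with $A,c$ in $\mathfrak g$, $e,\tau$ in $V$ and $S,B$ in $\mathfrak g^*$), with symplectic form $\int_\Sigma\langle\delta\mathbb B,\delta\mathbb A\rangle=\int_\Sigma\langle\delta B,\delta A\rangle+\eta(\delta\tau,\delta e)+\langle\delta c,\delta S\rangle$. For Lagrange multipliers $\mathbb a=(\theta,\epsilon,\sigma)\in\Omega^0(\Sigma;\mathrm{ad}P)$ and $\mathbb H=(\alpha,\rho,\zeta)\in\Omega^1(\Sigma;\mathrm{ad}P)$ its constraints are $H_\theta+I_\epsilon+J_\sigma+K_\alpha+L_\rho+M_\zeta$, where $$H_\theta=\int_\Sigma\langle d_AB+[e,\tau]-[c,S],\theta\rangle,\quad I_\epsilon=\int_\Sigma\eta(d_A\tau,\epsilon)-\eta([c,e],\epsilon),\quad J_\sigma=\int_\Sigma\langle d_Ac,\sigma\rangle,$$ $$K_\alpha=\int_\Sigma\langle(\mathrm{id}+\beta T)B+d_AS+\tfrac12[e,e],\alpha\rangle,\quad L_\rho=\int_\Sigma\eta(d_Ae+(1+\beta)\tau,\rho),\quad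 M_\zeta=\int_\Sigma\langle F_A+(\mathrm{id}+\beta T)c,\zeta\rangle.$$ Counting. A space of pairs (one-form, two-form) with values in $\mathrm{ad}P$ has $n$ local degrees of freedom if at every point the dimension of its space of $k$-jets, divided by $\binom{k+3}{3}$, tends to $n$ as $k\to\infty$. Let $d$ be the number of local degrees of freedom of the tangent space of $\mathcal F^\partial$. A constraint is first class at a point $\phi$ of the constraint surface if its Hamiltonian vector at $\phi$ exists and its Poisson brackets with all the constraints vanish at $\phi$. The numbers $c_1$, $c_2$ of independent local first- and second-class constraints are such that, at every $\phi$ in the constraint surface, the Hamiltonian vectors of the constraints that are first class at $\phi$ have $c_1$ local degrees of freedom, and those of all the constraints have $c_1+c_2$. The theory is topological if $d=2c_1+c_2$. Theorem. Assume that $\beta,T$ are in the topological sector, $\beta T=\beta\,\mathrm{id}$. Then: 1. The constraints of qeGR are those of $BF+(1+\beta)BB$ theory for $\mathfrak d$: for all $(\mathbb A,\mathbb B)$, $\mathbb a$ and $\mathbb H$, $$H_\theta+I_\epsilon+J_\sigma=\int_\Sigma\langle d_{\mathbb A}\mathbb B,\mathbb a\rangle,\qquad K_\alpha+L_\rho+M_\zeta=\int_\Sigma\langle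 F_{\mathbb A}+(1+\beta)\mathbb B,\mathbb H\rangle.$$ 2. The constraint set is first class: at every point of the constraint surface all the constraints have Hamiltonian vectors, and all their Poisson brackets vanish. 3. $d=96$, $c_1=48$ and $c_2=0$. Hence $d=2c_1+c_2$: qeGR is topological. -/

import Mathlib

open scoped Manifold ContDiff

noncomputable section

namespace QEGR

/-! ### The Lie algebra `so(3,1)` and its Killing form -/

section
set_option linter.unusedSectionVars false
attribute [local instance 100] LieRing.ofAssociativeRing

/-- The real Lie algebra `so(3,1)`. Mathlib lets it act on `ℝ^{3,1} = (Fin 3 ⊕ Fin 1 → ℝ)` by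
multiplication of a vector by a matrix (the defining representation). -/
abbrev SO31 :=
  ↥(LieAlgebra.Orthogonal.so' (Fin 3) (Fin 1) ℝ)

theorem mem_SO31_iff (A : Matrix (Fin 3 ⊕ Fin 1) (Fin 3 ⊕ Fin 1) ℝ) :
    A ∈ LieAlgebra.Orthogonal.so' (Fin 3) (Fin 1) ℝ ↔ ∀ i j, A j i * (Sum.elim (fun _ => 1) (fun _ => -1) j : ℝ) =
      - ((Sum.elim (fun _ => 1) (fun _ => -1) i : ℝ) * A i j) := by
  rw [LieAlgebra.Orthogonal.so', mem_skewAdjointMatricesLieSubalgebra,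
    mem_skewAdjointMatricesSubmodule, Matrix.IsSkewAdjoint, Matrix.IsAdjointPair,
    ← Matrix.ext_iff]
  simp only [LieAlgebra.Orthogonal.indefiniteDiagonal, Matrix.mul_diagonal,
    Matrix.diagonal_mul, Matrix.transpose_apply, Matrix.neg_apply, mul_neg]

/-- The element of `so(3,1)` with given rotation and boost entries. -/
def so31OfCoord (f : Fin 6 → ℝ) : SO31 :=
  ⟨Matrix.fromBlocks !![0, f 0, f 1; -f 0, 0, f 2; -f 1, -f 2, 0] !![f 3; f 4; f 5]
    !![f 3, f 4, f 5] 0, by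
    rw [mem_SO31_iff]
    rintro (i | i) (j | j) <;> fin_cases i <;> fin_cases j <;> simp [Matrix.fromBlocks]⟩

/-- Linear coordinates on `so(3,1)`. -/
def so31Coord : SO31 ≃ₗ[ℝ] (Fin 6 → ℝ) where
  toFun A := ![A.1 (.inl 0) (.inl 1), A.1 (.inl 0) (.inl 2), A.1 (.inl 1) (.inl 2),
    A.1 (.inl 0) (.inr 0), A.1 (.inl 1) (.inr 0), A.1 (.inl 2) (.inr 0)]
  invFun := so31OfCoord
  map_add' A B := by ext i; fin_cases i <;> simp
  map_smul' c A := by ext i; fin_cases i <;> simp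
  left_inv A := by
    have h := (mem_SO31_iff A.1).1 A.2
    apply Subtype.ext
    ext i j
    have h1 := h i j
    have h2 := h j i
    have h3 := h i i
    rcases i with i | i <;> rcases j with j | j <;> fin_cases i <;> fin_cases j <;>
      simp [so31OfCoord, Matrix.fromBlocks] at h1 h2 h3 ⊢ <;> linarith
  right_inv f := by ext i; fin_cases i <;> simp [so31OfCoord, Matrix.fromBlocks]

theorem killing_coord (X Y : SO31) : killingForm ℝ SO31 X Y =
    ∑ i, so31Coord ⁅X, ⁅Y, so31OfCoord (Pi.single i 1)⁆⁆ i := by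
  rw [killingForm_apply_apply,
    LinearMap.trace_eq_matrix_trace ℝ (Module.Basis.ofEquivFun so31Coord)]
  simp [Matrix.trace, LinearMap.toMatrix_apply, Module.Basis.ofEquivFun]
  rfl

theorem killing_eq (f g : Fin 6 → ℝ) :
    killingForm ℝ SO31 (so31OfCoord f) (so31OfCoord g) =
      4 * (f 3 * g 3 + f 4 * g 4 + f 5 * g 5 - f 0 * g 0 - f 1 * g 1 - f 2 * g 2) := by
  rw [killing_coord]
  simp [Fin.sum_univ_succ, so31Coord, so31OfCoord, LieSubalgebra.coe_bracket, LieRing.of_associative_ring_bracket,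
    Matrix.sub_apply, Matrix.mul_apply, Fintype.sum_sum_type, Matrix.fromBlocks, Pi.single_apply]
  ring

theorem killing_nondegenerate : (killingForm ℝ SO31).Nondegenerate := by
  refine (LieModule.traceForm_isSymm ℝ SO31 SO31).isRefl.nondegenerate_iff_separatingLeft.mpr ?_
  intro X hX
  obtain ⟨f, rfl⟩ := so31Coord.symm.surjective X
  have h : ∀ i, f i = 0 := by
    intro i
    have := (killing_eq f (Pi.single i 1)).symm.trans (hX _)
    fin_cases i <;> simpa [Pi.single_apply] using this
  have : f = 0 := funext h
  simp [this]

end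

/-- The identification of `so(3,1)` with its dual through the Killing form. -/
def killingIso : SO31 ≃ₗ[ℝ] Module.Dual ℝ SO31 :=
  LinearMap.BilinForm.toDual (killingForm ℝ SO31) killing_nondegenerate

/-! ### Trivial standard extensions -/

/-- Orthogonal modules: representations on a vector space with an invariant nondegenerate
symmetric bilinear form. -/
class OrthogonalLieModule (𝔤 V : Type*) [LieRing 𝔤] [LieAlgebra ℝ 𝔤] [AddCommGroup V] [Module ℝ V]
    [LieRingModule 𝔤 V] [LieModule ℝ 𝔤 V] where
  form : LinearMap.BilinForm ℝ V
  symm : ∀ v w, form v w = form w v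
  nondegenerate : form.Nondegenerate
  invariant : ∀ (x : 𝔤) (v w : V), form ⁅x, v⁆ w + form v ⁅x, w⁆ = 0

/-- The vector space `𝔤* ⊕ V ⊕ 𝔤` underlying the trivial standard extension of `𝔤` by `V`. -/
def TrivialExt (𝔤 V : Type*) [LieRing 𝔤] [LieAlgebra ℝ 𝔤] : Type _ :=
  Module.Dual ℝ 𝔤 × V × 𝔤

namespace TrivialExt

section
set_option linter.unusedSectionVars false
variable {𝔤 V : Type*} [LieRing 𝔤] [LieAlgebra ℝ 𝔤] [AddCommGroup V] [Module ℝ V]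

instance : AddCommGroup (TrivialExt 𝔤 V) :=
  inferInstanceAs (AddCommGroup (Module.Dual ℝ 𝔤 × V × 𝔤))

instance : Module ℝ (TrivialExt 𝔤 V) :=
  inferInstanceAs (Module ℝ (Module.Dual ℝ 𝔤 × V × 𝔤))

instance [Module.Finite ℝ 𝔤] [Module.Finite ℝ V] : Module.Finite ℝ (TrivialExt 𝔤 V) :=
  inferInstanceAs (Module.Finite ℝ (Module.Dual ℝ 𝔤 × V × 𝔤))

/-- The component in `𝔤*`. -/
def dual (X : TrivialExt 𝔤 V) : Module.Dual ℝ 𝔤 := Prod.fst X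

/-- The component in `V`. -/
def vec (X : TrivialExt 𝔤 V) : V := Prod.fst (Prod.snd X)

/-- The component in `𝔤`. -/
def alg (X : TrivialExt 𝔤 V) : 𝔤 := Prod.snd (Prod.snd X)

/-- The element `z + v + x` of `𝔤* ⊕ V ⊕ 𝔤`. -/
def mk (z : Module.Dual ℝ 𝔤) (v : V) (x : 𝔤) : TrivialExt 𝔤 V := (z, v, x)

@[simp] theorem dual_mk (z : Module.Dual ℝ 𝔤) (v : V) (x : 𝔤) : (mk z v x).dual = z := rfl
@[simp] theorem vec_mk (z : Module.Dual ℝ 𝔤) (v : V) (x : 𝔤) : (mk z v x).vec = v := rfl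
@[simp] theorem alg_mk (z : Module.Dual ℝ 𝔤) (v : V) (x : 𝔤) : (mk z v x).alg = x := rfl
@[simp] theorem dual_add (X Y : TrivialExt 𝔤 V) : (X + Y).dual = X.dual + Y.dual := rfl
@[simp] theorem vec_add (X Y : TrivialExt 𝔤 V) : (X + Y).vec = X.vec + Y.vec := rfl
@[simp] theorem alg_add (X Y : TrivialExt 𝔤 V) : (X + Y).alg = X.alg + Y.alg := rfl
@[simp] theorem dual_zero : (0 : TrivialExt 𝔤 V).dual = 0 := rfl
@[simp] theorem vec_zero : (0 : TrivialExt 𝔤 V).vec = 0 := rfl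
@[simp] theorem alg_zero : (0 : TrivialExt 𝔤 V).alg = 0 := rfl
@[simp] theorem dual_smul (r : ℝ) (X : TrivialExt 𝔤 V) : (r • X).dual = r • X.dual := rfl
@[simp] theorem vec_smul (r : ℝ) (X : TrivialExt 𝔤 V) : (r • X).vec = r • X.vec := rfl
@[simp] theorem alg_smul (r : ℝ) (X : TrivialExt 𝔤 V) : (r • X).alg = r • X.alg := rfl

theorem ext' {X Y : TrivialExt 𝔤 V} (h₁ : ∀ x, X.dual x = Y.dual x) (h₂ : X.vec = Y.vec)
    (h₃ : X.alg = Y.alg) : X = Y :=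
  Prod.ext (LinearMap.ext h₁) (Prod.ext h₂ h₃)

variable [LieRingModule 𝔤 V] [LieModule ℝ 𝔤 V] [OrthogonalLieModule 𝔤 V]

/-- The inner product `⟨z₁ + v₁ + x₁, z₂ + v₂ + x₂⟩ = ⟨v₁, v₂⟩ + z₁(x₂) + z₂(x₁)`. -/
def pair (X Y : TrivialExt 𝔤 V) : ℝ :=
  OrthogonalLieModule.form 𝔤 X.vec Y.vec + X.dual Y.alg + Y.dual X.alg

/-- The bracket `V × V → 𝔤*`, determined by `⟨[v, w], x⟩ = ⟨x • v, w⟩`. -/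
def vecBracket (v w : V) : Module.Dual ℝ 𝔤 where
  toFun x := OrthogonalLieModule.form 𝔤 ⁅x, v⁆ w
  map_add' x y := by simp
  map_smul' r x := by simp

@[simp] theorem vecBracket_apply (v w : V) (x : 𝔤) :
    vecBracket v w x = OrthogonalLieModule.form 𝔤 ⁅x, v⁆ w := rfl

/-- The bracket of the trivial standard extension; `𝔤` acts on `𝔤*` by the coadjoint action. -/
instance : Bracket (TrivialExt 𝔤 V) (TrivialExt 𝔤 V) where
  bracket X Y := mk (⁅X.alg, Y.dual⁆ - ⁅Y.alg, X.dual⁆ + vecBracket X.vec Y.vec)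
    (⁅X.alg, Y.vec⁆ - ⁅Y.alg, X.vec⁆) ⁅X.alg, Y.alg⁆

theorem bracket_def (X Y : TrivialExt 𝔤 V) :
    ⁅X, Y⁆ = mk (⁅X.alg, Y.dual⁆ - ⁅Y.alg, X.dual⁆ + vecBracket X.vec Y.vec)
      (⁅X.alg, Y.vec⁆ - ⁅Y.alg, X.vec⁆) ⁅X.alg, Y.alg⁆ := rfl

theorem form_lie_right (x : 𝔤) (v w : V) : OrthogonalLieModule.form 𝔤 v ⁅x, w⁆ =
    - OrthogonalLieModule.form 𝔤 ⁅x, v⁆ w := by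
  linarith [OrthogonalLieModule.invariant x v w]

instance : LieRing (TrivialExt 𝔤 V) where
  add_lie X Y Z := by
    refine ext' (fun x => ?_) ?_ ?_
    · simp [bracket_def]; ring
    · simp [bracket_def]; abel
    · simp [bracket_def]
  lie_add X Y Z := by
    refine ext' (fun x => ?_) ?_ ?_
    · simp [bracket_def]; ring
    · simp [bracket_def]; abel
    · simp [bracket_def]
  lie_self X := by
    refine ext' (fun x => ?_) ?_ ?_
    · have h := OrthogonalLieModule.invariant x X.vec X.vec
      rw [OrthogonalLieModule.symm (𝔤 := 𝔤) X.vec] at h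
      simp [bracket_def]; linarith
    · simp [bracket_def]
    · simp [bracket_def]
  leibniz_lie X Y Z := by
    refine ext' (fun x => ?_) ?_ ?_
    · have h := OrthogonalLieModule.symm (𝔤 := 𝔤) ⁅x, Y.vec⁆ ⁅Z.alg, X.vec⁆
      have h2 := form_lie_right Z.alg ⁅x, Y.vec⁆ X.vec
      have h1 := form_lie_right x ⁅Z.alg, X.vec⁆ Y.vec
      simp [bracket_def, form_lie_right, lie_lie]
      linarith
    · simp [bracket_def, lie_lie]; abel
    · simp [bracket_def]

instance : LieAlgebra ℝ (TrivialExt 𝔤 V) where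
  lie_smul r X Y := by
    refine ext' (fun x => ?_) ?_ ?_
    · simp [bracket_def]; ring
    · simp [bracket_def, smul_sub]
    · simp [bracket_def]

/-- The inner product is invariant, so that the extension is a metric Lie algebra. -/
theorem pair_lie (X Y Z : TrivialExt 𝔤 V) : pair ⁅X, Y⁆ Z = pair X ⁅Y, Z⁆ := by
  have h1 : Z.dual ⁅Y.alg, X.alg⁆ = - Z.dual ⁅X.alg, Y.alg⁆ := by
    rw [← lie_skew, map_neg]
  have h2 : Y.dual ⁅Z.alg, X.alg⁆ = - Y.dual ⁅X.alg, Z.alg⁆ := by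
    rw [← lie_skew, map_neg]
  simp only [pair, bracket_def, dual_mk, vec_mk, alg_mk, form_lie_right, LinearMap.add_apply,
    LinearMap.sub_apply, Module.Dual.lie_apply, vecBracket_apply, map_sub, h1, h2]
  linarith

end

/-- The extension is normed by the choice of linear coordinates (all norms are equivalent, and
nothing depends on this choice). -/
instance {𝔤 V : Type*} [LieRing 𝔤] [LieAlgebra ℝ 𝔤] [AddCommGroup V] [Module ℝ V]
    [Module.Finite ℝ 𝔤] [Module.Finite ℝ V] : NormedAddCommGroup (TrivialExt 𝔤 V) :=
  NormedAddCommGroup.induced (TrivialExt 𝔤 V)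
    (Fin (Module.finrank ℝ (TrivialExt 𝔤 V)) → ℝ)
    (Module.finBasis ℝ (TrivialExt 𝔤 V)).equivFun
    (Module.finBasis ℝ (TrivialExt 𝔤 V)).equivFun.injective

instance {𝔤 V : Type*} [LieRing 𝔤] [LieAlgebra ℝ 𝔤] [AddCommGroup V] [Module ℝ V]
    [Module.Finite ℝ 𝔤] [Module.Finite ℝ V] : NormedSpace ℝ (TrivialExt 𝔤 V) :=
  NormedSpace.induced ℝ (TrivialExt 𝔤 V) (Fin (Module.finrank ℝ (TrivialExt 𝔤 V)) → ℝ)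
    (Module.finBasis ℝ (TrivialExt 𝔤 V)).equivFun.toLinearMap

end TrivialExt

/-! ### The Lie algebra of quadratically extended General Relativity -/

/-- Minkowski space `ℝ^{3,1}`. -/
abbrev Mink : Type := Fin 3 ⊕ Fin 1 → ℝ

/-- The Minkowski metric with signature `(+,+,+,-)`. -/
def minkForm : LinearMap.BilinForm ℝ Mink :=
  Matrix.toBilin' (LieAlgebra.Orthogonal.indefiniteDiagonal (Fin 3) (Fin 1) ℝ)

theorem minkForm_apply (v w : Mink) : minkForm v w =
    v (.inl 0) * w (.inl 0) + v (.inl 1) * w (.inl 1) + v (.inl 2) * w (.inl 2)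
      - v (.inr 0) * w (.inr 0) := by
  simp [minkForm, Matrix.toBilin'_apply', LieAlgebra.Orthogonal.indefiniteDiagonal,
    Matrix.mulVec_diagonal, dotProduct, Fin.sum_univ_succ]
  ring

theorem so31_lie_apply (A : SO31) (v : Mink) : ⁅A, v⁆ = A.1.mulVec v := rfl

/-- `ℝ^{3,1}` as an orthogonal `so(3,1)`-module. -/
instance : OrthogonalLieModule SO31 Mink where
  form := minkForm
  symm v w := by rw [minkForm_apply, minkForm_apply]; ring
  nondegenerate := by
    refine Matrix.Nondegenerate.toBilin' (Matrix.nondegenerate_of_det_ne_zero ?_)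
    simp [LieAlgebra.Orthogonal.indefiniteDiagonal, Matrix.det_diagonal]
  invariant A v w := by
    obtain ⟨f, rfl⟩ := so31Coord.symm.surjective A
    rw [minkForm_apply, minkForm_apply]
    simp [so31Coord, so31OfCoord, Matrix.mulVec, dotProduct, Fin.sum_univ_succ,
      Matrix.fromBlocks]
    ring

/-- `𝔡 = so(3,1)* ⊕ ℝ^{3,1} ⊕ so(3,1)`. -/
abbrev 𝔡 : Type := TrivialExt SO31 Mink


/-- The action of a linear automorphism `T` of `so(3,1)` on `so(3,1)*`, the two spaces being
identified through the Killing form. -/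
def dualAut (T : SO31 ≃ₗ[ℝ] SO31) : Module.Dual ℝ SO31 →ₗ[ℝ] Module.Dual ℝ SO31 :=
  killingIso.toLinearMap ∘ₗ T.toLinearMap ∘ₗ killingIso.symm.toLinearMap

/-! ### Oriented closed three-manifolds with a principal bundle -/

/-- The model of three-manifolds. -/
abbrev E3 : Type := EuclideanSpace ℝ (Fin 3)

/-- Differential `k`-forms on `ℝ³` with values in `𝔡`. -/
abbrev LocalForm (k : ℕ) : Type := E3 → E3 [⋀^Fin k]→L[ℝ] 𝔡

section Bundle

/-- The smoothness that Mathlib requires for the Lie algebra of a Lie group. -/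
instance {E D : Type*} [NormedAddCommGroup E] [NormedSpace ℝ E] [TopologicalSpace D]
    [ChartedSpace E D] [Group D] [LieGroup 𝓘(ℝ, E) ∞ D] :
    LieGroup 𝓘(ℝ, E) (minSmoothness ℝ 3) D :=
  LieGroup.of_le (n := ∞) (by
    rw [minSmoothness_of_isRCLikeNormedField]; exact ENat.LEInfty.out)

variable (E D N ι : Type*) [NormedAddCommGroup E] [NormedSpace ℝ E] [TopologicalSpace D]
  [ChartedSpace E D] [Group D] [TopologicalSpace N] [ChartedSpace E3 N]

/-- An orientation of the smooth three-manifold `N` and a smooth principal `D`-bundle on `N`, given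
by an atlas of oriented charts such that the bundle has a section `sᵢ` over the domain of the `i`-th
chart, and the transition functions `g i j` with `s j = s i * g i j`. -/
structure BundleAtlas where
  chart : ι → OpenPartialHomeomorph N E3
  chart_mem : ∀ i, chart i ∈ IsManifold.maximalAtlas (𝓡 3) ∞ N
  cover : ∀ x, ∃ i, x ∈ (chart i).source
  oriented : ∀ i j, ∀ y ∈ (chart j).target, (chart j).symm y ∈ (chart i).source →
    0 < (fderiv ℝ (fun z => chart i ((chart j).symm z)) y).det
  g : ι → ι → N → D
  smooth_g : ∀ i j,
    ContMDiffOn (𝓡 3) 𝓘(ℝ, E) ∞ (g i j) ((chart i).source ∩ (chart j).source)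
  cocycle : ∀ i j k, ∀ x ∈ (chart i).source ∩ (chart j).source ∩ (chart k).source,
    g i j x * g j k x = g i k x

variable {E D N ι}

namespace BundleAtlas

variable (P : BundleAtlas E D N ι)

/-- The change of coordinates from the `j`-th to the `i`-th chart. -/
def trans (i j : ι) (y : E3) : E3 := P.chart i ((P.chart j).symm y)

/-- The image under the `j`-th chart of the overlap with the domain of the `i`-th chart. -/
def overlap (i j : ι) : Set E3 :=
  {y | y ∈ (P.chart j).target ∧ (P.chart j).symm y ∈ (P.chart i).source}

theorem exists_pou [T2Space N] [CompactSpace N] [IsManifold (𝓡 3) ∞ N] :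
    ∃ χ : SmoothPartitionOfUnity ι (𝓡 3) N Set.univ,
      χ.IsSubordinate fun i => (P.chart i).source :=
  SmoothPartitionOfUnity.exists_isSubordinate (𝓡 3) isClosed_univ _
    (fun i => (P.chart i).open_source) fun x _ => Set.mem_iUnion.2 (P.cover x)

/-- The transition function of the bundle in the coordinates of the `j`-th chart. -/
def gLoc (i j : ι) (y : E3) : D := P.g i j ((P.chart j).symm y)

end BundleAtlas

variable [CompleteSpace E] [LieGroup 𝓘(ℝ, E) ∞ D]

/-- The adjoint action of `D` on `𝔡`, the Lie algebra of `D` being identified with `𝔡` by `Φ`. -/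
def Ad (Φ : GroupLieAlgebra 𝓘(ℝ, E) D ≃ₗ⁅ℝ⁆ 𝔡) (a : D) (X : 𝔡) : 𝔡 :=
  Φ (mfderiv 𝓘(ℝ, E) 𝓘(ℝ, E) (fun b : D => a * b * a⁻¹) 1 (Φ.symm X))

/-- The left logarithmic derivative `h⁻¹ dh` at `y` of a map `h : ℝ³ → D`, applied to `v`. -/
def logDeriv (Φ : GroupLieAlgebra 𝓘(ℝ, E) D ≃ₗ⁅ℝ⁆ 𝔡) (h : E3 → D) (y v : E3) : 𝔡 :=
  Φ (mfderiv 𝓘(ℝ, E3) 𝓘(ℝ, E) (fun z => (h y)⁻¹ * h z) y v)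

namespace BundleAtlas

variable (P : BundleAtlas E D N ι) (Φ : GroupLieAlgebra 𝓘(ℝ, E) D ≃ₗ⁅ℝ⁆ 𝔡)

/-- `k`-forms on `N` with values in the adjoint bundle of `P`: families of smooth `𝔡`-valued forms
on the chart domains, extended by zero, that transform by `η j = Ad((g i j)⁻¹) η i`. -/
def IsAdForm {k : ℕ} (η : ι → LocalForm k) : Prop :=
  (∀ i, ContDiffOn ℝ ∞ (η i) (P.chart i).target) ∧
  (∀ i, ∀ y ∉ (P.chart i).target, η i y = 0) ∧
  ∀ i j, ∀ y ∈ P.overlap i j, ∀ v : Fin k → E3,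
    η j y v = Ad Φ (P.gLoc i j y)⁻¹
      (η i (P.trans i j y) (fun a => fderiv ℝ (P.trans i j) y (v a)))

/-- Principal connections on `P`: families of smooth `𝔡`-valued one-forms on the chart domains,
extended by zero, that transform by `A j = Ad((g i j)⁻¹) A i + (g i j)⁻¹ d(g i j)`. -/
def IsConnection (A : ι → LocalForm 1) : Prop :=
  (∀ i, ContDiffOn ℝ ∞ (A i) (P.chart i).target) ∧
  (∀ i, ∀ y ∉ (P.chart i).target, A i y = 0) ∧
  ∀ i j, ∀ y ∈ P.overlap i j, ∀ v : E3,
    A j y ![v] = Ad Φ (P.gLoc i j y)⁻¹ (A i (P.trans i j y) ![fderiv ℝ (P.trans i j) y v])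
      + logDeriv Φ (P.gLoc i j) y v

end BundleAtlas

/-- Boundary fields `(𝔸, 𝔹)`, and also their variations, in terms of local representatives. -/
abbrev Config (ι : Type*) : Type _ := (ι → LocalForm 1) × (ι → LocalForm 2)

/-- Lagrange multipliers `(𝕒, ℍ)` in terms of local representatives. -/
abbrev Multiplier (ι : Type*) : Type _ := (ι → LocalForm 0) × (ι → LocalForm 1)

namespace BundleAtlas

variable (P : BundleAtlas E D N ι) (Φ : GroupLieAlgebra 𝓘(ℝ, E) D ≃ₗ⁅ℝ⁆ 𝔡)

/-- The geometric phase space: pairs of a connection on `P` and an adjoint-valued two-form. -/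
def phaseSpace : Set (Config ι) := {φ | P.IsConnection Φ φ.1 ∧ P.IsAdForm Φ φ.2}

/-- The tangent space of the phase space (the same at all points). -/
def tangent : Set (Config ι) := {X | P.IsAdForm Φ X.1 ∧ P.IsAdForm Φ X.2}

/-- The Lagrange multipliers `(𝕒, ℍ)`, an adjoint-valued function and one-form. -/
def multipliers : Set (Multiplier ι) := {l | P.IsAdForm Φ l.1 ∧ P.IsAdForm Φ l.2}

end BundleAtlas

/-! ### Integration over the closed oriented three-manifold -/

namespace BundleAtlas

variable [Fintype ι] [T2Space N] [CompactSpace N] [IsManifold (𝓡 3) ∞ N]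
  (P : BundleAtlas E D N ι)

/-- A partition of unity subordinate to the atlas. -/
def pou : SmoothPartitionOfUnity ι (𝓡 3) N Set.univ := P.exists_pou.choose

/-- The integral over `N` of the three-form that is `ρ i dy₀ ∧ dy₁ ∧ dy₂` in the `i`-th chart. -/
def integral (ρ : ι → E3 → ℝ) : ℝ :=
  ∑ i, ∫ y in (P.chart i).target, P.pou i ((P.chart i).symm y) * ρ i y

end BundleAtlas

/-- The standard basis of `ℝ³`. -/
def e (a : Fin 3) : E3 := EuclideanSpace.single a 1

/-- Sum over the cyclic permutations of the three indices. If `ω` is a two-form and `η` a one-form,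
the wedge product of `ω` and `η` with respect to a bilinear product `*` has the value
`cyc fun a b c => ω (e a, e b) * η (e c)` on the standard basis. -/
def cyc {R : Type*} [Add R] (f : Fin 3 → Fin 3 → Fin 3 → R) : R := f 0 1 2 + f 1 2 0 + f 2 0 1

/-! ### Constraints of `BF + Λ BB` theory for `𝔡` -/

namespace BF

open TrivialExt

/-- The curvature `F_𝔸 = d𝔸 + ½[𝔸, 𝔸]`. -/
def curvature (A : LocalForm 1) (y v w : E3) : 𝔡 :=
  extDeriv A y ![v, w] + ⁅A y ![v], A y ![w]⁆

/-- The value of `d_𝔸 𝔹 = d𝔹 + [𝔸, 𝔹]` on the standard basis. -/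
def covDeriv (A : LocalForm 1) (B : LocalForm 2) (y : E3) : 𝔡 :=
  extDeriv B y ![e 0, e 1, e 2] + cyc fun a b c => ⁅A y ![e c], B y ![e a, e b]⁆

variable [Fintype ι] [T2Space N] [CompactSpace N] [IsManifold (𝓡 3) ∞ N]
  (P : BundleAtlas E D N ι)

/-- `J_𝕒 = ∫ ⟨d_𝔸 𝔹, 𝕒⟩`. -/
def J (a : ι → LocalForm 0) (φ : Config ι) : ℝ :=
  P.integral fun i y => pair (covDeriv (φ.1 i) (φ.2 i) y) (a i y ![])

/-- `L_ℍ = ∫ ⟨F_𝔸 + Λ 𝔹, ℍ⟩`. -/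
def L (Λ : ℝ) (h : ι → LocalForm 1) (φ : Config ι) : ℝ :=
  P.integral fun i y => cyc fun a b c =>
    pair (curvature (φ.1 i) y (e a) (e b) + Λ • φ.2 i y ![e a, e b]) (h i y ![e c])

end BF

/-! ### Constraints of quadratically extended General Relativity

The fields have the components `𝔸 = (A, e, S)` and `𝔹 = (B, τ, c)` with `A, c` in `so(3,1)`, with
`e, τ` in `ℝ^{3,1}` and `S, B` in `so(3,1)*`; the multipliers are `𝕒 = (θ, ε, σ)` and
`ℍ = (α, ρ, ζ)` with `θ, α` in `so(3,1)`, with `ε, ρ` in `ℝ^{3,1}` and `σ, ζ` in `so(3,1)*`. -/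

namespace GR

open TrivialExt

section
variable (𝔸 : LocalForm 1) (𝔹 : LocalForm 2) (y : E3)

/-- `d_A B + [e, τ] - [c, S]` on the standard basis. -/
def gaussDual : Module.Dual ℝ SO31 :=
  (extDeriv 𝔹 y ![e 0, e 1, e 2]).dual + cyc fun a b c =>
    ⁅(𝔸 y ![e c]).alg, (𝔹 y ![e a, e b]).dual⁆
      + vecBracket (𝔸 y ![e c]).vec (𝔹 y ![e a, e b]).vec
      - ⁅(𝔹 y ![e a, e b]).alg, (𝔸 y ![e c]).dual⁆

/-- `d_A τ` on the standard basis. -/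
def dTau : Mink :=
  (extDeriv 𝔹 y ![e 0, e 1, e 2]).vec + cyc fun a b c =>
    ⁅(𝔸 y ![e c]).alg, (𝔹 y ![e a, e b]).vec⁆

/-- `c • e`, the wedge product with respect to the action, on the standard basis. -/
def cAct : Mink := cyc fun a b c => ⁅(𝔹 y ![e a, e b]).alg, (𝔸 y ![e c]).vec⁆

/-- `d_A c` on the standard basis. -/
def dC : SO31 :=
  (extDeriv 𝔹 y ![e 0, e 1, e 2]).alg + cyc fun a b c =>
    ⁅(𝔸 y ![e c]).alg, (𝔹 y ![e a, e b]).alg⁆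

/-- The curvature `F_A = dA + ½[A, A]`. -/
def F (v w : E3) : SO31 :=
  (extDeriv 𝔸 y ![v, w]).alg + ⁅(𝔸 y ![v]).alg, (𝔸 y ![w]).alg⁆

/-- The torsion `d_A e`. -/
def torsion (v w : E3) : Mink :=
  (extDeriv 𝔸 y ![v, w]).vec
    + (⁅(𝔸 y ![v]).alg, (𝔸 y ![w]).vec⁆ - ⁅(𝔸 y ![w]).alg, (𝔸 y ![v]).vec⁆)

/-- `d_A S`. -/
def dS (v w : E3) : Module.Dual ℝ SO31 :=
  (extDeriv 𝔸 y ![v, w]).dual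
    + (⁅(𝔸 y ![v]).alg, (𝔸 y ![w]).dual⁆ - ⁅(𝔸 y ![w]).alg, (𝔸 y ![v]).dual⁆)

/-- `½[e, e]`. -/
def halfEE (v w : E3) : Module.Dual ℝ SO31 := vecBracket (𝔸 y ![v]).vec (𝔸 y ![w]).vec

end

variable [Fintype ι] [T2Space N] [CompactSpace N] [IsManifold (𝓡 3) ∞ N]
  (P : BundleAtlas E D N ι)

/-- `H_θ = ∫ ⟨d_A B + [e, τ] - [c, S], θ⟩`. -/
def H (a : ι → LocalForm 0) (φ : Config ι) : ℝ :=
  P.integral fun i y => gaussDual (φ.1 i) (φ.2 i) y (a i y ![]).alg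

/-- `I_ε = ∫ η(d_A τ, ε) - η(c • e, ε)`. -/
def I (a : ι → LocalForm 0) (φ : Config ι) : ℝ :=
  P.integral fun i y => minkForm (dTau (φ.1 i) (φ.2 i) y) (a i y ![]).vec
    - minkForm (cAct (φ.1 i) (φ.2 i) y) (a i y ![]).vec

/-- `J_σ = ∫ ⟨d_A c, σ⟩`. -/
def J (a : ι → LocalForm 0) (φ : Config ι) : ℝ :=
  P.integral fun i y => (a i y ![]).dual (dC (φ.1 i) (φ.2 i) y)

/-- `K_α = ∫ ⟨(id + β T) B + d_A S + ½[e, e], α⟩`. -/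
def K (β : ℝ) (T : SO31 ≃ₗ[ℝ] SO31) (h : ι → LocalForm 1) (φ : Config ι) : ℝ :=
  P.integral fun i y => cyc fun a b c =>
    ((φ.2 i y ![e a, e b]).dual + β • dualAut T (φ.2 i y ![e a, e b]).dual
      + dS (φ.1 i) y (e a) (e b) + halfEE (φ.1 i) y (e a) (e b)) (h i y ![e c]).alg

/-- `L_ρ = ∫ η(d_A e + (1 + β) τ, ρ)`. -/
def L (β : ℝ) (h : ι → LocalForm 1) (φ : Config ι) : ℝ :=
  P.integral fun i y => cyc fun a b c =>
    minkForm (torsion (φ.1 i) y (e a) (e b) + (1 + β) • (φ.2 i y ![e a, e b]).vec)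
      (h i y ![e c]).vec

/-- `M_ζ = ∫ ⟨F_A + (id + β T) c, ζ⟩`. -/
def M (β : ℝ) (T : SO31 ≃ₗ[ℝ] SO31) (h : ι → LocalForm 1) (φ : Config ι) : ℝ :=
  P.integral fun i y => cyc fun a b c =>
    (h i y ![e c]).dual (F (φ.1 i) y (e a) (e b) + (φ.2 i y ![e a, e b]).alg
      + β • T (φ.2 i y ![e a, e b]).alg)

/-- The constraint of quadratically extended General Relativity with multipliers `(𝕒, ℍ)`. The six
families of constraints are obtained from multipliers with a single nonzero component. -/
def constraint (β : ℝ) (T : SO31 ≃ₗ[ℝ] SO31) (l : Multiplier ι) (φ : Config ι) : ℝ :=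
  H P l.1 φ + I P l.1 φ + J P l.1 φ + K P β T l.2 φ + L P β l.2 φ + M P β T l.2 φ

end GR

/-! ### First-class constraints and local degrees of freedom -/

namespace BundleAtlas

open TrivialExt Filter Topology

variable (P : BundleAtlas E D N ι) (Φ : GroupLieAlgebra 𝓘(ℝ, E) D ≃ₗ⁅ℝ⁆ 𝔡)

/-- The `k`-jet of a pair of forms, in the `i`-th chart and trivialisation, at the point with
coordinates `y`: all derivatives up to order `k`. -/
def jet (k : ℕ) (i : ι) (y : E3) (X : Config ι) :
    (∀ m : Fin (k + 1), E3 [×(m : ℕ)]→L[ℝ] (E3 [⋀^Fin 1]→L[ℝ] 𝔡)) ×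
      (∀ m : Fin (k + 1), E3 [×(m : ℕ)]→L[ℝ] (E3 [⋀^Fin 2]→L[ℝ] 𝔡)) :=
  (fun m => iteratedFDeriv ℝ m (X.1 i) y, fun m => iteratedFDeriv ℝ m (X.2 i) y)

/-- A space `W` of pairs of forms on `N` has `n` local degrees of freedom: at every point, the
dimension of the space of `k`-jets of elements of `W` grows like `n` times the dimension
`(k + 3).choose 3` of the space of `k`-jets of real functions, i.e. the elements of `W` depend on
`n` arbitrary functions of three variables. -/
def HasLocalDim (W : Set (Config ι)) (n : ℕ) : Prop :=
  ∀ i, ∀ y ∈ (P.chart i).target,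
    Tendsto (fun k : ℕ => (Set.finrank ℝ (jet k i y '' W) : ℝ) / ((k + 3).choose 3 : ℝ))
      atTop (𝓝 n)

variable [Fintype ι] [T2Space N] [CompactSpace N] [IsManifold (𝓡 3) ∞ N]

/-- The symplectic form `∫ ⟨δ𝔹, δ𝔸⟩`, that is `∫ ⟨δB, δA⟩ + η(δτ, δe) + ⟨δc, δS⟩`. -/
def symplectic (X Y : Config ι) : ℝ :=
  P.integral fun i y => cyc fun a b c =>
    pair (X.2 i y ![e a, e b]) (Y.1 i y ![e c]) - pair (Y.2 i y ![e a, e b]) (X.1 i y ![e c])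

variable (C : Multiplier ι → Config ι → ℝ)

/-- The common zero locus of a family `C` of constraints in the phase space. -/
def constraintSurface : Set (Config ι) :=
  {φ | φ ∈ P.phaseSpace Φ ∧ ∀ l ∈ P.multipliers Φ, C l φ = 0}

/-- `X` is the value at `φ` of the Hamiltonian vector field of a functional `f`. -/
def IsHamiltonianVector (f : Config ι → ℝ) (φ X : Config ι) : Prop :=
  X ∈ P.tangent Φ ∧
    ∀ Y ∈ P.tangent Φ, HasDerivAt (fun t : ℝ => f (φ + t • Y)) (P.symplectic X Y) 0

/-- `X` is the value at `φ` of the Hamiltonian vector field of `C l`, and the Poisson brackets of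
`C l` with all the constraints vanish at `φ` (the bracket with `C l'` is the derivative of `C l'`
along `X`). -/
def IsFirstClassVector (l : Multiplier ι) (φ X : Config ι) : Prop :=
  P.IsHamiltonianVector Φ (C l) φ X ∧
    ∀ l' ∈ P.multipliers Φ, HasDerivAt (fun t : ℝ => C l' (φ + t • X)) 0 0

/-- The constraint set is first class: on the constraint surface, all the Poisson brackets of
constraints are defined and vanish. -/
def IsFirstClass : Prop :=
  ∀ φ ∈ P.constraintSurface Φ C, ∀ l ∈ P.multipliers Φ, ∃ X, P.IsFirstClassVector Φ C l φ X

/-- The phase space has `d` local degrees of freedom, and the numbers of independent local first-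
and second-class constraints are `c₁` and `c₂`. Independence is that of the differentials at the
points of the constraint surface, equivalently that of the Hamiltonian vectors. -/
def LocalCounts (d c₁ c₂ : ℕ) : Prop :=
  P.HasLocalDim (P.tangent Φ) d ∧
  ∀ φ ∈ P.constraintSurface Φ C,
    P.HasLocalDim {X | ∃ l ∈ P.multipliers Φ, P.IsFirstClassVector Φ C l φ X} c₁ ∧
    P.HasLocalDim {X | ∃ l ∈ P.multipliers Φ, P.IsHamiltonianVector Φ (C l) φ X} (c₁ + c₂)

/-- The theory with the constraints `C` is topological: `d = 2 c₁ + c₂`. -/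
def IsTopological : Prop :=
  ∃ d c₁ c₂ : ℕ, P.LocalCounts Φ C d c₁ c₂ ∧ d = 2 * c₁ + c₂

end BundleAtlas

end Bundle

end QEGR

end

open scoped Manifold ContDiff
noncomputable section
namespace QEGR
open Filter Topology

section Shortcuts

/-! In the metric Lie algebra `𝔡` the component in `so(3,1)*` pairs with the component in `so(3,1)`,
and the vector components pair with each other. Splitting the multipliers `𝕒` and `ℍ` into their
three components therefore splits the two constraints of `BF + Λ BB` theory, `Λ = 1 + β`, into three
each. With `βT = β id` these are the six constraints of qeGR (`gauss_eq`,
`curvature_constraint_eq`). Everything else is proved for `BF + Λ BB`, uniformly in `Λ`, including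
`Λ = 0`.

A constraint is an exact quadratic polynomial along each line in the phase space. Integrating its
first variation by parts shows that its Hamiltonian vector is the `flow` `(d_A 𝕒 - Λℍ, [𝔹, 𝕒] + d_A
ℍ)` (`integral_firstVariation`), and nondegeneracy of the symplectic form makes this vector unique.
On the constraint surface `F + Λ𝔹 = 0` and `d_A 𝔹 = 0` hold pointwise, by the fundamental lemma of
the calculus of variations. Then `d_A² = [F, ·]` shows that the flow solves the linearised field
equations (`covD_flow_fst`, `covD_flow_snd`), so all Poisson brackets vanish.

Fields are families of local representatives, so every global statement needs gauge covariance of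
`d_A` and `F`. This rests on the derivative of `Ad` being the Lie bracket (`fderiv_localAd`,
`lieBracket_locMul`). Covariance of `F` then follows from that of `d_A`, because `[F, a] = d_A d_A
a` and `𝔡` has trivial center. `Ad`-invariance of the inner product makes the integrands into
densities, so Stokes' theorem can be applied chart by chart.

Counting: `dim 𝔡 = 16`, so the tangent space has `(3 + 3) · 16 = 96` free components. The
multipliers have `64`, but on shell the flow is unchanged under `𝕒 ↦ 𝕒 + Λf`, `ℍ ↦ ℍ + d_A f`, which
suggests `64 - 16 = 48` independent flows. The proof squeezes this number. From above, the
linearised equations express the derivative along `e 0` of three of the six components of a flow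
through the other components, so those three matter only on a surface (`flow_mem_vanishing`). From
below, multipliers with `ℍ(e 0) = 0` are determined by their flow up to data on a surface
(`multiplier_mem_vanishing`). Surface data contribute to `k`-jets at order `(k + 2).choose 2`, which
is negligible against `(k + 3).choose 3`. -/

instance : NormedAddCommGroup 𝔡 := inferInstance
instance : NormedSpace ℝ 𝔡 := inferInstance
instance : Module.Finite ℝ 𝔡 := inferInstance
instance : SeminormedAddCommGroup 𝔡 := inferInstance
instance : TopologicalSpace 𝔡 := inferInstance
instance : IsTopologicalAddGroup 𝔡 := inferInstance
instance : ContinuousSMul ℝ 𝔡 := inferInstance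
instance : Module ℝ 𝔡 := inferInstance
instance : AddCommGroup 𝔡 := inferInstance
instance : AddCommMonoid 𝔡 := inferInstance

end Shortcuts

/-! ### The adjoint action of a local Lie group. -/

section LocalGroup
variable {E : Type*} [NormedAddCommGroup E] [NormedSpace ℝ E]

theorem contDiffAt_fderiv_partial_right {f : E → E → E} {o : E}
    (hf : ContDiffAt ℝ ∞ (fun p : E × E => f p.1 p.2) (o, o)) :
    ContDiffAt ℝ ∞ (fun x => fderiv ℝ (fun y => f x y) o) o :=
  ContDiffAt.fderiv (n := ∞) (m := ∞) (f := f) (g := fun _ => o) hf contDiffAt_const (by simp)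

/-- Being `C^n` at a point is an open condition only for finite `n`, so the order is lowered from
`∞` to `2`, enough for second derivatives. -/
theorem eventually_contDiffAt_right {f : E → E → E} {o : E}
    (hf : ContDiffAt ℝ ∞ (fun p : E × E => f p.1 p.2) (o, o)) :
    ∀ᶠ x in 𝓝 o, ContDiffAt ℝ 2 (fun p : E × E => f p.1 p.2) (x, o) := by
  have h2 : ContDiffAt ℝ 2 (fun p : E × E => f p.1 p.2) (o, o) := hf.of_le ENat.LEInfty.out
  have h := h2.eventually (by simp)
  have hc : Tendsto (fun x : E => (x, o)) (𝓝 o) (𝓝 (o, o)) :=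
    Continuous.tendsto' (by fun_prop) _ _ rfl
  exact hc.eventually h

/-- The derivative of the adjoint action of a local Lie group is the Lie bracket of the
left-invariant vector fields. -/
theorem fderiv_localAd {m c : E → E → E} {o : E}
    (hm : ContDiffAt ℝ ∞ (fun p : E × E => m p.1 p.2) (o, o))
    (hc : ContDiffAt ℝ ∞ (fun p : E × E => c p.1 p.2) (o, o))
    (hmc : ∀ᶠ p in 𝓝 (o, o), m (c p.1 p.2) p.1 = m p.1 p.2)
    (hco : ∀ᶠ x in 𝓝 o, c x o = o) (hoc : ∀ᶠ y in 𝓝 o, c o y = y)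
    (hmo : ∀ᶠ x in 𝓝 o, m x o = x) (ξ Z : E) :
    fderiv ℝ (fun x => fderiv ℝ (fun y => c x y) o) o ξ Z =
      fderiv ℝ (fun x => fderiv ℝ (fun y => m x y) o Z) o ξ -
      fderiv ℝ (fun x => fderiv ℝ (fun y => m x y) o ξ) o Z := by
  set M : E × E → E := fun p => m p.1 p.2 with hM
  have hm2 : ContDiffAt ℝ 2 M (o, o) := hm.of_le ENat.LEInfty.out
  have hM' : ContDiffAt ℝ 1 (fderiv ℝ M) (o, o) := hm2.fderiv_right (by norm_num)
  have hMd : HasFDerivAt (fderiv ℝ M) (fderiv ℝ (fderiv ℝ M) (o, o)) (o, o) :=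
    (hM'.differentiableAt (by simp)).hasFDerivAt
  have hsymm : IsSymmSndFDerivAt ℝ M (o, o) := hm2.isSymmSndFDerivAt (by simp)
  have hswap : ContDiffAt ℝ ∞ (fun p : E × E => m p.2 p.1) (o, o) :=
    hm.comp (o, o) (f := fun p : E × E => (p.2, p.1)) (by fun_prop)
  have hA := contDiffAt_fderiv_partial_right hc
  have hL := contDiffAt_fderiv_partial_right hm
  have hR : ContDiffAt ℝ ∞ (fun x => fderiv ℝ (fun y => m y x) o) o :=
    contDiffAt_fderiv_partial_right (f := fun x y => m y x) hswap
  -- partial derivatives in terms of the full derivative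
  have hLM : ∀ᶠ x in 𝓝 o, fderiv ℝ (fun y => m x y) o =
      (fderiv ℝ M (x, o)).comp (ContinuousLinearMap.inr ℝ E E) := by
    filter_upwards [eventually_contDiffAt_right hm] with x hx
    have h := HasFDerivAt.comp (g := M) (f := fun y : E => (x, y)) o (hx.differentiableAt (by simp)).hasFDerivAt
      ((hasFDerivAt_const x o).prodMk (hasFDerivAt_id o))
    exact (h.congr_fderiv (by ext; simp [M])).fderiv
  have hRM : ∀ᶠ x in 𝓝 o, fderiv ℝ (fun y => m y x) o =
      (fderiv ℝ M (o, x)).comp (ContinuousLinearMap.inl ℝ E E) := by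
    have hc : Tendsto (fun x : E => (o, x)) (𝓝 o) (𝓝 (o, o)) :=
      Continuous.tendsto' (by fun_prop) _ _ rfl
    filter_upwards [hc.eventually (hm2.eventually (by simp))] with x hx
    have h := HasFDerivAt.comp (g := M) (f := fun y : E => (y, x)) o (hx.differentiableAt (by simp)).hasFDerivAt
      ((hasFDerivAt_id o).prodMk (hasFDerivAt_const x o))
    exact (h.congr_fderiv (by ext; simp)).fderiv
  -- `hL'` and `hR'` are the two mixed second derivatives of the product at `(o, o)`; they differ
  -- only in the order of the two arguments.
  have hL' : ∀ u v, fderiv ℝ (fun x => fderiv ℝ (fun y => m x y) o v) o u =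
      fderiv ℝ (fderiv ℝ M) (o, o) (u, 0) (0, v) := by
    intro u v
    have h1 : (fun x => fderiv ℝ (fun y => m x y) o v) =ᶠ[𝓝 o] fun x => fderiv ℝ M (x, o) (0, v) := by
      filter_upwards [hLM] with x hx
      rw [hx]; simp
    rw [h1.fderiv_eq]
    have h2 : HasFDerivAt (fun x : E => (x, o)) (ContinuousLinearMap.inl ℝ E E) o :=
      ((hasFDerivAt_id o).prodMk (hasFDerivAt_const o o)).congr_fderiv (by ext <;> simp)
    have h3 := (HasFDerivAt.comp (f := fun x : E => (x, o)) o hMd h2).clm_apply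
      (hasFDerivAt_const ((0 : E), v) o)
    exact (congrArg (fun T : E →L[ℝ] E => T u) h3.fderiv).trans (by simp)
  have hR' : ∀ u v, fderiv ℝ (fun x => fderiv ℝ (fun y => m y x) o v) o u =
      fderiv ℝ (fderiv ℝ M) (o, o) (0, u) (v, 0) := by
    intro u v
    have h1 : (fun x => fderiv ℝ (fun y => m y x) o v) =ᶠ[𝓝 o] fun x => fderiv ℝ M (o, x) (v, 0) := by
      filter_upwards [hRM] with x hx
      rw [hx]; simp
    rw [h1.fderiv_eq]
    have h2 : HasFDerivAt (fun x : E => (o, x)) (ContinuousLinearMap.inr ℝ E E) o :=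
      ((hasFDerivAt_const o o).prodMk (hasFDerivAt_id o)).congr_fderiv (by ext <;> simp)
    have h3 := (HasFDerivAt.comp (f := fun x : E => (o, x)) o hMd h2).clm_apply
      (hasFDerivAt_const (v, (0 : E)) o)
    exact (congrArg (fun T : E →L[ℝ] E => T u) h3.fderiv).trans (by simp)
  -- the relation between the adjoint action and the two translations
  have hrel : ∀ᶠ x in 𝓝 o, (fderiv ℝ (fun y => m y x) o).comp (fderiv ℝ (fun y => c x y) o) =
      fderiv ℝ (fun y => m x y) o := by
    -- The relation must hold for all `y` near `o` at fixed `x` before it can be differentiated in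
    -- `y`.
    have h1 : ∀ᶠ x in 𝓝 o, ∀ᶠ p in 𝓝 (x, o), m (c p.1 p.2) p.1 = m p.1 p.2 := by
      have hc : Tendsto (fun x : E => (x, o)) (𝓝 o) (𝓝 (o, o)) :=
        Continuous.tendsto' (by fun_prop) _ _ rfl
      exact hc.eventually hmc.eventually_nhds
    have hc' : Tendsto (fun x : E => (o, x)) (𝓝 o) (𝓝 (o, o)) :=
      Continuous.tendsto' (by fun_prop) _ _ rfl
    filter_upwards [h1, hco, eventually_contDiffAt_right hc,
      hc'.eventually (hm2.eventually (by simp))] with x hx hxo hcx hmx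
    have h2 : ∀ᶠ y in 𝓝 o, m (c x y) x = m x y :=
      (Continuous.tendsto' (f := fun y : E => (x, y)) (by fun_prop) _ _ rfl).eventually hx
    have hcd : DifferentiableAt ℝ (fun y => c x y) o :=
      (hcx.differentiableAt (by simp)).comp o (f := fun y => (x, y)) (by fun_prop)
    have hmd : DifferentiableAt ℝ (fun y => m y x) (c x o) := by
      rw [hxo]
      exact (hmx.differentiableAt (by simp)).comp o (f := fun y => (y, x)) (by fun_prop)
    have h3 := fderiv_comp o hmd hcd
    rw [hxo] at h3
    rw [← h3]
    exact (EventuallyEq.fderiv_eq (f₁ := (fun y => m y x) ∘ fun y => c x y) h2)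
  have hA0 : fderiv ℝ (fun y => c o y) o = ContinuousLinearMap.id ℝ E := by
    rw [EventuallyEq.fderiv_eq (f := id) hoc]; exact fderiv_id
  have hR0 : fderiv ℝ (fun y => m y o) o = ContinuousLinearMap.id ℝ E := by
    rw [EventuallyEq.fderiv_eq (f := id) hmo]; exact fderiv_id
  -- Differentiating `R_x ∘ Ad_x = L_x` at `x = o`, where `R` and `Ad` are the identity, gives `dL =
  -- dAd + dR` (`key` below).
  have hd := ((hR.differentiableAt (by simp)).hasFDerivAt.clm_comp
    (hA.differentiableAt (by simp)).hasFDerivAt)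
  have hd2 := hd.congr_of_eventuallyEq (f₁ := fun x => fderiv ℝ (fun y => m x y) o)
    (by filter_upwards [hrel] with x hx using hx.symm)
  have hLd : fderiv ℝ (fun x => fderiv ℝ (fun y => m x y) o Z) o ξ =
      fderiv ℝ (fun x => fderiv ℝ (fun y => m x y) o) o ξ Z := by
    rw [fderiv_clm_apply (hL.differentiableAt (by simp)) (differentiableAt_const _)]
    simp
  have hRd : fderiv ℝ (fun x => fderiv ℝ (fun y => m y x) o Z) o ξ =
      fderiv ℝ (fun x => fderiv ℝ (fun y => m y x) o) o ξ Z := by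
    rw [fderiv_clm_apply (hR.differentiableAt (by simp)) (differentiableAt_const _)]
    simp
  have key : fderiv ℝ (fun x => fderiv ℝ (fun y => m x y) o) o ξ Z =
      fderiv ℝ (fun x => fderiv ℝ (fun y => c x y) o) o ξ Z +
      fderiv ℝ (fun x => fderiv ℝ (fun y => m y x) o) o ξ Z := by
    rw [hd2.fderiv]
    simp [hA0, hR0]
  -- Symmetry of the second derivative turns the right-translation term into a left-translation term
  -- with `ξ` and `Z` exchanged.
  rw [hLd, key, ← hRd, hR', hL', hsymm.eq (Z, 0) (0, ξ)]
  abel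

end LocalGroup
end QEGR
end

open scoped Manifold ContDiff
noncomputable section
namespace QEGR
open Filter Topology

/-! ### The bracket of a Lie group in the chart at the identity. -/

section LieGroupChart
set_option linter.unusedSectionVars false
variable {E D : Type*} [NormedAddCommGroup E] [NormedSpace ℝ E] [TopologicalSpace D]
    [ChartedSpace E D] [Group D]

variable (D) in
/-- A vector of the model space as an element of the Lie algebra. -/
def toLie (v : E) : GroupLieAlgebra 𝓘(ℝ, E) D := v

variable (E D) in
/-- The chart of a Lie group at the identity. -/
def chartOne : OpenPartialHomeomorph D E := chartAt E (1 : D)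

theorem extChartAt_one : extChartAt 𝓘(ℝ, E) (1 : D) = (chartOne E D).toPartialEquiv := by
  simp [chartOne, extChartAt]

theorem one_mem_chartOne : (1 : D) ∈ (chartOne E D).source := mem_chart_source E 1

/-- Since `f` fixes `1`, the same chart is used at the source and at the target. -/
theorem mfderiv_at_one {f : D → D} (hf : MDifferentiableAt 𝓘(ℝ, E) 𝓘(ℝ, E) f 1) (h1 : f 1 = 1) :
    (mfderiv 𝓘(ℝ, E) 𝓘(ℝ, E) f 1 : E →L[ℝ] E) =
      fderiv ℝ (fun y => chartOne E D (f ((chartOne E D).symm y))) (chartOne E D 1) := by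
  refine (MDifferentiableAt.mfderiv hf).trans ?_
  rw [writtenInExtChartAt, h1, extChartAt_one]
  simp only [modelWithCornersSelf_coe, Set.range_id, fderivWithin_univ]
  rfl

variable [LieGroup 𝓘(ℝ, E) ∞ D]

theorem mdifferentiableAt_conj (a b : D) :
    MDifferentiableAt 𝓘(ℝ, E) 𝓘(ℝ, E) (fun b : D => a * b * a⁻¹) b := by
  have h : ContMDiff 𝓘(ℝ, E) 𝓘(ℝ, E) ∞ (fun b : D => a * b * a⁻¹) :=
    (contMDiff_const.mul contMDiff_id).mul contMDiff_const
  exact h.contMDiffAt.mdifferentiableAt (by simp)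

variable (E D) in
/-- Multiplication in the chart at the identity. -/
def locMul (x y : E) : E :=
  chartOne E D ((chartOne E D).symm x * (chartOne E D).symm y)

variable (E D) in
/-- Conjugation in the chart at the identity. -/
def locConj (x y : E) : E :=
  chartOne E D ((chartOne E D).symm x * (chartOne E D).symm y * ((chartOne E D).symm x)⁻¹)

theorem chartOne_symm_one : (chartOne E D).symm (chartOne E D 1) = 1 :=
  (chartOne E D).left_inv one_mem_chartOne

theorem contMDiffAt_chartOne_symm :
    ContMDiffAt 𝓘(ℝ, E) 𝓘(ℝ, E) ∞ (chartOne E D).symm (chartOne E D 1) := by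
  have : IsManifold 𝓘(ℝ, E) ∞ D := inferInstance
  exact (contMDiffOn_chart_symm (x := (1 : D))).contMDiffAt
    ((chartOne E D).open_target.mem_nhds ((chartOne E D).map_source one_mem_chartOne))

theorem contMDiffAt_chartOne {a : D} (ha : a ∈ (chartOne E D).source) :
    ContMDiffAt 𝓘(ℝ, E) 𝓘(ℝ, E) ∞ (chartOne E D) a := by
  have : IsManifold 𝓘(ℝ, E) ∞ D := inferInstance
  exact (contMDiffOn_chart (x := (1 : D))).contMDiffAt ((chartOne E D).open_source.mem_nhds ha)

theorem contDiffAt_locMul :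
    ContDiffAt ℝ ∞ (fun p : E × E => locMul E D p.1 p.2) (chartOne E D 1, chartOne E D 1) := by
  rw [← contMDiffAt_iff_contDiffAt]
  have h1 : ContMDiffAt 𝓘(ℝ, E × E) 𝓘(ℝ, E) ∞
      (fun p : E × E => (chartOne E D).symm p.1 * (chartOne E D).symm p.2)
      (chartOne E D 1, chartOne E D 1) :=
    (ContMDiffAt.comp (g := (chartOne E D).symm) (f := Prod.fst) (chartOne E D 1, chartOne E D 1) contMDiffAt_chartOne_symm contDiffAt_fst.contMDiffAt).mul
    (ContMDiffAt.comp (g := (chartOne E D).symm) (f := Prod.snd) (chartOne E D 1, chartOne E D 1) contMDiffAt_chartOne_symm contDiffAt_snd.contMDiffAt)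
  refine ContMDiffAt.comp (g := chartOne E D) _ (contMDiffAt_chartOne ?_) h1
  simp [one_mem_chartOne]

theorem contDiffAt_locConj :
    ContDiffAt ℝ ∞ (fun p : E × E => locConj E D p.1 p.2) (chartOne E D 1, chartOne E D 1) := by
  rw [← contMDiffAt_iff_contDiffAt]
  have hf : ContMDiffAt 𝓘(ℝ, E × E) 𝓘(ℝ, E) ∞
      (fun p : E × E => (chartOne E D).symm p.1) (chartOne E D 1, chartOne E D 1) :=
    (ContMDiffAt.comp (g := (chartOne E D).symm) (f := Prod.fst) (chartOne E D 1, chartOne E D 1) contMDiffAt_chartOne_symm contDiffAt_fst.contMDiffAt)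
  have hs : ContMDiffAt 𝓘(ℝ, E × E) 𝓘(ℝ, E) ∞
      (fun p : E × E => (chartOne E D).symm p.2) (chartOne E D 1, chartOne E D 1) :=
    (ContMDiffAt.comp (g := (chartOne E D).symm) (f := Prod.snd) (chartOne E D 1, chartOne E D 1) contMDiffAt_chartOne_symm contDiffAt_snd.contMDiffAt)
  refine ContMDiffAt.comp (g := chartOne E D) _ (contMDiffAt_chartOne ?_) ((hf.mul hs).mul hf.inv)
  simp [one_mem_chartOne]

theorem continuousAt_chartOne_symm : ContinuousAt (chartOne E D).symm (chartOne E D 1) :=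
  contMDiffAt_chartOne_symm.continuousAt

/-- This holds only near the identity: the conjugate has to stay in the domain of the chart for the
chart and its inverse to cancel. -/
theorem locConj_mul : ∀ᶠ p in 𝓝 (chartOne E D 1, chartOne E D 1),
    locMul E D (locConj E D p.1 p.2) p.1 = locMul E D p.1 p.2 := by
  have : IsTopologicalGroup D := topologicalGroup_of_lieGroup 𝓘(ℝ, E) ∞
  have hc : ContinuousAt (fun p : E × E => (chartOne E D).symm p.1 * (chartOne E D).symm p.2 *
      ((chartOne E D).symm p.1)⁻¹) (chartOne E D 1, chartOne E D 1) := by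
    have hf : ContinuousAt (fun p : E × E => (chartOne E D).symm p.1)
      (chartOne E D 1, chartOne E D 1) := ContinuousAt.comp (f := Prod.fst) continuousAt_chartOne_symm continuousAt_fst
    have hs : ContinuousAt (fun p : E × E => (chartOne E D).symm p.2)
      (chartOne E D 1, chartOne E D 1) := ContinuousAt.comp (f := Prod.snd) continuousAt_chartOne_symm continuousAt_snd
    exact (hf.mul hs).mul hf.inv
  have h := hc.eventually_mem ((chartOne E D).open_source.mem_nhds
    (by simp [one_mem_chartOne]))
  filter_upwards [h] with p hp
  rw [locMul, locConj, (chartOne E D).left_inv hp, locMul]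
  simp

theorem eventually_chartOne_target : ∀ᶠ x in 𝓝 (chartOne E D 1), x ∈ (chartOne E D).target :=
  (chartOne E D).open_target.mem_nhds ((chartOne E D).map_source one_mem_chartOne)

theorem fderiv_locConj (x : E) : (mfderiv 𝓘(ℝ, E) 𝓘(ℝ, E)
      (fun b : D => (chartOne E D).symm x * b * ((chartOne E D).symm x)⁻¹) 1 : E →L[ℝ] E) =
      fderiv ℝ (fun y => locConj E D x y) (chartOne E D 1) :=
  mfderiv_at_one (mdifferentiableAt_conj _ _) (by simp)


/-- The bracket of `GroupLieAlgebra` is the bracket at `1` of left-invariant vector fields. In the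
chart such a field is `x ↦ ∂_y locMul(x, y) v` at the base point, and the bracket of vector fields
is `DW(V) - DV(W)`. -/
theorem lieBracket_locMul [CompleteSpace E] (ξ Z : E) :
    (fderiv ℝ (fun x => fderiv ℝ (fun y => locMul E D x y) (chartOne E D 1) Z) (chartOne E D 1) ξ -
      fderiv ℝ (fun x => fderiv ℝ (fun y => locMul E D x y) (chartOne E D 1) ξ) (chartOne E D 1) Z)
      = ⁅toLie D ξ, toLie D Z⁆ := by
  have : IsManifold 𝓘(ℝ, E) ∞ D := inferInstance
  have : IsManifold 𝓘(ℝ, E) 1 D := IsManifold.of_le (n := ∞) (by simp)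
  have hV : ∀ v : E, (VectorField.mpullbackWithin 𝓘(ℝ, E) 𝓘(ℝ, E)
      (extChartAt 𝓘(ℝ, E) (1 : D)).symm (mulInvariantVectorField (toLie D v)) (Set.range 𝓘(ℝ, E)) : E → E)
      =ᶠ[𝓝 (chartOne E D 1)] fun x => fderiv ℝ (fun y => locMul E D x y) (chartOne E D 1) (v : E) := by
    intro v
    filter_upwards [eventually_chartOne_target] with x hx
    have hx' : x ∈ (extChartAt 𝓘(ℝ, E) (1 : D)).target := by rw [extChartAt_one]; exact hx
    set a := (chartOne E D).symm x with ha
    have has : a ∈ (chartOne E D).source := (chartOne E D).map_target hx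
    -- The pullback of a vector field involves the inverse of the derivative of the inverse chart,
    -- which is the derivative of the chart.
    have h3 : ContinuousLinearMap.inverse (mfderivWithin 𝓘(ℝ, E) 𝓘(ℝ, E) (extChartAt 𝓘(ℝ, E) (1 : D)).symm
        (Set.range 𝓘(ℝ, E)) x) = mfderiv 𝓘(ℝ, E) 𝓘(ℝ, E) (extChartAt 𝓘(ℝ, E) (1 : D))
          ((extChartAt 𝓘(ℝ, E) (1 : D)).symm x) :=
      ContinuousLinearMap.inverse_eq
        (mfderivWithin_extChartAt_symm_comp_mfderiv_extChartAt hx')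
        (mfderiv_extChartAt_comp_mfderivWithin_extChartAt_symm hx')
    refine (congrArg (fun T : E →L[ℝ] E => T _) h3).trans ?_
    have hmul : MDifferentiableAt 𝓘(ℝ, E) 𝓘(ℝ, E) (fun b : D => a * b) 1 :=
      (contMDiff_mul_left (I := 𝓘(ℝ, E)) (n := ∞)).contMDiffAt.mdifferentiableAt (by simp)
    have hch : MDifferentiableAt 𝓘(ℝ, E) 𝓘(ℝ, E) (chartOne E D) (a * 1) := by
      rw [mul_one]
      exact (contMDiffAt_chartOne has).mdifferentiableAt (by simp)
    have h4 := mfderiv_comp (1 : D) hch hmul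
    have h5 : (mfderiv 𝓘(ℝ, E) 𝓘(ℝ, E) (chartOne E D ∘ fun b : D => a * b) 1 : E →L[ℝ] E) =
        fderiv ℝ (fun y => locMul E D x y) (chartOne E D 1) := by
      refine (MDifferentiableAt.mfderiv (hch.comp _ hmul)).trans ?_
      rw [writtenInExtChartAt, extChartAt_one]
      simp only [modelWithCornersSelf_coe, Set.range_id, fderivWithin_univ]
      rfl
    have h6 := congrArg (fun T : E →L[ℝ] E => T v) (h4.symm.trans h5)
    refine Eq.trans ?_ h6
    rw [mul_one]
    rfl
  -- The tangent space at `1` is trivialised by this very chart, so the final transport back to it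
  -- is the identity.
  have h1 : (mfderiv 𝓘(ℝ, E) 𝓘(ℝ, E) (extChartAt 𝓘(ℝ, E) (1 : D)) 1 : E →L[ℝ] E) =
      ContinuousLinearMap.id ℝ E := by
    have hch : MDifferentiableAt 𝓘(ℝ, E) 𝓘(ℝ, E) (extChartAt 𝓘(ℝ, E) (1 : D)) 1 := by
      rw [extChartAt_one]
      exact (contMDiffAt_chartOne one_mem_chartOne).mdifferentiableAt (by simp)
    refine (MDifferentiableAt.mfderiv hch).trans ?_
    rw [writtenInExtChartAt, extChartAt_one]
    simp only [modelWithCornersSelf_coe, Set.range_id, fderivWithin_univ]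
    refine (EventuallyEq.fderiv_eq (f := id) ?_).trans fderiv_id
    filter_upwards [eventually_chartOne_target] with y hy
    exact (chartOne E D).right_inv hy
  symm
  refine (GroupLieAlgebra.bracket_def _ _).trans ?_
  refine (VectorField.mlieBracketWithin_apply).trans ?_
  have h2 : (mfderiv 𝓘(ℝ, E) 𝓘(ℝ, E) (extChartAt 𝓘(ℝ, E) (1 : D)) 1 : E →L[ℝ] E).inverse =
      ContinuousLinearMap.id ℝ E :=
    (congrArg (fun T : E →L[ℝ] E => T.inverse) h1).trans ContinuousLinearMap.inverse_id
  refine (congrArg (fun T : E →L[ℝ] E => T _) h2).trans ?_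
  have hset : (extChartAt 𝓘(ℝ, E) (1 : D)).symm ⁻¹' Set.univ ∩ Set.range 𝓘(ℝ, E) = Set.univ := by simp
  rw [hset]
  have h7 : extChartAt 𝓘(ℝ, E) (1 : D) 1 = chartOne E D 1 := by rw [extChartAt_one]; rfl
  rw [h7]
  refine (congrFun (VectorField.lieBracketWithin_univ (𝕜 := ℝ)) _).trans ?_
  refine (Filter.EventuallyEq.lieBracket_vectorField_eq (hV ξ) (hV Z)).trans ?_
  rw [VectorField.lieBracket]
  -- At the base point the left-invariant field through `v` has the value `v`.
  have h8 : ∀ v : E, fderiv ℝ (fun y => locMul E D (chartOne E D 1) y) (chartOne E D 1) v = v := by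
    intro v
    rw [EventuallyEq.fderiv_eq (f := id), fderiv_id]
    · rfl
    · filter_upwards [eventually_chartOne_target] with y hy
      simp [locMul, chartOne_symm_one, (chartOne E D).right_inv hy]
  rw [h8, h8]

/-- The derivative of the adjoint action in the chart at the identity. -/
theorem fderiv_fderiv_locConj [CompleteSpace E] (ξ Z : E) :
    fderiv ℝ (fun x => fderiv ℝ (fun y => locConj E D x y) (chartOne E D 1)) (chartOne E D 1)
      ξ Z = ⁅toLie D ξ, toLie D Z⁆ := by
  refine (fderiv_localAd contDiffAt_locMul contDiffAt_locConj locConj_mul ?_ ?_ ?_ ξ Z).trans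
    (lieBracket_locMul ξ Z)
  · exact Eventually.of_forall fun x => by simp [locConj, chartOne_symm_one]
  · filter_upwards [eventually_chartOne_target] with y hy
    simp [locConj, chartOne_symm_one, (chartOne E D).right_inv hy]
  · filter_upwards [eventually_chartOne_target] with y hy
    simp [locMul, chartOne_symm_one, (chartOne E D).right_inv hy]

end LieGroupChart
end QEGR
end

open scoped Manifold ContDiff
noncomputable section
namespace QEGR
open Filter Topology

/-! ### Smoothness and derivative of `Ad`, and its compatibility with the bracket. -/

section AdjointAction
set_option linter.unusedSectionVars false
variable {E D : Type*} [NormedAddCommGroup E] [NormedSpace ℝ E] [TopologicalSpace D]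
    [ChartedSpace E D] [Group D] [LieGroup 𝓘(ℝ, E) ∞ D]

/-- The adjoint action on the model space. -/
def conjDeriv (a : D) : E →L[ℝ] E :=
  mfderiv 𝓘(ℝ, E) 𝓘(ℝ, E) (fun b : D => a * b * a⁻¹) 1

theorem conjDeriv_one : conjDeriv (E := E) (1 : D) = ContinuousLinearMap.id ℝ E := by
  have h : (fun b : D => 1 * b * 1⁻¹) = id := by ext; simp
  have h2 : HasMFDerivAt 𝓘(ℝ, E) 𝓘(ℝ, E) (fun b : D => 1 * b * 1⁻¹) 1 (ContinuousLinearMap.id ℝ E) := by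
    rw [h]; exact hasMFDerivAt_id 1
  exact h2.mfderiv

theorem conjDeriv_mul (a b : D) :
    conjDeriv (E := E) (a * b) = (conjDeriv a).comp (conjDeriv b) := by
  have h : (fun x : D => a * b * x * (a * b)⁻¹) = (fun x => a * x * a⁻¹) ∘ fun x => b * x * b⁻¹ := by
    ext x; simp [mul_assoc]
  have h1 : HasMFDerivAt 𝓘(ℝ, E) 𝓘(ℝ, E) (fun x : D => a * x * a⁻¹) (b * 1 * b⁻¹) (conjDeriv (E := E) a) := by
    have : b * 1 * b⁻¹ = 1 := by simp
    rw [this]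
    exact (mdifferentiableAt_conj a 1).hasMFDerivAt
  have h2 := HasMFDerivAt.comp (1 : D) h1 (mdifferentiableAt_conj b 1).hasMFDerivAt
  rw [← h] at h2
  exact h2.mfderiv

theorem conjDeriv_chartOne_symm (x : E) : conjDeriv (E := E) ((chartOne E D).symm x) =
    fderiv ℝ (fun y => locConj E D x y) (chartOne E D 1) := fderiv_locConj x

/-- Near `1` smoothness is seen in the chart; multiplicativity carries it to every other point by
translation. -/
theorem contMDiff_conjDeriv : ContMDiff 𝓘(ℝ, E) 𝓘(ℝ, E →L[ℝ] E) ∞ (conjDeriv : D → E →L[ℝ] E) := by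
  have h1 : ContMDiffAt 𝓘(ℝ, E) 𝓘(ℝ, E →L[ℝ] E) ∞ (conjDeriv : D → E →L[ℝ] E) 1 := by
    have h := ContMDiffAt.comp (1 : D)
      (contDiffAt_fderiv_partial_right (contDiffAt_locConj (E := E) (D := D))).contMDiffAt
      (contMDiffAt_chartOne one_mem_chartOne)
    refine h.congr_of_eventuallyEq ?_
    filter_upwards [(chartOne E D).open_source.mem_nhds one_mem_chartOne] with a ha
    rw [Function.comp_apply, ← conjDeriv_chartOne_symm, (chartOne E D).left_inv ha]
  intro a
  have h2 : (conjDeriv : D → E →L[ℝ] E) = fun b => (conjDeriv a).comp (conjDeriv (a⁻¹ * b)) := by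
    ext1 b
    rw [← conjDeriv_mul]; simp
  rw [h2]
  have h3 : ContMDiffAt 𝓘(ℝ, E) 𝓘(ℝ, E →L[ℝ] E) ∞ (fun b : D => (conjDeriv (a⁻¹ * b) : E →L[ℝ] E)) a := by
    refine ContMDiffAt.comp (g := (conjDeriv : D → E →L[ℝ] E)) (f := fun b : D => a⁻¹ * b) a ?_
      (contMDiff_mul_left (I := 𝓘(ℝ, E)) (n := ∞)).contMDiffAt
    simpa using h1
  exact (contMDiffAt_const (c := (conjDeriv a : E →L[ℝ] E))).clm_comp h3

variable {F : Type*} [NormedAddCommGroup F] [NormedSpace ℝ F]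

variable (E) in
/-- The derivative of a map into a Lie group, with values in the model space. -/
def modelDeriv (k : F → D) (y : F) : F →L[ℝ] E := mfderiv 𝓘(ℝ, F) 𝓘(ℝ, E) k y

theorem modelDeriv_eq_of_eq_one {k : F → D} {y : F} (hk : MDifferentiableAt 𝓘(ℝ, F) 𝓘(ℝ, E) k y)
    (h1 : k y = 1) : modelDeriv E k y =
      fderiv ℝ (fun z => chartOne E D (k z)) y := by
  refine (MDifferentiableAt.mfderiv hk).trans ?_
  rw [writtenInExtChartAt, h1, extChartAt_one]
  simp only [modelWithCornersSelf_coe, Set.range_id, fderivWithin_univ]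
  rfl

/-- As `k y = 1`, the chain rule goes through the chart at the identity, where the derivative of
conjugation is the bracket. -/
theorem fderiv_conjDeriv [CompleteSpace E] {k : F → D} {y : F}
    (hk : MDifferentiableAt 𝓘(ℝ, F) 𝓘(ℝ, E) k y) (h1 : k y = 1) (v : F) (Z : E) :
    fderiv ℝ (fun z => (conjDeriv (k z) : E →L[ℝ] E)) y v Z =
      ⁅toLie (E := E) D (modelDeriv E k y v), toLie (E := E) D Z⁆ := by
  rw [modelDeriv_eq_of_eq_one hk h1]
  have hch : DifferentiableAt ℝ (fun z => chartOne E D (k z)) y := by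
    rw [← mdifferentiableAt_iff_differentiableAt]
    have h := contMDiffAt_chartOne (E := E) (D := D) one_mem_chartOne
    rw [← h1] at h
    exact (h.mdifferentiableAt (by simp)).comp y hk
  have hF := contDiffAt_fderiv_partial_right (contDiffAt_locConj (E := E) (D := D))
  have heq : (fun z => (conjDeriv (k z) : E →L[ℝ] E)) =ᶠ[𝓝 y]
      (fun x => fderiv ℝ (fun w => locConj E D x w) (chartOne E D 1)) ∘ fun z => chartOne E D (k z) := by
    have hc : ContinuousAt k y := hk.continuousAt
    have hm : ∀ᶠ z in 𝓝 y, k z ∈ (chartOne E D).source := hc.eventually_mem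
      ((chartOne E D).open_source.mem_nhds (by rw [h1]; exact one_mem_chartOne))
    filter_upwards [hm] with z hz
    rw [Function.comp_apply, ← conjDeriv_chartOne_symm, (chartOne E D).left_inv hz]
  rw [heq.fderiv_eq, fderiv_comp]
  · rw [h1]
    exact fderiv_fderiv_locConj _ _
  · rw [h1]; exact hF.differentiableAt (by simp)
  · exact hch

variable [CompleteSpace E] (Φ : GroupLieAlgebra 𝓘(ℝ, E) D ≃ₗ⁅ℝ⁆ 𝔡)

include Φ in
theorem finiteDimensional_model : FiniteDimensional ℝ E := by
  exact Module.Finite.equiv (Φ.toLinearEquiv.symm : 𝔡 ≃ₗ[ℝ] E)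

/-- The identification of the model space with `𝔡`. -/
def modelEquiv : E ≃L[ℝ] 𝔡 :=
  haveI := finiteDimensional_model Φ
  LinearEquiv.toContinuousLinearEquiv (Φ.toLinearEquiv : E ≃ₗ[ℝ] 𝔡)

theorem modelEquiv_apply (v : E) : modelEquiv Φ v = Φ (toLie D v) := rfl

/-- The adjoint action as a continuous linear map. -/
def adMap (a : D) : 𝔡 →L[ℝ] 𝔡 :=
  (modelEquiv Φ : E →L[ℝ] 𝔡).comp ((conjDeriv a).comp ((modelEquiv Φ).symm : 𝔡 →L[ℝ] E))

theorem adMap_apply (a : D) (X : 𝔡) : adMap Φ a X = Ad Φ a X := rfl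

theorem Ad_one (X : 𝔡) : Ad Φ 1 X = X := by
  rw [← adMap_apply]; simp [adMap, conjDeriv_one]

theorem Ad_mul (a b : D) (X : 𝔡) : Ad Φ (a * b) X = Ad Φ a (Ad Φ b X) := by
  simp only [← adMap_apply]; simp [adMap, conjDeriv_mul]

theorem Ad_inv_Ad (a : D) (X : 𝔡) : Ad Φ a⁻¹ (Ad Φ a X) = X := by
  rw [← Ad_mul]; simp [Ad_one]

theorem Ad_add (a : D) (X Y : 𝔡) : Ad Φ a (X + Y) = Ad Φ a X + Ad Φ a Y := (adMap Φ a).map_add X Y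
theorem Ad_smul (a : D) (r : ℝ) (X : 𝔡) : Ad Φ a (r • X) = r • Ad Φ a X := (adMap Φ a).map_smul r X
theorem Ad_zero (a : D) : Ad Φ a 0 = 0 := (adMap Φ a).map_zero

theorem contMDiff_adMap : ContMDiff 𝓘(ℝ, E) 𝓘(ℝ, 𝔡 →L[ℝ] 𝔡) ∞ (adMap Φ) :=
  (contMDiff_const (c := (modelEquiv Φ : E →L[ℝ] 𝔡))).clm_comp
    (contMDiff_conjDeriv.clm_comp (contMDiff_const (c := ((modelEquiv Φ).symm : 𝔡 →L[ℝ] E))))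

theorem fderiv_adMap {k : F → D} {y : F} (hk : ContMDiffAt 𝓘(ℝ, F) 𝓘(ℝ, E) ∞ k y) (h1 : k y = 1)
    (v : F) (X : 𝔡) : fderiv ℝ (fun z => adMap Φ (k z)) y v X =
      ⁅modelEquiv Φ (modelDeriv E k y v), X⁆ := by
  have hd : DifferentiableAt ℝ (fun z => (conjDeriv (k z) : E →L[ℝ] E)) y := by
    rw [← mdifferentiableAt_iff_differentiableAt]
    exact ((contMDiff_conjDeriv.contMDiffAt).comp y hk).mdifferentiableAt (by simp)
  have h := (hasFDerivAt_const (modelEquiv Φ : E →L[ℝ] 𝔡) y).clm_comp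
    (hd.hasFDerivAt.clm_comp (hasFDerivAt_const ((modelEquiv Φ).symm : 𝔡 →L[ℝ] E) y))
  have h2 : fderiv ℝ (fun z => adMap Φ (k z)) y v X =
      modelEquiv Φ (fderiv ℝ (fun z => (conjDeriv (k z) : E →L[ℝ] E)) y v ((modelEquiv Φ).symm X)) := by
    exact (congrArg (fun T : F →L[ℝ] 𝔡 →L[ℝ] 𝔡 => T v X) h.fderiv).trans (by simp)
  rw [h2, fderiv_conjDeriv (hk.mdifferentiableAt (by simp)) h1]
  refine (Φ.map_lie _ _).trans ?_
  exact congrArg (fun W => ⁅modelEquiv Φ (modelDeriv E k y v), W⁆)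
    ((modelEquiv Φ).apply_symm_apply X)

theorem logDeriv_eq (h : E3 → D) (y v : E3) :
    logDeriv Φ h y v = modelEquiv Φ (modelDeriv E (fun z => (h y)⁻¹ * h z) y v) := by
  unfold logDeriv modelDeriv
  exact (modelEquiv_apply Φ _).symm

/-- The derivative of `h ↦ Ad h⁻¹`. -/
theorem fderiv_adMap_inv {h : E3 → D} {y : E3} (hh : ContMDiffAt 𝓘(ℝ, E3) 𝓘(ℝ, E) ∞ h y)
    (v : E3) (X : 𝔡) : fderiv ℝ (fun z => adMap Φ (h z)⁻¹) y v X =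
      - ⁅logDeriv Φ h y v, Ad Φ (h y)⁻¹ X⁆ := by
  have hk : ContMDiffAt 𝓘(ℝ, E3) 𝓘(ℝ, E) ∞ (fun z => (h y)⁻¹ * h z) y := contMDiffAt_const.mul hh
  have h1 : (h y)⁻¹ * h y = 1 := by simp
  have hd := fderiv_adMap Φ hk h1
  have hG : DifferentiableAt ℝ (fun z => adMap Φ ((h y)⁻¹ * h z)) y := by
    rw [← mdifferentiableAt_iff_differentiableAt]
    exact (((contMDiff_adMap Φ).contMDiffAt).comp y hk).mdifferentiableAt (by simp)
  have hI : DifferentiableAt ℝ (fun z => adMap Φ (h z)⁻¹) y := by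
    rw [← mdifferentiableAt_iff_differentiableAt]
    exact (((contMDiff_adMap Φ).contMDiffAt).comp y hh.inv).mdifferentiableAt (by simp)
  -- This product is constant in `z`; its derivative at `y` relates the derivative of `Ad h⁻¹` to
  -- that of a map with value `1` at `y`.
  have hc : (fun z => (adMap Φ ((h y)⁻¹ * h z)).comp (adMap Φ (h z)⁻¹)) =
      fun _ => adMap Φ (h y)⁻¹ := by
    ext1 z
    ext1 X
    simp only [ContinuousLinearMap.comp_apply, adMap_apply]
    rw [← Ad_mul]; simp
  have h2 := hG.hasFDerivAt.clm_comp hI.hasFDerivAt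
  have h4 := h2.congr_of_eventuallyEq (f₁ := fun _ => adMap Φ (h y)⁻¹)
    (Eventually.of_forall fun z => (congrFun hc z).symm)
  have h5 := h4.unique (hasFDerivAt_const _ _)
  have h3 := congrArg (fun T : E3 →L[ℝ] 𝔡 →L[ℝ] 𝔡 => T v X) h5
  have h6 : adMap Φ ((h y)⁻¹ * h y) (fderiv ℝ (fun z => adMap Φ (h z)⁻¹) y v X) +
    fderiv ℝ (fun z => adMap Φ ((h y)⁻¹ * h z)) y v (adMap Φ (h y)⁻¹ X) = 0 := h3
  rw [hd, adMap_apply, adMap_apply, h1, Ad_one] at h6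
  rw [logDeriv_eq]
  exact eq_neg_of_add_eq_zero_left h6

/-- The adjoint action preserves the bracket. -/
theorem Ad_lie (a : D) (X Y : 𝔡) : Ad Φ a ⁅X, Y⁆ = ⁅Ad Φ a X, Ad Φ a Y⁆ := by
  set o := chartOne E D 1
  set x := (modelEquiv Φ).symm X with hx
  have hk : ContMDiffAt 𝓘(ℝ, E) 𝓘(ℝ, E) ∞ (chartOne E D).symm o := contMDiffAt_chartOne_symm
  have hkd := hk.mdifferentiableAt (by simp)
  have hk2 : ContMDiffAt 𝓘(ℝ, E) 𝓘(ℝ, E) ∞ (fun z => a * (chartOne E D).symm z * a⁻¹) o :=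
    (contMDiffAt_const.mul hk).mul contMDiffAt_const
  have hk1 : (chartOne E D).symm o = 1 := chartOne_symm_one
  have hm1 : modelDeriv E (chartOne E D).symm o = ContinuousLinearMap.id ℝ E := by
    rw [modelDeriv_eq_of_eq_one hkd hk1]
    refine (EventuallyEq.fderiv_eq (f := id) ?_).trans fderiv_id
    filter_upwards [eventually_chartOne_target] with y hy
    exact (chartOne E D).right_inv hy
  have hm2 : modelDeriv E (fun z => a * (chartOne E D).symm z * a⁻¹) o =
      conjDeriv a := by
    have h1 : HasMFDerivAt 𝓘(ℝ, E) 𝓘(ℝ, E) (fun x : D => a * x * a⁻¹) ((chartOne E D).symm o)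
        (conjDeriv (E := E) a) := by
      rw [hk1]
      exact (mdifferentiableAt_conj a 1).hasMFDerivAt
    have h2 := (HasMFDerivAt.comp o h1 hkd.hasMFDerivAt).mfderiv
    refine h2.trans ?_
    refine (congrArg (fun T : E →L[ℝ] E => (conjDeriv (E := E) a).comp T) hm1).trans ?_
    exact ContinuousLinearMap.comp_id _
  have e1 := fderiv_adMap Φ hk hk1 x Y
  have e2 := fderiv_adMap Φ hk2 (by simp [hk1]) x (Ad Φ a Y)
  rw [hm1] at e1
  rw [hm2] at e2
  have hd1 : DifferentiableAt ℝ (fun z => adMap Φ ((chartOne E D).symm z)) o := by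
    rw [← mdifferentiableAt_iff_differentiableAt]
    exact (((contMDiff_adMap Φ).contMDiffAt).comp o hk).mdifferentiableAt (by simp)
  have hd2 : DifferentiableAt ℝ (fun z => adMap Φ (a * (chartOne E D).symm z * a⁻¹)) o := by
    rw [← mdifferentiableAt_iff_differentiableAt]
    exact (((contMDiff_adMap Φ).contMDiffAt).comp o hk2).mdifferentiableAt (by simp)
  -- With `g` the group element with coordinates `z`, both sides of `Ad_a Ad_g Y = Ad_(a g a⁻¹) Ad_a
  -- Y` are differentiated at `g = 1` in the direction `X`.
  have hfun : (fun z => adMap Φ a (adMap Φ ((chartOne E D).symm z) Y)) =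
      fun z => adMap Φ (a * (chartOne E D).symm z * a⁻¹) (Ad Φ a Y) := by
    ext1 z
    simp only [adMap_apply]
    rw [← Ad_mul, ← Ad_mul]; simp
  have d1 := (hasFDerivAt_const (adMap Φ a) o).clm_apply
    (hd1.hasFDerivAt.clm_apply (hasFDerivAt_const Y o))
  have d2 := hd2.hasFDerivAt.clm_apply (hasFDerivAt_const (Ad Φ a Y) o)
  rw [hfun] at d1
  have h3 := congrArg (fun T => T x) (d1.unique d2)
  simp only [add_apply, ContinuousLinearMap.comp_apply,
    ContinuousLinearMap.flip_apply, e1, e2, zero_apply, zero_add, map_zero,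
    adMap_apply, ContinuousLinearMap.id_apply, add_zero] at h3
  rw [hx] at h3
  simpa [← adMap_apply, adMap] using h3

end AdjointAction
end QEGR
end

open scoped Manifold ContDiff
noncomputable section
namespace QEGR
open Filter Topology

/-! ### Smoothness of forms through their components. -/

section FormCalculus
variable {V F : Type*} [NormedAddCommGroup V] [NormedSpace ℝ V] [FiniteDimensional ℝ V]
  [NormedAddCommGroup F] [NormedSpace ℝ F] [FiniteDimensional ℝ F]

instance finiteDimensional_alternating (k : ℕ) : FiniteDimensional ℝ (V [⋀^Fin k]→L[ℝ] F) := by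
  let T : (V [⋀^Fin k]→L[ℝ] F) →ₗ[ℝ] ((Fin k → Fin (Module.finrank ℝ V)) → F) :=
    { toFun := fun η w => η (fun i => Module.finBasis ℝ V (w i))
      map_add' := fun _ _ => rfl
      map_smul' := fun _ _ => rfl }
  refine Module.Finite.of_injective T fun η η' h => ?_
  apply ContinuousAlternatingMap.toAlternatingMap_injective
  refine AlternatingMap.coe_multilinearMap_injective ?_
  exact Module.Basis.ext_multilinear (fun _ => Module.finBasis ℝ V) fun w => congrFun h w

/-- Evaluation of forms on fixed vectors. -/
def evalCLM {k : ℕ} (w : Fin k → V) : (V [⋀^Fin k]→L[ℝ] F) →L[ℝ] F :=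
  LinearMap.toContinuousLinearMap
    { toFun := fun η => η w, map_add' := fun _ _ => rfl, map_smul' := fun _ _ => rfl }

@[simp] theorem evalCLM_apply {k : ℕ} (w : Fin k → V) (η : V [⋀^Fin k]→L[ℝ] F) :
    evalCLM w η = η w := rfl

/-- A form is determined by its values on basis vectors. A linear left inverse of this component map
is continuous in finite dimension, so smoothness can be tested on components. -/
theorem exists_clm_of_components (V F : Type*) [NormedAddCommGroup V] [NormedSpace ℝ V]
    [FiniteDimensional ℝ V] [NormedAddCommGroup F] [NormedSpace ℝ F] [FiniteDimensional ℝ F] (k : ℕ) :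
    ∃ S : ((Fin k → Fin (Module.finrank ℝ V)) → F) →L[ℝ] (V [⋀^Fin k]→L[ℝ] F),
      ∀ η : V [⋀^Fin k]→L[ℝ] F, S (fun w => η (fun i => Module.finBasis ℝ V (w i))) = η := by
  let T : (V [⋀^Fin k]→L[ℝ] F) →ₗ[ℝ] ((Fin k → Fin (Module.finrank ℝ V)) → F) :=
    { toFun := fun η w => η (fun i => Module.finBasis ℝ V (w i))
      map_add' := fun _ _ => rfl
      map_smul' := fun _ _ => rfl }
  have hT : Function.Injective T := fun η η' h => by
    apply ContinuousAlternatingMap.toAlternatingMap_injective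
    refine AlternatingMap.coe_multilinearMap_injective ?_
    exact Module.Basis.ext_multilinear (fun _ => Module.finBasis ℝ V) fun w => congrFun h w
  obtain ⟨S, hS⟩ := LinearMap.exists_leftInverse_of_injective T (LinearMap.ker_eq_bot.2 hT)
  exact ⟨LinearMap.toContinuousLinearMap S, fun η => LinearMap.congr_fun hS η⟩

theorem contDiffOn_form_iff {G : Type*} [NormedAddCommGroup G] [NormedSpace ℝ G] {k : ℕ}
    {n : WithTop ℕ∞} {η : G → V [⋀^Fin k]→L[ℝ] F} {U : Set G} :
    ContDiffOn ℝ n η U ↔ ∀ w, ContDiffOn ℝ n (fun y => η y w) U := by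
  refine ⟨fun h w => (evalCLM (F := F) w).contDiff.comp_contDiffOn h, fun h => ?_⟩
  obtain ⟨S, hS⟩ := exists_clm_of_components V F k
  have h2 : η = fun y => S (fun w => η y (fun i => Module.finBasis ℝ V (w i))) := by
    ext1 y; rw [hS]
  rw [h2]
  exact S.contDiff.comp_contDiffOn (contDiffOn_pi.2 fun w => h _)

end FormCalculus

/-! ### Nondegeneracy and trivial center of `𝔡`. -/

section Algebra

/-- The bracket of `𝔡` as a continuous bilinear map. -/
def lieCLM : 𝔡 →L[ℝ] 𝔡 →L[ℝ] 𝔡 :=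
  LinearMap.toContinuousLinearMap
    ((LinearMap.toContinuousLinearMap : (𝔡 →ₗ[ℝ] 𝔡) ≃ₗ[ℝ] (𝔡 →L[ℝ] 𝔡)).toLinearMap ∘ₗ
      LinearMap.mk₂ ℝ (fun X Y : 𝔡 => ⁅X, Y⁆) add_lie smul_lie lie_add lie_smul)

@[simp] theorem lieCLM_apply (X Y : 𝔡) : lieCLM X Y = ⁅X, Y⁆ := rfl

namespace TrivialExt

theorem pair_add_left (X Y Z : 𝔡) : pair (X + Y) Z = pair X Z + pair Y Z := by
  simp [pair]; ring

theorem pair_add_right (X Y Z : 𝔡) : pair X (Y + Z) = pair X Y + pair X Z := by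
  simp [pair]; ring

theorem pair_smul_left (r : ℝ) (X Z : 𝔡) : pair (r • X) Z = r * pair X Z := by
  simp [pair]; ring

theorem pair_smul_right (r : ℝ) (X Z : 𝔡) : pair X (r • Z) = r * pair X Z := by
  simp [pair]; ring

theorem pair_comm (X Y : 𝔡) : pair X Y = pair Y X := by
  rw [pair, pair, OrthogonalLieModule.symm (𝔤 := SO31)]; ring

end TrivialExt
open TrivialExt

/-- The inner product of `𝔡` as a continuous bilinear map. -/
def pairCLM : 𝔡 →L[ℝ] 𝔡 →L[ℝ] ℝ :=
  LinearMap.toContinuousLinearMap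
    ((LinearMap.toContinuousLinearMap : (𝔡 →ₗ[ℝ] ℝ) ≃ₗ[ℝ] (𝔡 →L[ℝ] ℝ)).toLinearMap ∘ₗ
      LinearMap.mk₂ ℝ (fun X Y : 𝔡 => pair X Y) pair_add_left pair_smul_left pair_add_right
        pair_smul_right)

theorem pairCLM_apply (X Y : 𝔡) : pairCLM X Y = pair X Y := rfl

theorem pair_zero_left (X : 𝔡) : pair 0 X = 0 := by simp [← pairCLM_apply]
theorem pair_zero_right (X : 𝔡) : pair X 0 = 0 := by simp [← pairCLM_apply]
theorem pair_neg_left (X Y : 𝔡) : pair (-X) Y = - pair X Y := by simp [← pairCLM_apply]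
theorem pair_sub_left (X Y Z : 𝔡) : pair (X - Y) Z = pair X Z - pair Y Z := by
  simp [← pairCLM_apply]
theorem pair_sub_right (X Y Z : 𝔡) : pair X (Y - Z) = pair X Y - pair X Z := by
  simp [← pairCLM_apply]

/-- The inner product of `𝔡` is nondegenerate. -/
theorem eq_zero_of_pair_eq_zero {X : 𝔡} (h : ∀ Y, pair X Y = 0) : X = 0 := by
  refine TrivialExt.ext' (fun x => ?_) ?_ ?_
  · simpa [pair] using h (mk 0 0 x)
  · have hn := (OrthogonalLieModule.nondegenerate (𝔤 := SO31) (V := Mink)).1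
    exact hn _ fun w => by simpa [pair] using h (mk 0 w 0)
  · refine (Module.forall_dual_apply_eq_zero_iff ℝ _).1 fun z => ?_
    simpa [pair] using h (mk z 0 0)

/-- The center of `so(3,1)` is trivial. -/
theorem so31_eq_zero_of_vec {A : SO31} (h : ∀ v : Mink, ⁅A, v⁆ = 0) : A = 0 := by
  apply Subtype.ext
  ext i j
  have := congrFun (h (Pi.single j 1)) i
  rw [so31_lie_apply] at this
  simpa using this

/-- If `ad A = 0` then `A` lies in the radical of the Killing form. -/
theorem so31_eq_zero_of_lie {A : SO31} (h : ∀ B : SO31, ⁅A, B⁆ = 0) : A = 0 := by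
  have h2 : ∀ B, killingForm ℝ SO31 A B = 0 := by
    intro B
    have : LieAlgebra.ad ℝ SO31 A = 0 := by ext1 B; simpa using h B
    rw [killingForm_apply_apply, this]; simp
  exact killing_nondegenerate.1 A h2

/-- The elements `⁅B, C⁆` span `so(3,1)`. -/
theorem so31_dual_eq_zero {z : Module.Dual ℝ SO31} (h : ∀ B : SO31, ⁅B, z⁆ = 0) : z = 0 := by
  obtain ⟨A, rfl⟩ := killingIso.surjective z
  have hA : A = 0 := by
    refine so31_eq_zero_of_lie fun B => ?_
    -- Invariance of the Killing form converts invariance of the functional dual to `A` into `⁅A,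
    -- B⁆` being orthogonal to everything.
    have h3 : ∀ C, killingForm ℝ SO31 ⁅A, B⁆ C = 0 := by
      intro C
      have h4 := LinearMap.congr_fun (h B) C
      have h5 : killingForm ℝ SO31 A ⁅B, C⁆ = 0 := by
        rw [Module.Dual.lie_apply] at h4
        simpa [killingIso, LinearMap.BilinForm.toDual_def] using h4
      rw [← h5]
      exact LieModule.traceForm_apply_lie_apply ℝ SO31 SO31 A B C
    exact killing_nondegenerate.1 _ h3
  simp [hA]

/-- The center of `𝔡` is trivial. -/
theorem eq_zero_of_lie_eq_zero {X : 𝔡} (h : ∀ Y : 𝔡, ⁅X, Y⁆ = 0) : X = 0 := by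
  have hv : X.alg = 0 := so31_eq_zero_of_vec fun v => by
    simpa [bracket_def] using congrArg TrivialExt.vec (h (mk 0 v 0))
  have hw : X.vec = 0 := by
    have hA : ∀ A : SO31, ⁅A, X.vec⁆ = 0 := fun A => by
      simpa [bracket_def] using congrArg TrivialExt.vec (h (mk 0 0 A))
    -- Coordinates `3, 4, 5` are the boosts. The time components of the three boosted vectors are
    -- the spatial entries of `X.vec`, and a space component of the first one is its time entry.
    have h0 := hA (so31OfCoord (Pi.single 3 1))
    have h1 := hA (so31OfCoord (Pi.single 4 1))
    have h2 := hA (so31OfCoord (Pi.single 5 1))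
    rw [so31_lie_apply] at h0 h1 h2
    have e0 := congrFun h0 (.inr 0)
    have e1 := congrFun h1 (.inr 0)
    have e2 := congrFun h2 (.inr 0)
    have e3 := congrFun h0 (.inl 0)
    ext i
    rcases i with i | i <;> fin_cases i <;>
      simp [so31OfCoord, Matrix.mulVec, dotProduct, Fin.sum_univ_succ, Matrix.fromBlocks] at e0 e1 e2 e3 ⊢ <;> assumption
  have hz : X.dual = 0 := so31_dual_eq_zero fun B => by
    have h0 : vecBracket (𝔤 := SO31) X.vec (0 : Mink) = 0 := by ext; simp
    simpa [bracket_def, h0] using congrArg TrivialExt.dual (h (mk 0 0 B))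
  exact TrivialExt.ext' (fun x => by rw [hz]; rfl) hw hv

end Algebra

section BracketCalculus
variable {V : Type*} [NormedAddCommGroup V] [NormedSpace ℝ V] {f g : V → 𝔡} {U : Set V} {y : V}
  {n : WithTop ℕ∞}

theorem contDiffOn_lie (hf : ContDiffOn ℝ n f U) (hg : ContDiffOn ℝ n g U) :
    ContDiffOn ℝ n (fun y => ⁅f y, g y⁆) U :=
  (lieCLM.contDiff.comp_contDiffOn hf).clm_apply hg

theorem contDiffOn_pair (hf : ContDiffOn ℝ n f U) (hg : ContDiffOn ℝ n g U) :
    ContDiffOn ℝ n (fun y => TrivialExt.pair (f y) (g y)) U :=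
  (pairCLM.contDiff.comp_contDiffOn hf).clm_apply hg

theorem differentiableAt_lie (hf : DifferentiableAt ℝ f y) (hg : DifferentiableAt ℝ g y) :
    DifferentiableAt ℝ (fun y => ⁅f y, g y⁆) y :=
  (lieCLM.differentiableAt.comp y hf).clm_apply hg

theorem fderiv_lie (hf : DifferentiableAt ℝ f y) (hg : DifferentiableAt ℝ g y) (v : V) :
    fderiv ℝ (fun y => ⁅f y, g y⁆) y v = ⁅fderiv ℝ f y v, g y⁆ + ⁅f y, fderiv ℝ g y v⁆ := by
  simp only [← lieCLM_apply]
  rw [(lieCLM.hasFDerivAt_of_bilinear hf.hasFDerivAt hg.hasFDerivAt).fderiv, add_apply,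
    ContinuousLinearMap.precompR_apply, ContinuousLinearMap.precompL_apply, add_comm]
  rfl

theorem fderiv_pair (hf : DifferentiableAt ℝ f y) (hg : DifferentiableAt ℝ g y) (v : V) :
    fderiv ℝ (fun y => TrivialExt.pair (f y) (g y)) y v =
      TrivialExt.pair (fderiv ℝ f y v) (g y) + TrivialExt.pair (f y) (fderiv ℝ g y v) := by
  simp only [← pairCLM_apply]
  rw [(pairCLM.hasFDerivAt_of_bilinear hf.hasFDerivAt hg.hasFDerivAt).fderiv, add_apply,
    ContinuousLinearMap.precompR_apply, ContinuousLinearMap.precompL_apply, add_comm]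
  rfl

end BracketCalculus
end QEGR
end

open scoped Manifold ContDiff
noncomputable section
namespace QEGR
open Filter Topology

/-! ### The covariant exterior derivative and its gauge covariance. -/

section CovariantDerivative
variable {k : ℕ}

/-- The linear map `v ↦ [α(v), η]`. -/
def adForm (α : E3 [⋀^Fin 1]→L[ℝ] 𝔡) (η : E3 [⋀^Fin k]→L[ℝ] 𝔡) :
    E3 →L[ℝ] E3 [⋀^Fin k]→L[ℝ] 𝔡 :=
  LinearMap.toContinuousLinearMap
    { toFun := fun v => (lieCLM ((ContinuousAlternatingMap.ofSubsingleton ℝ E3 𝔡 (0 : Fin 1)).symm α v)).compContinuousAlternatingMap η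
      map_add' := fun v w => by rw [map_add, map_add]; rfl
      map_smul' := fun r v => by rw [map_smul, map_smul]; rfl }

theorem ofSubsingleton_symm_apply (α : E3 [⋀^Fin 1]→L[ℝ] 𝔡) (v : E3) :
    (ContinuousAlternatingMap.ofSubsingleton ℝ E3 𝔡 (0 : Fin 1)).symm α v = α ![v] := by
  have : α ![v] = α (fun _ => v) := by congr 1; ext i; fin_cases i; rfl
  rw [this]; rfl

theorem adForm_apply (α : E3 [⋀^Fin 1]→L[ℝ] 𝔡) (η : E3 [⋀^Fin k]→L[ℝ] 𝔡) (v : E3)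
    (w : Fin k → E3) : adForm α η v w = ⁅α ![v], η w⁆ := by
  rw [← ofSubsingleton_symm_apply]; rfl

/-- The covariant exterior derivative `d_A η = dη + [A ∧ η]`. -/
def covD (A : LocalForm 1) (η : LocalForm k) : LocalForm (k + 1) := fun y =>
  ContinuousAlternatingMap.alternatizeUncurryFin (fderiv ℝ η y + adForm (A y) (η y))

theorem covD_apply (A : LocalForm 1) {η : LocalForm k} {y : E3} (hη : DifferentiableAt ℝ η y)
    (w : Fin (k + 1) → E3) : covD A η y w = ∑ i : Fin (k + 1), (-1 : ℝ) ^ i.val •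
      (fderiv ℝ (fun z => η z (i.removeNth w)) y (w i) + ⁅A y ![w i], η y (i.removeNth w)⁆) := by
  simp only [covD, ContinuousAlternatingMap.alternatizeUncurryFin_apply]
  refine Finset.sum_congr rfl fun i _ => ?_
  rw [fderiv_continuousAlternatingMap_apply_const_apply hη, add_apply,
    ContinuousAlternatingMap.add_apply, adForm_apply]
  rcases Nat.even_or_odd i.val with h | h
  · simp [h.neg_one_pow]
  · simp [h.neg_one_pow]

theorem extDeriv_apply_real {η : LocalForm k} {y : E3} (hη : DifferentiableAt ℝ η y)
    (w : Fin (k + 1) → E3) : extDeriv η y w = ∑ i : Fin (k + 1), (-1 : ℝ) ^ i.val •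
      fderiv ℝ (fun z => η z (i.removeNth w)) y (w i) := by
  rw [extDeriv_apply hη]
  refine Finset.sum_congr rfl fun i _ => ?_
  rcases Nat.even_or_odd i.val with h | h
  · simp [h.neg_one_pow]
  · simp [h.neg_one_pow]

theorem covD_eq (A : LocalForm 1) {η : LocalForm k} {y : E3} (hη : DifferentiableAt ℝ η y)
    (w : Fin (k + 1) → E3) : covD A η y w = extDeriv η y w +
      ∑ i : Fin (k + 1), (-1 : ℝ) ^ i.val • ⁅A y ![w i], η y (i.removeNth w)⁆ := by
  simp only [covD_apply A hη, extDeriv_apply_real hη, smul_add, Finset.sum_add_distrib]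

theorem differentiableAt_apply {η : LocalForm k} {y : E3} (hη : DifferentiableAt ℝ η y)
    (w : Fin k → E3) : DifferentiableAt ℝ (fun z => η z w) y :=
  (evalCLM (F := 𝔡) w).differentiableAt.comp y hη

theorem contDiffOn_covD {A : LocalForm 1} {η : LocalForm k} {U : Set E3} (hU : IsOpen U)
    (hA : ContDiffOn ℝ ∞ A U) (hη : ContDiffOn ℝ ∞ η U) : ContDiffOn ℝ ∞ (covD A η) U := by
  rw [contDiffOn_form_iff]
  intro w
  have h1 : ContDiffOn ℝ ∞ (fun y => ∑ i : Fin (k + 1), (-1 : ℝ) ^ i.val •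
      (fderiv ℝ (fun z => η z (i.removeNth w)) y (w i) + ⁅A y ![w i], η y (i.removeNth w)⁆)) U := by
    refine ContDiffOn.sum fun i _ => ContDiffOn.const_smul (f := fun y =>
      fderiv ℝ (fun z => η z (i.removeNth w)) y (w i) + ⁅A y ![w i], η y (i.removeNth w)⁆) _
      (ContDiffOn.add ?_ ?_)
    · exact ((contDiffOn_form_iff.1 hη _).fderiv_of_isOpen hU (m := ∞) (by simp)).clm_apply
        contDiffOn_const
    · exact contDiffOn_lie (contDiffOn_form_iff.1 hA _) (contDiffOn_form_iff.1 hη _)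
  refine h1.congr fun y hy => covD_apply A ?_ w
  exact (hη.contDiffAt (hU.mem_nhds hy)).differentiableAt (by simp)

section Gauge
variable {E D : Type*} [NormedAddCommGroup E] [NormedSpace ℝ E] [CompleteSpace E]
  [TopologicalSpace D] [ChartedSpace E D] [Group D] [LieGroup 𝓘(ℝ, E) ∞ D]
  (Φ : GroupLieAlgebra 𝓘(ℝ, E) D ≃ₗ⁅ℝ⁆ 𝔡)

/-- The covariant derivative is compatible with changes of coordinates and gauge. -/
theorem covD_gauge {A A' : LocalForm 1} {η η' : LocalForm k} {t : E3 → E3} {h : E3 → D} {y : E3}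
    (ht : ContDiffAt ℝ ∞ t y) (hh : ContMDiffAt 𝓘(ℝ, E3) 𝓘(ℝ, E) ∞ h y)
    (hη : DifferentiableAt ℝ η (t y)) (hη' : DifferentiableAt ℝ η' y)
    (hA : ∀ v, A' y ![v] = Ad Φ (h y)⁻¹ (A (t y) ![fderiv ℝ t y v]) + logDeriv Φ h y v)
    (hηη : ∀ᶠ z in 𝓝 y, ∀ w, η' z w = Ad Φ (h z)⁻¹ (η (t z) (fun a => fderiv ℝ t z (w a))))
    (w : Fin (k + 1) → E3) :
    covD A' η' y w = Ad Φ (h y)⁻¹ (covD A η (t y) (fun a => fderiv ℝ t y (w a))) := by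
  -- The coordinate change is separated from the gauge change: `extDeriv` commutes with the pullback
  -- `μ`, so only the factor `Ad h⁻¹` has to be differentiated.
  set μ : LocalForm k := fun z => (η (t z)).compContinuousLinearMap (fderiv ℝ t z) with hμ
  have htd : DifferentiableAt ℝ t y := ht.differentiableAt (by simp)
  have hμd : DifferentiableAt ℝ μ y := by
    refine DifferentiableAt.continuousAlternatingMapCompContinuousLinearMap ?_ ?_
    · exact hη.comp y htd
    · exact (ht.fderiv_right (m := ∞) (by simp)).differentiableAt (by simp)
  have hpull := extDeriv_pullback (x := y) hη ht
    (by rw [minSmoothness_of_isRCLikeNormedField]; exact ENat.LEInfty.out)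
  have hI : DifferentiableAt ℝ (fun z => adMap Φ (h z)⁻¹) y := by
    rw [← mdifferentiableAt_iff_differentiableAt]
    exact (((contMDiff_adMap Φ).contMDiffAt).comp y hh.inv).mdifferentiableAt (by simp)
  -- The term with `logDeriv` cancels the inhomogeneous term in the transformation law of the
  -- connection.
  have hder : ∀ (u : Fin k → E3) (v : E3), fderiv ℝ (fun z => η' z u) y v =
      Ad Φ (h y)⁻¹ (fderiv ℝ (fun z => μ z u) y v) - ⁅logDeriv Φ h y v, η' y u⁆ := by
    intro u v
    have h1 : (fun z => η' z u) =ᶠ[𝓝 y] fun z => adMap Φ (h z)⁻¹ (μ z u) := by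
      filter_upwards [hηη] with z hz
      rw [hz]; rfl
    rw [h1.fderiv_eq, fderiv_clm_apply hI (differentiableAt_apply hμd u), add_apply,
      ContinuousLinearMap.comp_apply, ContinuousLinearMap.flip_apply, fderiv_adMap_inv Φ hh,
      adMap_apply, h1.eq_of_nhds, adMap_apply, sub_eq_add_neg]
  have hy := hηη.self_of_nhds
  rw [covD_apply A' hη', covD_eq A hη]
  have hp := congrArg (fun T => T w) hpull
  simp only [ContinuousAlternatingMap.compContinuousLinearMap_apply] at hp
  have hcomp : (⇑(fderiv ℝ t y) ∘ w) = fun a => fderiv ℝ t y (w a) := rfl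
  rw [hcomp] at hp
  rw [← hp, extDeriv_apply_real hμd]
  simp only [← adMap_apply, map_add, map_sum, map_smul]
  rw [← Finset.sum_add_distrib]
  refine Finset.sum_congr rfl fun i _ => ?_
  rw [← smul_add]
  congr 1
  rw [hder, hA, add_lie, adMap_apply, adMap_apply, Ad_lie, hy (i.removeNth w)]
  have : (i.removeNth fun a => fderiv ℝ t y (w a)) = fun a => fderiv ℝ t y (i.removeNth w a) := rfl
  rw [this]
  abel

end Gauge
end CovariantDerivative
end QEGR
end

open scoped Manifold ContDiff
noncomputable section
namespace QEGR
open Filter Topology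

/-! ### Commutators of covariant derivatives and the curvature. -/

section Nabla
variable {A : LocalForm 1} {U : Set E3} {y : E3} {f g : E3 → 𝔡}

/-- The covariant derivative of a `𝔡`-valued function in a constant direction. -/
def nabla (A : LocalForm 1) (v : E3) (f : E3 → 𝔡) (y : E3) : 𝔡 :=
  fderiv ℝ f y v + ⁅A y ![v], f y⁆

theorem nabla_add (v : E3) (hf : DifferentiableAt ℝ f y) (hg : DifferentiableAt ℝ g y) :
    nabla A v (fun z => f z + g z) y = nabla A v f y + nabla A v g y := by
  simp only [nabla, fderiv_fun_add hf hg, add_apply, lie_add]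
  abel

theorem nabla_sub (v : E3) (hf : DifferentiableAt ℝ f y) (hg : DifferentiableAt ℝ g y) :
    nabla A v (fun z => f z - g z) y = nabla A v f y - nabla A v g y := by
  simp only [nabla, fderiv_fun_sub hf hg, sub_apply, lie_sub]
  abel

theorem nabla_smul (r : ℝ) (v : E3) (hf : DifferentiableAt ℝ f y) :
    nabla A v (fun z => r • f z) y = r • nabla A v f y := by
  simp only [nabla, fderiv_fun_const_smul hf, smul_apply, lie_smul, smul_add]

theorem nabla_lie (v : E3) (hf : DifferentiableAt ℝ f y) (hg : DifferentiableAt ℝ g y) :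
    nabla A v (fun z => ⁅f z, g z⁆) y = ⁅nabla A v f y, g y⁆ + ⁅f y, nabla A v g y⁆ := by
  simp only [nabla, fderiv_lie hf hg, lie_add, add_lie, leibniz_lie (A y ![v])]
  abel

theorem nabla_congr (v : E3) (h : f =ᶠ[𝓝 y] g) : nabla A v f y = nabla A v g y := by
  simp only [nabla, h.fderiv_eq, h.eq_of_nhds]

theorem contDiffOn_nabla (hU : IsOpen U) (hA : ContDiffOn ℝ ∞ A U) (hf : ContDiffOn ℝ ∞ f U)
    (v : E3) : ContDiffOn ℝ ∞ (nabla A v f) U :=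
  ((hf.fderiv_of_isOpen hU (m := ∞) (by simp)).clm_apply contDiffOn_const).add
    (contDiffOn_lie (contDiffOn_form_iff.1 hA _) hf)

theorem differentiableAt_of_contDiffOn {F : Type*} [NormedAddCommGroup F] [NormedSpace ℝ F]
    {f : E3 → F} (hU : IsOpen U) (hf : ContDiffOn ℝ ∞ f U) (hy : y ∈ U) :
    DifferentiableAt ℝ f y :=
  (hf.contDiffAt (hU.mem_nhds hy)).differentiableAt (by simp)

theorem removeNth_two_zero (v w : E3) : (0 : Fin 2).removeNth ![v, w] = ![w] := rfl
theorem removeNth_two_one (v w : E3) : (1 : Fin 2).removeNth ![v, w] = ![v] := by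
  ext i; fin_cases i; rfl
theorem removeNth_three_zero (u v w : E3) : (0 : Fin 3).removeNth ![u, v, w] = ![v, w] := rfl
theorem removeNth_three_one (u v w : E3) : (1 : Fin 3).removeNth ![u, v, w] = ![u, w] := by
  ext i; fin_cases i <;> rfl
theorem removeNth_three_two (u v w : E3) : (2 : Fin 3).removeNth ![u, v, w] = ![u, v] := by
  ext i; fin_cases i <;> rfl

theorem extDeriv_one (hA : DifferentiableAt ℝ A y) (v w : E3) : extDeriv A y ![v, w] =
    fderiv ℝ (fun z => A z ![w]) y v - fderiv ℝ (fun z => A z ![v]) y w := by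
  rw [extDeriv_apply_real hA, Fin.sum_univ_two, removeNth_two_zero, removeNth_two_one]
  simp [sub_eq_add_neg]

/-- The commutator of covariant derivatives is the curvature. -/
theorem nabla_nabla (hU : IsOpen U) (hA : ContDiffOn ℝ ∞ A U) (hf : ContDiffOn ℝ ∞ f U)
    (hy : y ∈ U) (u v : E3) : nabla A u (nabla A v f) y - nabla A v (nabla A u f) y =
      ⁅BF.curvature A y u v, f y⁆ := by
  have hfd : DifferentiableAt ℝ (fderiv ℝ f) y :=
    differentiableAt_of_contDiffOn hU (hf.fderiv_of_isOpen hU (m := ∞) (by simp)) hy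
  have hd := differentiableAt_of_contDiffOn hU hf hy
  have hAd := differentiableAt_of_contDiffOn hU hA hy
  have hAc := fun w => differentiableAt_apply hAd w
  have hs : IsSymmSndFDerivAt ℝ f y := (hf.contDiffAt (hU.mem_nhds hy)).isSymmSndFDerivAt
    (by rw [minSmoothness_of_isRCLikeNormedField]; exact ENat.LEInfty.out)
  have key : ∀ u v, nabla A u (nabla A v f) y = fderiv ℝ (fderiv ℝ f) y u v +
      (⁅fderiv ℝ (fun z => A z ![v]) y u, f y⁆ + ⁅A y ![v], fderiv ℝ f y u⁆) +
      (⁅A y ![u], fderiv ℝ f y v⁆ + ⁅A y ![u], ⁅A y ![v], f y⁆⁆) := by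
    intro u v
    have h1 : nabla A v f = fun z => fderiv ℝ f z v + ⁅A z ![v], f z⁆ := rfl
    have h2 : DifferentiableAt ℝ (fun z => fderiv ℝ f z v) y :=
      hfd.clm_apply (differentiableAt_const _)
    rw [nabla, h1, fderiv_fun_add h2 (differentiableAt_lie (hAc _) hd), add_apply,
      fderiv_lie (hAc _) hd, fderiv_clm_apply hfd (differentiableAt_const _), lie_add]
    simp
  rw [key, key, hs.eq u v, BF.curvature, extDeriv_one hAd, add_lie, sub_lie, lie_lie]
  abel

theorem covD_zero {a : LocalForm 0} (ha : DifferentiableAt ℝ a y) (v : E3) :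
    covD A a y ![v] = nabla A v (fun z => a z ![]) y := by
  rw [covD_apply A ha]
  have : ∀ w : Fin 0 → E3, w = ![] := fun w => Subsingleton.elim _ _
  simp [nabla, this]

theorem covD_one {H : LocalForm 1} (hH : DifferentiableAt ℝ H y) (v w : E3) :
    covD A H y ![v, w] = nabla A v (fun z => H z ![w]) y - nabla A w (fun z => H z ![v]) y := by
  rw [covD_apply A hH, Fin.sum_univ_two, removeNth_two_zero, removeNth_two_one]
  simp [nabla, sub_eq_add_neg]
  abel

theorem covD_two {B : LocalForm 2} (hB : DifferentiableAt ℝ B y) (u v w : E3) :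
    covD A B y ![u, v, w] = nabla A u (fun z => B z ![v, w]) y -
      nabla A v (fun z => B z ![u, w]) y + nabla A w (fun z => B z ![u, v]) y := by
  rw [covD_apply A hB, Fin.sum_univ_three, removeNth_three_zero, removeNth_three_one,
    removeNth_three_two]
  simp [nabla, sub_eq_add_neg]
  abel

theorem form_swap {F : Type*} [NormedAddCommGroup F] [NormedSpace ℝ F]
    (B : E3 [⋀^Fin 2]→L[ℝ] F) (u v : E3) : B ![u, v] = - B ![v, u] := by
  have h := B.map_swap ![v, u] (i := 0) (j := 1) (by simp)
  refine Eq.trans ?_ h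
  refine congrArg B ?_
  ext i; fin_cases i <;> rfl

/-- The expression `d_𝔸 𝔹` in terms of covariant derivatives. -/
theorem covDeriv_eq {B : LocalForm 2} (hB : DifferentiableAt ℝ B y) :
    BF.covDeriv A B y = covD A B y ![e 0, e 1, e 2] := by
  rw [BF.covDeriv, covD_eq A hB, Fin.sum_univ_three, removeNth_three_zero, removeNth_three_one,
    removeNth_three_two]
  simp only [cyc, form_swap (B y) (e 2) (e 0)]
  simp
  abel

/-- The square of `d_A` on functions is the commutator of covariant derivatives, hence algebraic in
`a`. Besides the linearised equations, this is the source of the transformation law of the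
curvature. -/
theorem covD_covD_zero {a : LocalForm 0} (hU : IsOpen U) (hA : ContDiffOn ℝ ∞ A U)
    (ha : ContDiffOn ℝ ∞ a U) (hy : y ∈ U) (v w : E3) :
    covD A (covD A a) y ![v, w] = ⁅BF.curvature A y v w, a y ![]⁆ := by
  rw [covD_one (differentiableAt_of_contDiffOn hU (contDiffOn_covD hU hA ha) hy),
    ← nabla_nabla hU hA (contDiffOn_form_iff.1 ha ![]) hy]
  have : ∀ w, (fun z => covD A a z ![w]) =ᶠ[𝓝 y] nabla A w fun z => a z ![] := fun w => by
    filter_upwards [hU.mem_nhds hy] with z hz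
    exact covD_zero (differentiableAt_of_contDiffOn hU ha hz) w
  rw [nabla_congr _ (this w), nabla_congr _ (this v)]

/-- Expanding `d_A d_A H` on three constant vectors groups the second derivatives into three
commutators, each of them a curvature. -/
theorem covD_covD_one {H : LocalForm 1} (hU : IsOpen U) (hA : ContDiffOn ℝ ∞ A U)
    (hH : ContDiffOn ℝ ∞ H U) (hy : y ∈ U) (u v w : E3) :
    covD A (covD A H) y ![u, v, w] = ⁅BF.curvature A y u v, H y ![w]⁆ -
      ⁅BF.curvature A y u w, H y ![v]⁆ + ⁅BF.curvature A y v w, H y ![u]⁆ := by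
  rw [covD_two (differentiableAt_of_contDiffOn hU (contDiffOn_covD hU hA hH) hy)]
  have hc := fun w => contDiffOn_form_iff.1 hH w
  have hn : ∀ v w, DifferentiableAt ℝ (nabla A v fun z => H z w) y := fun v w =>
    differentiableAt_of_contDiffOn hU (contDiffOn_nabla hU hA (hc w) v) hy
  have h1 : ∀ u v w, nabla A u (fun z => covD A H z ![v, w]) y =
      nabla A u (nabla A v fun z => H z ![w]) y - nabla A u (nabla A w fun z => H z ![v]) y := by
    intro u v w
    rw [← nabla_sub _ (hn _ _) (hn _ _)]
    refine nabla_congr _ ?_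
    filter_upwards [hU.mem_nhds hy] with z hz
    exact covD_one (differentiableAt_of_contDiffOn hU hH hz) v w
  rw [h1, h1, h1, ← nabla_nabla hU hA (hc _) hy, ← nabla_nabla hU hA (hc _) hy,
    ← nabla_nabla hU hA (hc _) hy]
  abel

end Nabla

section Gauge
variable {E D : Type*} [NormedAddCommGroup E] [NormedSpace ℝ E] [CompleteSpace E]
  [TopologicalSpace D] [ChartedSpace E D] [Group D] [LieGroup 𝓘(ℝ, E) ∞ D]
  (Φ : GroupLieAlgebra 𝓘(ℝ, E) D ≃ₗ⁅ℝ⁆ 𝔡)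

/-- The connection form `A'` on `U` is obtained from the connection form `A` on `V` by the change of
coordinates `t` and the change of gauge `h`. -/
structure IsGaugeChange (t : E3 → E3) (h : E3 → D) (U V : Set E3) (A' A : LocalForm 1) : Prop where
  isOpen_source : IsOpen U
  isOpen_target : IsOpen V
  mapsTo : Set.MapsTo t U V
  smooth_coord : ContDiffOn ℝ ∞ t U
  smooth_gauge : ContMDiffOn 𝓘(ℝ, E3) 𝓘(ℝ, E) ∞ h U
  smooth_source : ContDiffOn ℝ ∞ A' U
  smooth_target : ContDiffOn ℝ ∞ A V
  rel : ∀ y ∈ U, ∀ v, A' y ![v] = Ad Φ (h y)⁻¹ (A (t y) ![fderiv ℝ t y v]) + logDeriv Φ h y v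

namespace IsGaugeChange
variable {Φ} {t : E3 → E3} {h : E3 → D} {U V : Set E3} {A' A : LocalForm 1} {k : ℕ}

theorem covD_rel (hg : IsGaugeChange Φ t h U V A' A) {η η' : LocalForm k}
    (hη : ContDiffOn ℝ ∞ η V) (hη' : ContDiffOn ℝ ∞ η' U)
    (hr : ∀ y ∈ U, ∀ w, η' y w = Ad Φ (h y)⁻¹ (η (t y) (fun a => fderiv ℝ t y (w a))))
    {y : E3} (hy : y ∈ U) (w : Fin (k + 1) → E3) :
    covD A' η' y w = Ad Φ (h y)⁻¹ (covD A η (t y) (fun a => fderiv ℝ t y (w a))) := by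
  have hn := hg.isOpen_source.mem_nhds hy
  refine covD_gauge Φ (hg.smooth_coord.contDiffAt hn) (hg.smooth_gauge.contMDiffAt hn)
    (differentiableAt_of_contDiffOn hg.isOpen_target hη (hg.mapsTo hy))
    (differentiableAt_of_contDiffOn hg.isOpen_source hη' hy) (hg.rel y hy) ?_ w
  filter_upwards [hn] with z hz using hr z hz

/-- The curvature transforms by the adjoint action. -/
theorem curvature_rel (hg : IsGaugeChange Φ t h U V A' A) {y : E3} (hy : y ∈ U) (v w : E3) :
    BF.curvature A' y v w =
      Ad Φ (h y)⁻¹ (BF.curvature A (t y) (fderiv ℝ t y v) (fderiv ℝ t y w)) := by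
  rw [← sub_eq_zero]
  -- Differentiating the logarithmic derivative is avoided: `[F, a] = d_A d_A a` is covariant for
  -- every section `a`, and an element of `𝔡` is determined by its brackets.
  refine eq_zero_of_lie_eq_zero fun Y => ?_
  -- The section is constant in the target gauge, with the constant chosen so that its transform
  -- `a'` has the prescribed value `Y` at `y`.
  set X := Ad Φ (h y) Y with hX
  set a : LocalForm 0 := fun _ => ContinuousAlternatingMap.constOfIsEmpty ℝ E3 (Fin 0) X with ha
  set a' : LocalForm 0 := fun z => ContinuousAlternatingMap.constOfIsEmpty ℝ E3 (Fin 0)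
    (Ad Φ (h z)⁻¹ X) with ha'
  have hs : ContDiffOn ℝ ∞ a V := contDiffOn_const
  have hs' : ContDiffOn ℝ ∞ a' U := by
    rw [contDiffOn_form_iff]
    intro w
    have h1 : ContDiffOn ℝ ∞ (fun z => adMap Φ (h z)⁻¹) U := by
      rw [← contMDiffOn_iff_contDiffOn]
      exact (contMDiff_adMap Φ).comp_contMDiffOn hg.smooth_gauge.inv
    exact h1.clm_apply contDiffOn_const
  have h1 := fun z (hz : z ∈ U) => hg.covD_rel hs hs' (fun y _ w => rfl) hz
  have h2 := hg.covD_rel (contDiffOn_covD hg.isOpen_target hg.smooth_target hs)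
    (contDiffOn_covD hg.isOpen_source hg.smooth_source hs') h1 hy ![v, w]
  have h3 : (fun i => fderiv ℝ t y ((![v, w] : Fin 2 → E3) i)) =
      ![fderiv ℝ t y v, fderiv ℝ t y w] := by ext i; fin_cases i <;> rfl
  rw [h3, covD_covD_zero hg.isOpen_source hg.smooth_source hs' hy,
    covD_covD_zero hg.isOpen_target hg.smooth_target hs (hg.mapsTo hy), Ad_lie] at h2
  have h4 : a' y ![] = Y := by simp [ha', hX, Ad_inv_Ad]
  have h5 : a (t y) ![] = X := by simp [ha]
  rw [h4, h5, hX, Ad_inv_Ad] at h2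
  rw [sub_lie, h2, sub_self]

end IsGaugeChange
end Gauge
end QEGR
end

open scoped Manifold ContDiff
noncomputable section
namespace QEGR
open Filter Topology

/-! ### Adjoint-valued forms on the atlas, infinitesimal symmetries and global extensions. -/

section Atlas
set_option linter.unusedSectionVars false
variable {E D N ι : Type*} [NormedAddCommGroup E] [NormedSpace ℝ E] [CompleteSpace E]
  [TopologicalSpace D] [ChartedSpace E D] [Group D] [LieGroup 𝓘(ℝ, E) ∞ D]
  [TopologicalSpace N] [ChartedSpace E3 N]

theorem contDiffOn_pullback {k : ℕ} {η : LocalForm k} {t : E3 → E3} {U V : Set E3}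
    (hU : IsOpen U) (ht : ContDiffOn ℝ ∞ t U) (hη : ContDiffOn ℝ ∞ η V) (hm : Set.MapsTo t U V)
    (w : Fin k → E3) : ContDiffOn ℝ ∞ (fun z => η (t z) (fun a => fderiv ℝ t z (w a))) U := by
  have h1 : ContDiffOn ℝ ∞ (fun z => (η (t z)).toContinuousMultilinearMap) U :=
    (ContinuousAlternatingMap.toContinuousMultilinearMapCLM (𝕜 := ℝ) (E := E3) (F := 𝔡)
      (ι := Fin k) ℝ).contDiff.comp_contDiffOn
      (hη.comp ht hm)
  have h2 : ContDiffOn ℝ ∞ (fun z => fun _ : Fin k => fderiv ℝ t z) U :=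
    contDiffOn_pi.2 fun _ => ht.fderiv_of_isOpen hU (m := ∞) (by simp)
  have h3 : ContDiffOn ℝ ∞ (fun z =>
      ContinuousMultilinearMap.compContinuousLinearMapContinuousMultilinear ℝ
        (fun _ : Fin k => E3) (fun _ => E3) 𝔡 (fun _ => fderiv ℝ t z)
        (η (t z)).toContinuousMultilinearMap) U :=
    ((ContinuousMultilinearMap.contDiff _).comp_contDiffOn h2).clm_apply h1
  exact (ContinuousMultilinearMap.apply ℝ (fun _ : Fin k => E3) 𝔡 w).contDiff.comp_contDiffOn h3

namespace BundleAtlas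
variable (P : BundleAtlas E D N ι) {Φ : GroupLieAlgebra 𝓘(ℝ, E) D ≃ₗ⁅ℝ⁆ 𝔡}

theorem isOpen_overlap (i j : ι) : IsOpen (P.overlap i j) :=
  (P.chart j).isOpen_inter_preimage_symm (P.chart i).open_source

theorem isOpen_target (i : ι) : IsOpen (P.chart i).target := (P.chart i).open_target

theorem overlap_subset (i j : ι) : P.overlap i j ⊆ (P.chart j).target := fun _ h => h.1

theorem mapsTo_trans (i j : ι) : Set.MapsTo (P.trans i j) (P.overlap i j) (P.overlap j i) := by
  intro y hy
  refine ⟨(P.chart i).map_source hy.2, ?_⟩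
  rw [trans, (P.chart i).left_inv hy.2]
  exact (P.chart j).map_target hy.1

theorem trans_symm {i j : ι} {y : E3} (hy : y ∈ P.overlap i j) :
    (P.chart i).symm (P.trans i j y) = (P.chart j).symm y := by
  rw [trans, (P.chart i).left_inv hy.2]

theorem trans_trans {i j : ι} {y : E3} (hy : y ∈ P.overlap i j) :
    P.trans j i (P.trans i j y) = y := by
  rw [trans, P.trans_symm hy, (P.chart j).right_inv hy.1]

theorem trans_comp {i j l : ι} {y : E3} (hy : y ∈ P.overlap j l) :
    P.trans i j (P.trans j l y) = P.trans i l y := by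
  rw [trans, P.trans_symm hy, trans]

theorem mem_overlap_trans_iff {i j l : ι} {y : E3} (hy : y ∈ P.overlap j l) :
    P.trans j l y ∈ P.overlap i j ↔ y ∈ P.overlap i l := by
  constructor
  · rintro ⟨_, h⟩
    rw [P.trans_symm hy] at h
    exact ⟨hy.1, h⟩
  · rintro ⟨_, h⟩
    exact ⟨(P.mapsTo_trans j l hy).1, by rwa [P.trans_symm hy]⟩

theorem trans_self {i : ι} {y : E3} (hy : y ∈ (P.chart i).target) : P.trans i i y = y :=
  (P.chart i).right_inv hy

theorem mem_overlap_self {i : ι} {y : E3} (hy : y ∈ (P.chart i).target) : y ∈ P.overlap i i :=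
  ⟨hy, (P.chart i).map_target hy⟩

theorem fderiv_trans_self {i : ι} {y : E3} (hy : y ∈ (P.chart i).target) :
    fderiv ℝ (P.trans i i) y = ContinuousLinearMap.id ℝ E3 := by
  have : P.trans i i =ᶠ[𝓝 y] id := by
    filter_upwards [(P.isOpen_target i).mem_nhds hy] with z hz using P.trans_self hz
  rw [this.fderiv_eq, fderiv_id]

theorem g_self {i : ι} {x : N} (hx : x ∈ (P.chart i).source) : P.g i i x = 1 := by
  have h := P.cocycle i i i x ⟨⟨hx, hx⟩, hx⟩
  simpa using h

variable [IsManifold (𝓡 3) ∞ N]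

theorem contDiffOn_trans (i j : ι) : ContDiffOn ℝ ∞ (P.trans i j) (P.overlap i j) := by
  rw [← contMDiffOn_iff_contDiffOn]
  have h1 := contMDiffOn_of_mem_maximalAtlas (P.chart_mem i)
  have h2 := contMDiffOn_symm_of_mem_maximalAtlas (P.chart_mem j)
  exact h1.comp (h2.mono (P.overlap_subset i j)) fun y hy => hy.2

theorem contMDiffOn_gLoc (i j : ι) :
    ContMDiffOn 𝓘(ℝ, E3) 𝓘(ℝ, E) ∞ (P.gLoc i j) (P.overlap i j) := by
  have h2 := contMDiffOn_symm_of_mem_maximalAtlas (P.chart_mem j)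
  exact (P.smooth_g i j).comp (h2.mono (P.overlap_subset i j)) fun y hy =>
    ⟨hy.2, (P.chart j).map_target hy.1⟩

theorem differentiableAt_trans {i j : ι} {y : E3} (hy : y ∈ P.overlap i j) :
    DifferentiableAt ℝ (P.trans i j) y :=
  differentiableAt_of_contDiffOn (P.isOpen_overlap i j) (P.contDiffOn_trans i j) hy

theorem fderiv_trans_comp {i j l : ι} {y : E3} (hy : y ∈ P.overlap j l)
    (hy' : y ∈ P.overlap i l) (v : E3) :
    fderiv ℝ (P.trans i j) (P.trans j l y) (fderiv ℝ (P.trans j l) y v) =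
      fderiv ℝ (P.trans i l) y v := by
  have h1 := fderiv_comp (g := P.trans i j) (f := P.trans j l) y
    (P.differentiableAt_trans ((P.mem_overlap_trans_iff hy).2 hy')) (P.differentiableAt_trans hy)
  have h2 : P.trans i j ∘ P.trans j l =ᶠ[𝓝 y] P.trans i l := by
    filter_upwards [(P.isOpen_overlap j l).mem_nhds hy] with z hz using P.trans_comp hz
  rw [← h2.fderiv_eq, h1]
  rfl

theorem contDiffOn_adMap_gLoc (i j : ι) :
    ContDiffOn ℝ ∞ (fun z => adMap Φ (P.gLoc i j z)⁻¹) (P.overlap i j) := by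
  rw [← contMDiffOn_iff_contDiffOn]
  exact (contMDiff_adMap Φ).comp_contMDiffOn (P.contMDiffOn_gLoc i j).inv

variable {P}

theorem IsConnection.isGaugeChange {A : ι → LocalForm 1} (hA : P.IsConnection Φ A) (i j : ι) :
    IsGaugeChange Φ (P.trans i j) (P.gLoc i j) (P.overlap i j) (P.chart i).target (A j) (A i) where
  isOpen_source := P.isOpen_overlap i j
  isOpen_target := P.isOpen_target i
  mapsTo := fun _ hy => (P.mapsTo_trans i j hy).1
  smooth_coord := P.contDiffOn_trans i j
  smooth_gauge := P.contMDiffOn_gLoc i j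
  smooth_source := (hA.1 j).mono (P.overlap_subset i j)
  smooth_target := hA.1 i
  rel := hA.2.2 i j

variable {k : ℕ} {η η' : ι → LocalForm k}

theorem IsAdForm.add (h : P.IsAdForm Φ η) (h' : P.IsAdForm Φ η') : P.IsAdForm Φ (η + η') := by
  refine ⟨fun i => (h.1 i).add (h'.1 i), fun i y hy => ?_, fun i j y hy v => ?_⟩
  · simp [h.2.1 i y hy, h'.2.1 i y hy]
  · simp only [Pi.add_apply, ContinuousAlternatingMap.add_apply, h.2.2 i j y hy v,
      h'.2.2 i j y hy v, Ad_add]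

theorem IsAdForm.smul (h : P.IsAdForm Φ η) (r : ℝ) : P.IsAdForm Φ (r • η) := by
  refine ⟨fun i => (h.1 i).const_smul r, fun i y hy => ?_, fun i j y hy v => ?_⟩
  · simp [h.2.1 i y hy]
  · simp only [Pi.smul_apply, ContinuousAlternatingMap.smul_apply, h.2.2 i j y hy v, Ad_smul]

variable (P) in
/-- Restriction of local forms to the chart domains. -/
def restrict (η : ι → LocalForm k) (i : ι) : LocalForm k := (P.chart i).target.indicator (η i)

theorem restrict_apply {i : ι} {y : E3} (hy : y ∈ (P.chart i).target) :
    P.restrict η i y = η i y := Set.indicator_of_mem hy _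

theorem isAdForm_restrict (h : ∀ i, ContDiffOn ℝ ∞ (η i) (P.chart i).target)
    (h2 : ∀ i j, ∀ y ∈ P.overlap i j, ∀ v : Fin k → E3, η j y v = Ad Φ (P.gLoc i j y)⁻¹
      (η i (P.trans i j y) (fun a => fderiv ℝ (P.trans i j) y (v a)))) :
    P.IsAdForm Φ (P.restrict η) := by
  refine ⟨fun i => (h i).congr fun y hy => restrict_apply hy,
    fun i y hy => Set.indicator_of_notMem hy _, fun i j y hy v => ?_⟩
  rw [restrict_apply hy.1, restrict_apply (P.mapsTo_trans i j hy).1, h2 i j y hy v]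

theorem IsAdForm.covD {A : ι → LocalForm 1} (hA : P.IsConnection Φ A) (h : P.IsAdForm Φ η) :
    P.IsAdForm Φ (P.restrict fun i => covD (A i) (η i)) :=
  isAdForm_restrict (fun i => contDiffOn_covD (P.isOpen_target i) (hA.1 i) (h.1 i))
    fun i j _ hy v => (hA.isGaugeChange i j).covD_rel (h.1 i)
      ((h.1 j).mono (P.overlap_subset i j)) (h.2.2 i j) hy v

/-- The bracket of a form with a constant from the right. -/
def bracketRight (B : E3 [⋀^Fin k]→L[ℝ] 𝔡) (X : 𝔡) : E3 [⋀^Fin k]→L[ℝ] 𝔡 :=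
  (-lieCLM X).compContinuousAlternatingMap B

theorem bracketRight_apply (B : E3 [⋀^Fin k]→L[ℝ] 𝔡) (X : 𝔡) (w : Fin k → E3) :
    bracketRight B X w = ⁅B w, X⁆ := by
  rw [← lie_skew]; rfl

theorem IsAdForm.bracketRight {a : ι → LocalForm 0} (h : P.IsAdForm Φ η) (ha : P.IsAdForm Φ a) :
    P.IsAdForm Φ (fun i y => bracketRight (η i y) (a i y ![])) := by
  refine ⟨fun i => ?_, fun i y hy => ?_, fun i j y hy v => ?_⟩
  · rw [contDiffOn_form_iff]
    intro w
    simp only [bracketRight_apply]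
    exact contDiffOn_lie (contDiffOn_form_iff.1 (h.1 i) w) (contDiffOn_form_iff.1 (ha.1 i) _)
  · ext1 w
    rw [bracketRight_apply, h.2.1 i y hy]; simp
  · rw [bracketRight_apply, bracketRight_apply, h.2.2 i j y hy, ha.2.2 i j y hy, Ad_lie]
    congr 4
    exact Subsingleton.elim _ _

/-- The infinitesimal symmetry of the fields generated by a multiplier. -/
def flow (P : BundleAtlas E D N ι) (Λ : ℝ) (l : Multiplier ι) (φ : Config ι) : Config ι :=
  ((P.restrict fun i => QEGR.covD (φ.1 i) (l.1 i)) + (-Λ) • l.2,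
    (fun i y => BundleAtlas.bracketRight (φ.2 i y) (l.1 i y ![])) +
      P.restrict fun i => QEGR.covD (φ.1 i) (l.2 i))

theorem flow_mem_tangent (Λ : ℝ) {l : Multiplier ι} {φ : Config ι} (hl : l ∈ P.multipliers Φ)
    (hφ : φ ∈ P.phaseSpace Φ) : P.flow Λ l φ ∈ P.tangent Φ :=
  ⟨(hl.1.covD hφ.1).add (hl.2.smul _), (hφ.2.bracketRight hl.1).add (hl.2.covD hφ.1)⟩

variable (Φ) in
open Classical in
/-- The global form that is equal to a given compactly supported form in a chart. -/
def globalForm (P : BundleAtlas E D N ι) (i : ι) (η : LocalForm k) (j : ι) : LocalForm k := fun z =>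
  if z ∈ P.overlap i j then (adMap Φ (P.gLoc i j z)⁻¹).compContinuousAlternatingMap
    ((η (P.trans i j z)).compContinuousLinearMap (fderiv ℝ (P.trans i j) z)) else 0

omit [IsManifold (𝓡 3) ∞ N] in
theorem globalForm_apply {i j : ι} {η : LocalForm k} {z : E3} (hz : z ∈ P.overlap i j)
    (w : Fin k → E3) : P.globalForm Φ i η j z w =
      Ad Φ (P.gLoc i j z)⁻¹ (η (P.trans i j z) (fun a => fderiv ℝ (P.trans i j) z (w a))) := by
  rw [globalForm, if_pos hz]; rfl

theorem globalForm_self {i : ι} {η : LocalForm k} (hη : tsupport η ⊆ (P.chart i).target) :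
    P.globalForm Φ i η i = η := by
  ext z w
  by_cases hz : z ∈ (P.chart i).target
  · rw [globalForm_apply (P.mem_overlap_self hz), P.fderiv_trans_self hz, P.trans_self hz, gLoc,
      P.g_self ((P.chart i).map_target hz), inv_one, Ad_one]
    rfl
  · rw [globalForm, if_neg fun h => hz h.1]
    have : η z = 0 := image_eq_zero_of_notMem_tsupport fun h => hz (hη h)
    rw [this]

/-- Compact support in the chart domain makes extension by zero smooth, and the cocycle identity
together with the chain rule for `trans` gives the transformation law. -/
theorem isAdForm_globalForm [T2Space N] {i : ι} {η : LocalForm k} (hs : ContDiff ℝ ∞ η)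
    (hc : HasCompactSupport η) (hη : tsupport η ⊆ (P.chart i).target) :
    P.IsAdForm Φ (P.globalForm Φ i η) := by
  refine ⟨fun j z hz => ?_, fun j z hz => ?_, fun j l y hy v => ?_⟩
  · by_cases hzo : z ∈ P.overlap i j
    · have h1 : ContDiffOn ℝ ∞ (P.globalForm Φ i η j) (P.overlap i j) := by
        rw [contDiffOn_form_iff]
        intro w
        have h2 := (P.contDiffOn_adMap_gLoc (Φ := Φ) i j).clm_apply
          (contDiffOn_pullback (P.isOpen_overlap i j) (P.contDiffOn_trans i j) (V := Set.univ)
            hs.contDiffOn (fun _ _ => trivial) w)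
        exact h2.congr fun y hy => globalForm_apply hy w
      exact (h1.contDiffAt ((P.isOpen_overlap i j).mem_nhds hzo)).contDiffWithinAt
    -- Here `N` being Hausdorff matters: the compact support is closed in `N`, so a point outside
    -- the `i`-th domain has a neighbourhood on which the form vanishes.
    · have hK : IsClosed ((P.chart i).symm '' tsupport η) :=
        (hc.image_of_continuousOn ((P.chart i).continuousOn_symm.mono hη)).isClosed
      have hzK : (P.chart j).symm z ∉ (P.chart i).symm '' tsupport η := by
        rintro ⟨x, hx, hxz⟩
        exact hzo ⟨hz, hxz ▸ (P.chart i).map_target (hη hx)⟩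
      have hc : ContinuousAt (P.chart j).symm z := (P.chart j).continuousAt_symm hz
      have h0 : P.globalForm Φ i η j =ᶠ[𝓝 z] fun _ => 0 := by
        filter_upwards [hc.eventually_mem (hK.isOpen_compl.mem_nhds hzK)] with y hy
        by_cases hyo : y ∈ P.overlap i j
        · ext1 w
          have : η (P.trans i j y) = 0 := image_eq_zero_of_notMem_tsupport fun h =>
            hy ⟨_, h, P.trans_symm hyo⟩
          rw [globalForm_apply hyo, this]
          exact Ad_zero Φ _
        · rw [globalForm, if_neg hyo]
      exact (contDiffAt_const.congr_of_eventuallyEq h0).contDiffWithinAt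
  · rw [globalForm, if_neg fun h => hz h.1]
  · by_cases hyi : y ∈ P.overlap i l
    · have hyj := (P.mem_overlap_trans_iff hy).2 hyi
      rw [globalForm_apply hyi, globalForm_apply hyj, ← Ad_mul, P.trans_comp hy]
      have hg : P.gLoc i l y = P.gLoc i j (P.trans j l y) * P.gLoc j l y := by
        rw [gLoc, gLoc, gLoc, P.trans_symm hy]
        exact (P.cocycle i j l _ ⟨⟨hyi.2, hy.2⟩, (P.chart l).map_target hy.1⟩).symm
      rw [hg, mul_inv_rev]
      congr 3
      ext1 a
      exact (P.fderiv_trans_comp hy hyi _).symm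
    · have hyj : P.trans j l y ∉ P.overlap i j := fun h => hyi ((P.mem_overlap_trans_iff hy).1 h)
      rw [globalForm, if_neg hyi, globalForm, if_neg hyj]
      exact (Ad_zero Φ _).symm

end BundleAtlas
end Atlas
end QEGR
end

open scoped Manifold ContDiff
noncomputable section
namespace QEGR
open Filter Topology MeasureTheory

/-! ### Integrals of derivatives of compactly supported functions. -/

section CompactSupport
set_option linter.unusedSectionVars false
variable {F : Type*} [NormedAddCommGroup F] [NormedSpace ℝ F] {U K : Set E3} {f : E3 → F}

theorem contDiff_indicator (hU : IsOpen U) (hK : IsCompact K) (hKU : K ⊆ U)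
    (hf : ContDiffOn ℝ ∞ f U) (h0 : ∀ y ∈ U \ K, f y = 0) : ContDiff ℝ ∞ (U.indicator f) := by
  rw [contDiff_iff_contDiffAt]
  intro y
  by_cases hy : y ∈ U
  · refine (hf.contDiffAt (hU.mem_nhds hy)).congr_of_eventuallyEq ?_
    filter_upwards [hU.mem_nhds hy] with z hz using Set.indicator_of_mem hz f
  · refine contDiffAt_const (c := (0 : F)).congr_of_eventuallyEq ?_
    filter_upwards [hK.isClosed.isOpen_compl.mem_nhds fun h => hy (hKU h)] with z hz
    by_cases hzU : z ∈ U
    · rw [Set.indicator_of_mem hzU, h0 z ⟨hzU, hz⟩]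
    · exact Set.indicator_of_notMem hzU f

theorem hasCompactSupport_indicator (hK : IsCompact K) (h0 : ∀ y ∈ U \ K, f y = 0) :
    HasCompactSupport (U.indicator f) := by
  refine HasCompactSupport.intro hK fun y hy => ?_
  by_cases hyU : y ∈ U
  · rw [Set.indicator_of_mem hyU, h0 y ⟨hyU, hy⟩]
  · exact Set.indicator_of_notMem hyU f

theorem integrableOn_of_compact {f : E3 → ℝ} (hU : IsOpen U) (hK : IsCompact K) (hKU : K ⊆ U)
    (hf : ContinuousOn f U) (h0 : ∀ y ∈ U \ K, f y = 0) : IntegrableOn f U :=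
  ((hf.mono hKU).integrableOn_compact hK).of_forall_sdiff_eq_zero hU.measurableSet h0

/-- Integration by parts against the constant function `1`. -/
theorem integral_fderiv_eq_zero {u : E3 → ℝ} (hu : ContDiff ℝ ∞ u) (hc : HasCompactSupport u)
    (v : E3) : ∫ y, fderiv ℝ u y v = 0 := by
  have h1 : Integrable fun y => fderiv ℝ u y v := by
    refine Continuous.integrable_of_hasCompactSupport ?_ ?_
    · exact (hu.continuous_fderiv (by simp)).clm_apply continuous_const
    · exact hc.fderiv_apply ℝ v
  have h := integral_mul_fderiv_eq_neg_fderiv_mul_of_integrable (μ := volume) (f := fun _ : E3 => (1 : ℝ))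
    (g := u) (v := v) (by simp) (by simpa using h1)
    (by simpa using hu.continuous.integrable_of_hasCompactSupport hc)
    (fun _ _ => differentiableAt_const _) (fun x _ => (hu.differentiable (by simp)) x)
  simpa using h

theorem setIntegral_fderiv_eq_zero {f : E3 → ℝ} (hU : IsOpen U) (hK : IsCompact K) (hKU : K ⊆ U)
    (hf : ContDiffOn ℝ ∞ f U) (h0 : ∀ y ∈ U \ K, f y = 0) (v : E3) :
    ∫ y in U, fderiv ℝ f y v = 0 := by
  rw [← integral_fderiv_eq_zero (contDiff_indicator hU hK hKU hf h0)
    (hasCompactSupport_indicator hK h0) v, ← integral_indicator hU.measurableSet]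
  congr 1
  ext1 y
  by_cases hy : y ∈ U
  · rw [Set.indicator_of_mem hy]
    have : U.indicator f =ᶠ[𝓝 y] f := by
      filter_upwards [hU.mem_nhds hy] with z hz using Set.indicator_of_mem hz f
    rw [this.fderiv_eq]
  · rw [Set.indicator_of_notMem hy]
    have : U.indicator f =ᶠ[𝓝 y] fun _ => 0 := by
      filter_upwards [hK.isClosed.isOpen_compl.mem_nhds fun h => hy (hKU h)] with z hz
      by_cases hzU : z ∈ U
      · rw [Set.indicator_of_mem hzU, h0 z ⟨hzU, hz⟩]
      · exact Set.indicator_of_notMem hzU f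
    rw [this.fderiv_eq]; simp

end CompactSupport

/-! ### Three-forms on `ℝ³`, determinants and wedge products. -/

section ThreeForms

/-- The standard basis of `ℝ³`. -/
def stdBasis : Module.Basis (Fin 3) ℝ E3 := (EuclideanSpace.basisFun (Fin 3) ℝ).toBasis

theorem stdBasis_apply (a : Fin 3) : stdBasis a = e a := by simp [stdBasis, e]

theorem coe_stdBasis : ⇑stdBasis = ![e 0, e 1, e 2] := by
  ext1 a; fin_cases a <;> simp [stdBasis_apply]

/-- Three-forms on `ℝ³` are pulled back by the determinant. -/
theorem threeForm_comp (γ : E3 [⋀^Fin 3]→L[ℝ] ℝ) (L : E3 →L[ℝ] E3) :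
    γ (fun a => L ((![e 0, e 1, e 2] : Fin 3 → E3) a)) = L.det * γ ![e 0, e 1, e 2] := by
  rw [← coe_stdBasis]
  have h := γ.toAlternatingMap.eq_smul_basis_det stdBasis
  have h1 : γ (fun a => L (stdBasis a)) = γ stdBasis * stdBasis.det (fun a => L (stdBasis a)) :=
    congrArg (fun T => T (fun a => L (stdBasis a))) h
  have h2 := stdBasis.det_comp (L : E3 →ₗ[ℝ] E3) stdBasis
  rw [h1]
  have h3 : stdBasis.det (fun a => L (stdBasis a)) = L.det := by
    refine Eq.trans h2 ?_
    rw [Module.Basis.det_self, mul_one]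
  rw [h3, mul_comm]

variable {G : Type*} [NormedAddCommGroup G] [NormedSpace ℝ G] {k : ℕ}

/-- The wedge product of a one-form with values in functionals on `G` and a `G`-valued form. -/
def wedgeOne (m : E3 →L[ℝ] (G →L[ℝ] ℝ)) (η : E3 [⋀^Fin k]→L[ℝ] G) : E3 [⋀^Fin (k + 1)]→L[ℝ] ℝ :=
  ContinuousAlternatingMap.alternatizeUncurryFin (LinearMap.toContinuousLinearMap
    { toFun := fun v => (m v).compContinuousAlternatingMap η
      map_add' := fun v w => by rw [map_add]; rfl
      map_smul' := fun r v => by rw [map_smul]; rfl })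

theorem wedgeOne_apply (m : E3 →L[ℝ] (G →L[ℝ] ℝ)) (η : E3 [⋀^Fin k]→L[ℝ] G)
    (w : Fin (k + 1) → E3) : wedgeOne m η w =
      ∑ i : Fin (k + 1), (-1 : ℝ) ^ i.val * m (w i) (η (i.removeNth w)) := by
  simp only [wedgeOne, ContinuousAlternatingMap.alternatizeUncurryFin_apply]
  refine Finset.sum_congr rfl fun i _ => ?_
  rcases Nat.even_or_odd i.val with h | h
  · simp [h.neg_one_pow]
  · simp [h.neg_one_pow]

theorem wedgeOne_std (m : E3 →L[ℝ] (G →L[ℝ] ℝ)) (η : E3 [⋀^Fin 2]→L[ℝ] G) :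
    wedgeOne m η ![e 0, e 1, e 2] = cyc fun a b c => m (e c) (η ![e a, e b]) := by
  rw [wedgeOne_apply, Fin.sum_univ_three, removeNth_three_zero, removeNth_three_one,
    removeNth_three_two]
  simp only [cyc, form_swap η (e 2) (e 0), map_neg]
  simp
  ring

end ThreeForms
end QEGR
end

open scoped Manifold ContDiff
noncomputable section
namespace QEGR
open Filter Topology MeasureTheory TrivialExt

/-! ### Densities and the independence of their integral from the partition of unity. -/

section Integral
set_option linter.unusedSectionVars false
variable {E D N ι : Type*} [NormedAddCommGroup E] [NormedSpace ℝ E] [CompleteSpace E]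
  [TopologicalSpace D] [ChartedSpace E D] [Group D] [LieGroup 𝓘(ℝ, E) ∞ D]
  [TopologicalSpace N] [ChartedSpace E3 N] [T2Space N] [CompactSpace N]
  [IsManifold (𝓡 3) ∞ N] [Fintype ι]

namespace BundleAtlas
variable (P : BundleAtlas E D N ι)

/-- The functions of the partition of unity in local coordinates. -/
def pouLoc (i j : ι) (y : E3) : ℝ := P.pou i ((P.chart j).symm y)

theorem pou_subordinate (i : ι) : tsupport (P.pou i) ⊆ (P.chart i).source :=
  P.exists_pou.choose_spec i

theorem pouLoc_eq_zero {i j : ι} {y : E3} (hy : y ∈ (P.chart j).target) (h : y ∉ P.overlap i j) :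
    P.pouLoc i j y = 0 :=
  image_eq_zero_of_notMem_tsupport (f := P.pou i) fun h' => h ⟨hy, P.pou_subordinate i h'⟩

theorem pouLoc_trans {i j k : ι} {y : E3} (hy : y ∈ P.overlap j k) :
    P.pouLoc i j (P.trans j k y) = P.pouLoc i k y := by
  rw [pouLoc, P.trans_symm hy, pouLoc]

theorem sum_pouLoc (j : ι) (y : E3) : ∑ i, P.pouLoc i j y = 1 := by
  have := P.pou.sum_eq_one (Set.mem_univ ((P.chart j).symm y))
  rwa [finsum_eq_sum_of_fintype] at this

theorem contDiffOn_pouLoc (i j : ι) : ContDiffOn ℝ ∞ (P.pouLoc i j) (P.chart j).target := by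
  rw [← contMDiffOn_iff_contDiffOn]
  exact (P.pou i).contMDiff.comp_contMDiffOn (contMDiffOn_symm_of_mem_maximalAtlas (P.chart_mem j))

/-- The support of the `i`-th function of the partition of unity in the `i`-th chart. -/
def pouSupport (i : ι) : Set E3 := P.chart i '' tsupport (P.pou i)

theorem isCompact_pouSupport (i : ι) : IsCompact (P.pouSupport i) :=
  (isClosed_tsupport _).isCompact.image_of_continuousOn
    ((P.chart i).continuousOn.mono (P.pou_subordinate i))

theorem pouSupport_subset (i : ι) : P.pouSupport i ⊆ (P.chart i).target := by
  rintro _ ⟨x, hx, rfl⟩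
  exact (P.chart i).map_source (P.pou_subordinate i hx)

theorem pouLoc_eq_zero_of_notMem {i : ι} {y : E3} (hy : y ∈ (P.chart i).target \ P.pouSupport i) :
    P.pouLoc i i y = 0 :=
  image_eq_zero_of_notMem_tsupport (f := P.pou i) fun h => hy.2 ⟨_, h, (P.chart i).right_inv hy.1⟩

variable {ρ ρ' : ι → E3 → ℝ}

theorem integrableOn_pou_mul (h : ∀ i, ContinuousOn (ρ i) (P.chart i).target) (i : ι) :
    IntegrableOn (fun y => P.pou i ((P.chart i).symm y) * ρ i y) (P.chart i).target :=
  integrableOn_of_compact (P.isOpen_target i) (P.isCompact_pouSupport i) (P.pouSupport_subset i)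
    ((P.contDiffOn_pouLoc i i).continuousOn.mul (h i)) fun y hy => by
      have := P.pouLoc_eq_zero_of_notMem hy
      rw [pouLoc] at this
      rw [this, zero_mul]

theorem integral_congr (h : ∀ i, ∀ y ∈ (P.chart i).target, ρ i y = ρ' i y) :
    P.integral ρ = P.integral ρ' := by
  refine Finset.sum_congr rfl fun i _ => setIntegral_congr_fun (P.isOpen_target i).measurableSet
    fun y hy => ?_
  simp only [h i y hy]

theorem integral_add (h : ∀ i, ContinuousOn (ρ i) (P.chart i).target)
    (h' : ∀ i, ContinuousOn (ρ' i) (P.chart i).target) :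
    P.integral (fun i y => ρ i y + ρ' i y) = P.integral ρ + P.integral ρ' := by
  simp only [integral, mul_add, ← Finset.sum_add_distrib]
  exact Finset.sum_congr rfl fun i _ => MeasureTheory.integral_add (P.integrableOn_pou_mul h i)
    (P.integrableOn_pou_mul h' i)

theorem integral_const_mul (r : ℝ) : P.integral (fun i y => r * ρ i y) = r * P.integral ρ := by
  simp only [integral, Finset.mul_sum, ← MeasureTheory.integral_const_mul]
  refine Finset.sum_congr rfl fun i _ => ?_
  congr 1; ext y; ring

theorem integral_sub (h : ∀ i, ContinuousOn (ρ i) (P.chart i).target)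
    (h' : ∀ i, ContinuousOn (ρ' i) (P.chart i).target) :
    P.integral (fun i y => ρ i y - ρ' i y) = P.integral ρ - P.integral ρ' := by
  simp only [integral, mul_sub, ← Finset.sum_sub_distrib]
  exact Finset.sum_congr rfl fun i _ => MeasureTheory.integral_sub (P.integrableOn_pou_mul h i)
    (P.integrableOn_pou_mul h' i)

theorem integral_zero : P.integral (fun _ _ => 0) = 0 := by
  simp [integral]

theorem integral_finset_sum {κ : Type*} (s : Finset κ) (ρ : κ → ι → E3 → ℝ)
    (h : ∀ a i, ContinuousOn (ρ a i) (P.chart i).target) :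
    P.integral (fun i y => ∑ a ∈ s, ρ a i y) = ∑ a ∈ s, P.integral (ρ a) := by
  simp only [integral, Finset.mul_sum]
  rw [Finset.sum_comm]
  exact Finset.sum_congr rfl fun i _ => MeasureTheory.integral_finsetSum s
    fun a _ => P.integrableOn_pou_mul (h a) i

/-- Local expressions of a continuous three-form. -/
structure IsDensity (ρ : ι → E3 → ℝ) : Prop where
  continuousOn : ∀ i, ContinuousOn (ρ i) (P.chart i).target
  rel : ∀ i j, ∀ y ∈ P.overlap i j, ρ j y = (fderiv ℝ (P.trans i j) y).det * ρ i (P.trans i j y)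

theorem image_trans (i j : ι) : P.trans i j '' P.overlap i j = P.overlap j i := by
  refine Set.Subset.antisymm (P.mapsTo_trans i j).image_subset fun y hy => ?_
  exact ⟨P.trans j i y, P.mapsTo_trans j i hy, P.trans_trans hy⟩

theorem injOn_trans (i j : ι) : Set.InjOn (P.trans i j) (P.overlap i j) := by
  intro y hy z hz h
  rw [← P.trans_trans hy, h, P.trans_trans hz]

/-- Change of variables; the atlas is oriented, so the Jacobian determinant is positive and its
absolute value can be dropped. -/
theorem setIntegral_overlap (i j : ι) (f : E3 → ℝ) : ∫ y in P.overlap j i, f y =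
    ∫ y in P.overlap i j, (fderiv ℝ (P.trans i j) y).det * f (P.trans i j y) := by
  rw [← P.image_trans i j, integral_image_eq_integral_abs_det_fderiv_smul volume
    (P.isOpen_overlap i j).measurableSet
    (fun y hy => (P.differentiableAt_trans hy).hasFDerivAt.hasFDerivWithinAt) (P.injOn_trans i j)]
  refine setIntegral_congr_fun (P.isOpen_overlap i j).measurableSet fun y hy => ?_
  have h : 0 < (fderiv ℝ (P.trans i j) y).det := P.oriented i j y hy.1 hy.2
  simp only [abs_of_pos h, smul_eq_mul]

variable {P}

/-- The integral of a density supported in a chart. -/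
theorem IsDensity.integral_eq (hρ : P.IsDensity ρ) (k : ι) {K : Set E3} (hK : IsCompact K)
    (hKk : K ⊆ (P.chart k).target)
    (h0 : ∀ i, ∀ y ∈ (P.chart i).target, (y ∈ P.overlap k i → P.trans k i y ∉ K) → ρ i y = 0) :
    P.integral ρ = ∫ y in (P.chart k).target, ρ k y := by
  have h0k : ∀ y ∈ (P.chart k).target \ K, ρ k y = 0 := fun y hy =>
    h0 k y hy.1 fun _ => by rw [P.trans_self hy.1]; exact hy.2
  -- Each summand lives on the overlap with the `k`-th chart and is transported there; afterwards
  -- the weights of the partition of unity add up to `1`.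
  have h1 : ∀ i, ∫ y in (P.chart i).target, P.pou i ((P.chart i).symm y) * ρ i y =
      ∫ y in (P.chart k).target, P.pouLoc i k y * ρ k y := by
    intro i
    have h0i : ∀ y ∈ (P.chart i).target \ P.overlap k i,
        P.pou i ((P.chart i).symm y) * ρ i y = 0 := fun y hy => by
      rw [h0 i y hy.1 fun h => absurd h hy.2, mul_zero]
    have e1 : ∫ y in (P.chart i).target, P.pou i ((P.chart i).symm y) * ρ i y =
        ∫ y in P.overlap k i, P.pou i ((P.chart i).symm y) * ρ i y :=
      (setIntegral_eq_of_subset_of_forall_sdiff_eq_zero (P.isOpen_target i).measurableSet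
        (P.overlap_subset k i) h0i)
    have e2 : ∫ y in (P.chart k).target, P.pouLoc i k y * ρ k y =
        ∫ y in P.overlap i k, P.pouLoc i k y * ρ k y :=
      (setIntegral_eq_of_subset_of_forall_sdiff_eq_zero (P.isOpen_target k).measurableSet
        (P.overlap_subset i k) fun y hy => by rw [P.pouLoc_eq_zero hy.1 hy.2, zero_mul])
    rw [e1, e2, P.setIntegral_overlap i k]
    refine setIntegral_congr_fun (P.isOpen_overlap i k).measurableSet fun y hy => ?_
    have := P.pouLoc_trans (i := i) hy
    rw [pouLoc] at this
    simp only [this, hρ.rel i k y hy]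
    ring
  simp only [integral, h1]
  rw [← MeasureTheory.integral_finsetSum]
  · congr 1; ext y
    rw [← Finset.sum_mul, P.sum_pouLoc, one_mul]
  · intro i _
    exact integrableOn_of_compact (P.isOpen_target k) hK hKk
      ((P.contDiffOn_pouLoc i k).continuousOn.mul (hρ.continuousOn k))
      fun y hy => by rw [h0k y hy, mul_zero]

theorem isDensity_of_form (γ : ι → E3 → E3 [⋀^Fin 3]→L[ℝ] ℝ)
    (hc : ∀ i, ContinuousOn (fun y => γ i y ![e 0, e 1, e 2]) (P.chart i).target)
    (h : ∀ i j, ∀ y ∈ P.overlap i j, ∀ w, γ j y w =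
      γ i (P.trans i j y) (fun a => fderiv ℝ (P.trans i j) y (w a))) :
    P.IsDensity fun i y => γ i y ![e 0, e 1, e 2] :=
  ⟨hc, fun i j y hy => by rw [h i j y hy, threeForm_comp]⟩

variable {Φ : GroupLieAlgebra 𝓘(ℝ, E) D ≃ₗ⁅ℝ⁆ 𝔡}

/-- Invariance of the inner product under `Ad` cancels the gauge factors, so the pairing is an
ordinary three-form. -/
theorem IsAdForm.isDensity_pair
    (hΦ : ∀ (a : D) (X Y : 𝔡), pair (Ad Φ a X) (Ad Φ a Y) = pair X Y)
    {η : ι → LocalForm 3} {a : ι → LocalForm 0} (hη : P.IsAdForm Φ η) (ha : P.IsAdForm Φ a) :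
    P.IsDensity fun i y => pair (η i y ![e 0, e 1, e 2]) (a i y ![]) := by
  have := isDensity_of_form (P := P)
    (fun i y => (pairCLM (a i y ![])).compContinuousAlternatingMap (η i y)) (fun i => ?_)
    fun i j y hy w => ?_
  · refine cast ?_ this
    congr 1; ext i y
    exact pair_comm _ _
  · exact (contDiffOn_pair (contDiffOn_form_iff.1 (ha.1 i) _)
      (contDiffOn_form_iff.1 (hη.1 i) _)).continuousOn
  · change pair (a j y ![]) (η j y w) = pair (a i _ ![]) (η i _ _)
    rw [ha.2.2 i j y hy, hη.2.2 i j y hy, hΦ]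
    congr 2
    exact Subsingleton.elim _ _

/-- A one-form as a linear map. -/
def oneFormCLM (α : E3 [⋀^Fin 1]→L[ℝ] 𝔡) : E3 →L[ℝ] 𝔡 :=
  (ContinuousAlternatingMap.ofSubsingleton ℝ E3 𝔡 (0 : Fin 1)).symm α

theorem oneFormCLM_apply (α : E3 [⋀^Fin 1]→L[ℝ] 𝔡) (v : E3) : oneFormCLM α v = α ![v] :=
  ofSubsingleton_symm_apply α v

theorem IsAdForm.isDensity_cyc
    (hΦ : ∀ (a : D) (X Y : 𝔡), pair (Ad Φ a X) (Ad Φ a Y) = pair X Y)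
    {B : ι → LocalForm 2} {H : ι → LocalForm 1} (hB : P.IsAdForm Φ B) (hH : P.IsAdForm Φ H) :
    P.IsDensity fun i y => cyc fun a b c => pair (B i y ![e a, e b]) (H i y ![e c]) := by
  have h0 : ∀ i y, wedgeOne (pairCLM.comp (oneFormCLM (H i y))) (B i y) ![e 0, e 1, e 2] =
      cyc fun a b c => pair (B i y ![e a, e b]) (H i y ![e c]) := by
    intro i y
    rw [wedgeOne_std]
    simp only [ContinuousLinearMap.comp_apply, pairCLM_apply, oneFormCLM_apply]
    simp only [cyc, pair_comm]
  have := isDensity_of_form (P := P)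
    (fun i y => wedgeOne (pairCLM.comp (oneFormCLM (H i y))) (B i y)) (fun i => ?_)
    fun i j y hy w => ?_
  · simpa only [h0] using this
  · simp only [h0]
    have h := fun a b c => (contDiffOn_pair (contDiffOn_form_iff.1 (hB.1 i) ![e a, e b])
      (contDiffOn_form_iff.1 (hH.1 i) ![e c])).continuousOn
    exact ((h 0 1 2).add (h 1 2 0)).add (h 2 0 1)
  · rw [wedgeOne_apply, wedgeOne_apply]
    refine Finset.sum_congr rfl fun l _ => ?_
    simp only [ContinuousLinearMap.comp_apply, pairCLM_apply, oneFormCLM_apply]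
    rw [hB.2.2 i j y hy, hH.2.2 i j y hy, hΦ]
    congr 3
    ext a; fin_cases a; rfl

end BundleAtlas
end Integral
end QEGR
end

open scoped Manifold ContDiff
noncomputable section
namespace QEGR
open Filter Topology MeasureTheory TrivialExt

/-! ### Leibniz rules, divergences and forms with prescribed components. -/

section Calculus
variable {A : LocalForm 1} {f g : E3 → 𝔡} {y : E3} {U : Set E3}

theorem nabla_sum {κ : Type*} (s : Finset κ) (f : κ → E3 → 𝔡) (v : E3)
    (hf : ∀ k ∈ s, DifferentiableAt ℝ (f k) y) :
    nabla A v (fun z => ∑ k ∈ s, f k z) y = ∑ k ∈ s, nabla A v (f k) y := by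
  simp only [nabla]
  rw [fderiv_fun_sum hf, Finset.sum_add_distrib]
  congr 1
  · simp
  · simp only [← lieCLM_apply, map_sum]

theorem nabla_of_eventuallyEq_zero (v : E3) (h : f =ᶠ[𝓝 y] fun _ => 0) : nabla A v f y = 0 := by
  rw [nabla, h.fderiv_eq, h.eq_of_nhds]
  simp

/-- The connection terms on the right cancel because the inner product is invariant under the
bracket. -/
theorem fderiv_pair_nabla (hf : DifferentiableAt ℝ f y) (hg : DifferentiableAt ℝ g y) (v : E3) :
    fderiv ℝ (fun z => pair (f z) (g z)) y v =
      pair (nabla A v f y) (g y) + pair (f y) (nabla A v g y) := by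
  have h1 : pair ⁅A y ![v], f y⁆ (g y) = - pair (f y) ⁅A y ![v], g y⁆ := by
    rw [← lie_skew, pair_neg_left, pair_lie]
  rw [fderiv_pair hf hg, nabla, nabla, pair_add_left, pair_add_right, h1]
  ring

theorem setIntegral_divergence_eq_zero {K : Set E3} (hU : IsOpen U) (hK : IsCompact K)
    (hKU : K ⊆ U) {f : Fin 3 → Fin 3 → Fin 3 → E3 → ℝ}
    (hf : ∀ a b c, ContDiffOn ℝ ∞ (f a b c) U) (h0 : ∀ a b c, ∀ y ∈ U \ K, f a b c y = 0) :
    ∫ y in U, (cyc fun a b c => fderiv ℝ (f a b c) y (e c)) = 0 := by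
  have hi : ∀ a b c, IntegrableOn (fun y => fderiv ℝ (f a b c) y (e c)) U := by
    intro a b c
    refine integrableOn_of_compact hU hK hKU
      (((hf a b c).continuousOn_fderiv_of_isOpen hU (by simp)).clm_apply continuousOn_const) ?_
    intro y hy
    have : f a b c =ᶠ[𝓝 y] fun _ => 0 := by
      filter_upwards [(hU.sdiff hK.isClosed).mem_nhds hy] with z hz using h0 a b c z hz
    rw [this.fderiv_eq]; simp
  have hz := fun a b c => setIntegral_fderiv_eq_zero hU hK hKU (hf a b c) (h0 a b c) (e c)
  simp only [cyc]
  have h3 : IntegrableOn (fun y => fderiv ℝ (f 0 1 2) y (e 2) + fderiv ℝ (f 1 2 0) y (e 0)) U :=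
    (hi 0 1 2).add (hi 1 2 0)
  rw [MeasureTheory.integral_add h3 (hi 2 0 1),
    MeasureTheory.integral_add (hi 0 1 2) (hi 1 2 0), hz, hz, hz]
  simp

/-- The fundamental lemma of the calculus of variations gives vanishing almost everywhere;
continuity on the open set upgrades it to every point. -/
theorem eq_zero_of_setIntegral_mul_eq_zero {f : E3 → ℝ} (hU : IsOpen U) (hf : ContinuousOn f U)
    (h : ∀ g : E3 → ℝ, ContDiff ℝ ∞ g → HasCompactSupport g → tsupport g ⊆ U →
      ∫ y in U, g y * f y = 0) {y : E3} (hy : y ∈ U) : f y = 0 := by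
  have h1 := hU.ae_eq_zero_of_integral_contDiff_smul_eq_zero (μ := volume)
    (hf.locallyIntegrableOn hU.measurableSet) (fun g hg hc hs => by
      rw [← h g hg hc hs, ← setIntegral_eq_integral_of_forall_compl_eq_zero (s := U)]
      · rfl
      · intro x hx
        rw [image_eq_zero_of_notMem_tsupport fun h => hx (hs h), zero_smul])
  have h2 : f =ᵐ[volume.restrict U] fun _ => 0 := by
    rw [Filter.EventuallyEq, ae_restrict_iff' hU.measurableSet]
    exact h1
  exact Measure.eqOn_open_of_ae_eq h2 hU hf continuousOn_const hy

/-- The one-form with given components. -/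
def oneFormOf : (Fin 3 → 𝔡) →L[ℝ] E3 [⋀^Fin 1]→L[ℝ] 𝔡 :=
  LinearMap.toContinuousLinearMap
    { toFun := fun f => ContinuousAlternatingMap.ofSubsingleton ℝ E3 𝔡 (0 : Fin 1)
        (∑ c, (EuclideanSpace.proj c : E3 →L[ℝ] ℝ).smulRight (f c))
      map_add' := fun f g => by
        ext w; simp [Finset.sum_add_distrib]
      map_smul' := fun r f => by
        ext w; simp [Finset.smul_sum, smul_comm r] }

theorem oneFormOf_apply (f : Fin 3 → 𝔡) (w : Fin 1 → E3) :
    oneFormOf f w = ∑ c, w 0 c • f c := by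
  simp [oneFormOf]

theorem oneFormOf_std (f : Fin 3 → 𝔡) (c : Fin 3) : oneFormOf f ![e c] = f c := by
  rw [oneFormOf_apply]
  simp [e]

/-- The two-form with given components; the component `c` is the value on `e a, e b` for
`(a, b, c)` a cyclic permutation. -/
def twoFormOf : (Fin 3 → 𝔡) →L[ℝ] E3 [⋀^Fin 2]→L[ℝ] 𝔡 :=
  LinearMap.toContinuousLinearMap
    { toFun := fun f => ContinuousAlternatingMap.alternatizeUncurryFin
        (LinearMap.toContinuousLinearMap
          -- For each cyclic `(a, b, c)` this contains `v a * w b • f c`; alternatization supplies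
          -- the term with `v` and `w` exchanged.
          { toFun := fun v : E3 => oneFormOf ![v 2 • f 1, v 0 • f 2, v 1 • f 0]
            map_add' := fun v w => by
              rw [← map_add]; congr 1; ext c; fin_cases c <;> simp [add_smul]
            map_smul' := fun r v => by
              rw [RingHom.id_apply, ← map_smul]; congr 1; ext c; fin_cases c <;> simp [mul_smul] })
      map_add' := fun f g => by
        ext w
        simp [ContinuousAlternatingMap.alternatizeUncurryFin_apply, oneFormOf_apply,
          Fin.sum_univ_succ]
        abel
      map_smul' := fun r f => by
        ext w
        simp [ContinuousAlternatingMap.alternatizeUncurryFin_apply, oneFormOf_apply,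
          Fin.sum_univ_succ, smul_comm r]
        }

theorem twoFormOf_apply (f : Fin 3 → 𝔡) (v w : E3) :
    twoFormOf f ![v, w] = cyc fun a b c => (v a * w b - v b * w a) • f c := by
  simp [twoFormOf, ContinuousAlternatingMap.alternatizeUncurryFin_apply, oneFormOf_apply,
    Fin.sum_univ_succ, cyc, removeNth_two_one, sub_smul, mul_smul]
  simp only [smul_smul, mul_comm]
  abel

theorem twoFormOf_std (f : Fin 3 → 𝔡) : twoFormOf f ![e 0, e 1] = f 2 ∧
    twoFormOf f ![e 1, e 2] = f 0 ∧ twoFormOf f ![e 2, e 0] = f 1 := by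
  simp only [twoFormOf_apply, cyc]
  simp [e]

end Calculus
end QEGR
end

open scoped Manifold ContDiff
noncomputable section
namespace QEGR
open Filter Topology MeasureTheory TrivialExt

/-! ### Integration by parts for the covariant derivative on the closed manifold. -/

section Integral
set_option linter.unusedSectionVars false
variable {E D N ι : Type*} [NormedAddCommGroup E] [NormedSpace ℝ E] [CompleteSpace E]
  [TopologicalSpace D] [ChartedSpace E D] [Group D] [LieGroup 𝓘(ℝ, E) ∞ D]
  [TopologicalSpace N] [ChartedSpace E3 N] [T2Space N] [CompactSpace N]
  [IsManifold (𝓡 3) ∞ N] [Fintype ι]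

namespace BundleAtlas
variable {P : BundleAtlas E D N ι} {Φ : GroupLieAlgebra 𝓘(ℝ, E) D ≃ₗ⁅ℝ⁆ 𝔡}
  {ρ ρ' : ι → E3 → ℝ} {m : ℕ}

theorem IsDensity.congr (h : P.IsDensity ρ) (h' : ∀ i, ∀ y ∈ (P.chart i).target, ρ' i y = ρ i y) :
    P.IsDensity ρ' :=
  ⟨fun i => (h.continuousOn i).congr (h' i), fun i j y hy => by
    rw [h' j y hy.1, h' i _ (P.mapsTo_trans i j hy).1, h.rel i j y hy]⟩

theorem IsDensity.add (h : P.IsDensity ρ) (h' : P.IsDensity ρ') :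
    P.IsDensity fun i y => ρ i y + ρ' i y :=
  ⟨fun i => (h.continuousOn i).add (h'.continuousOn i), fun i j y hy => by
    simp only [h.rel i j y hy, h'.rel i j y hy]; ring⟩

theorem IsDensity.sub (h : P.IsDensity ρ) (h' : P.IsDensity ρ') :
    P.IsDensity fun i y => ρ i y - ρ' i y :=
  ⟨fun i => (h.continuousOn i).sub (h'.continuousOn i), fun i j y hy => by
    simp only [h.rel i j y hy, h'.rel i j y hy]; ring⟩

variable (P) in
/-- The product of a form with a function of the partition of unity. -/
def pouMul (k : ι) (η : ι → LocalForm m) (i : ι) : LocalForm m := fun y => P.pouLoc k i y • η i y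

theorem IsAdForm.pouMul {η : ι → LocalForm m} (h : P.IsAdForm Φ η) (k : ι) :
    P.IsAdForm Φ (P.pouMul k η) := by
  refine ⟨fun i => (P.contDiffOn_pouLoc k i).smul (h.1 i), fun i y hy => ?_, fun i j y hy v => ?_⟩
  · rw [BundleAtlas.pouMul, h.2.1 i y hy, smul_zero]
  · simp only [BundleAtlas.pouMul, ContinuousAlternatingMap.smul_apply]
    rw [P.pouLoc_trans hy, Ad_smul, h.2.2 i j y hy]

theorem sum_pouMul (η : ι → LocalForm m) (i : ι) (y : E3) : ∑ k, P.pouMul k η i y = η i y := by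
  simp only [pouMul, ← Finset.sum_smul, P.sum_pouLoc, one_smul]

theorem pouMul_eventuallyEq_zero {k i : ι} (η : ι → LocalForm m) {y : E3}
    (hy : y ∈ (P.chart i).target) (h : y ∈ P.overlap k i → P.trans k i y ∉ P.pouSupport k) :
    P.pouMul k η i =ᶠ[𝓝 y] fun _ => 0 := by
  have hn : (P.chart i).symm y ∉ tsupport (P.pou k) := fun h' =>
    h ⟨hy, P.pou_subordinate k h'⟩ ⟨_, h', rfl⟩
  filter_upwards [((P.chart i).continuousAt_symm hy).eventually_mem
    ((isClosed_tsupport _).isOpen_compl.mem_nhds hn)] with z hz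
  have : P.pouLoc k i z = 0 := image_eq_zero_of_notMem_tsupport (f := P.pou k) hz
  rw [pouMul, this, zero_smul]

/-- Vanishing of an integral that depends locally on a form, from the case of forms with support in
a chart. -/
theorem integral_eq_zero_of_local {R : (ι → LocalForm m) → ι → E3 → ℝ} {η : ι → LocalForm m}
    (hsum : ∀ i, ∀ y ∈ (P.chart i).target, R η i y = ∑ k, R (P.pouMul k η) i y)
    (hdens : ∀ k, P.IsDensity (R (P.pouMul k η)))
    (hloc : ∀ k i y, P.pouMul k η i =ᶠ[𝓝 y] (fun _ => 0) → R (P.pouMul k η) i y = 0)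
    (hdiv : ∀ k, (∀ y ∈ (P.chart k).target \ P.pouSupport k, P.pouMul k η k y = 0) →
      ∫ y in (P.chart k).target, R (P.pouMul k η) k y = 0) : P.integral (R η) = 0 := by
  rw [P.integral_congr hsum, P.integral_finset_sum _ _ fun k => (hdens k).continuousOn]
  refine Finset.sum_eq_zero fun k _ => ?_
  rw [(hdens k).integral_eq k (P.isCompact_pouSupport k) (P.pouSupport_subset k)
    fun i y hy h => hloc k i y (pouMul_eventuallyEq_zero η hy h)]
  refine hdiv k fun y hy => ?_
  rw [pouMul, P.pouLoc_eq_zero_of_notMem hy, zero_smul]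

theorem IsAdForm.differentiableAt {η : ι → LocalForm m} (h : P.IsAdForm Φ η) {i : ι} {y : E3}
    (hy : y ∈ (P.chart i).target) : DifferentiableAt ℝ (η i) y :=
  differentiableAt_of_contDiffOn (P.isOpen_target i) (h.1 i) hy

theorem IsAdForm.differentiableAt_apply {η : ι → LocalForm m} (h : P.IsAdForm Φ η) {i : ι} {y : E3}
    (hy : y ∈ (P.chart i).target) (w : Fin m → E3) : DifferentiableAt ℝ (fun z => η i z w) y :=
  QEGR.differentiableAt_apply (h.differentiableAt hy) w

theorem IsAdForm.contDiffOn_apply {η : ι → LocalForm m} (h : P.IsAdForm Φ η) (i : ι)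
    (w : Fin m → E3) : ContDiffOn ℝ ∞ (fun z => η i z w) (P.chart i).target :=
  contDiffOn_form_iff.1 (h.1 i) w

variable (hΦ : ∀ (a : D) (X Y : 𝔡), pair (Ad Φ a X) (Ad Φ a Y) = pair X Y)
  {A : ι → LocalForm 1} (hA : P.IsConnection Φ A)
include hΦ hA

/-- Integration by parts for a two-form and a function. -/
theorem integral_covD_two {Y : ι → LocalForm 2} {a : ι → LocalForm 0} (hY : P.IsAdForm Φ Y)
    (ha : P.IsAdForm Φ a) : P.integral (fun i y =>
      pair (covD (A i) (Y i) y ![e 0, e 1, e 2]) (a i y ![]) +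
      cyc fun b c d => pair (Y i y ![e b, e c]) (covD (A i) (a i) y ![e d])) = 0 := by
  -- Writing the integrand with `nabla` of the component of `a` makes its additivity and locality in
  -- `a` direct.
  let R : (ι → LocalForm 0) → ι → E3 → ℝ := fun a i y =>
    pair (covD (A i) (Y i) y ![e 0, e 1, e 2]) (a i y ![]) +
      cyc fun b c d => pair (Y i y ![e b, e c]) (nabla (A i) (e d) (fun z => a i z ![]) y)
  have hR : ∀ {a : ι → LocalForm 0}, P.IsAdForm Φ a → ∀ i, ∀ y ∈ (P.chart i).target,
      pair (covD (A i) (Y i) y ![e 0, e 1, e 2]) (a i y ![]) +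
      (cyc fun b c d => pair (Y i y ![e b, e c]) (covD (A i) (a i) y ![e d])) = R a i y := by
    intro a ha i y hy
    simp only [R, covD_zero (ha.differentiableAt hy)]
  rw [P.integral_congr (hR ha)]
  refine integral_eq_zero_of_local (fun i y hy => ?_) (fun k => ?_) (fun k i y h => ?_)
    fun k hk => ?_
  · have h1 : a i y ![] = ∑ k, P.pouMul k a i y ![] := by
      rw [← sum_pouMul (P := P) a i y]; simp
    have h2 : ∀ v, nabla (A i) v (fun z => a i z ![]) y =
        ∑ k, nabla (A i) v (fun z => P.pouMul k a i z ![]) y := fun v => by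
      rw [← nabla_sum _ _ _ fun k _ => (ha.pouMul k).differentiableAt_apply hy _]
      congr 1; ext1 z
      rw [← sum_pouMul (P := P) a i z]; simp
    simp only [R, h1, h2, cyc, ← pairCLM_apply, map_sum, Finset.sum_add_distrib]
  · have hk := ha.pouMul k
    refine IsDensity.congr (((hY.covD hA).isDensity_pair hΦ hk).add
      (hY.isDensity_cyc hΦ (hk.covD hA))) fun i y hy => ?_
    simp only [restrict_apply hy]
    exact (hR hk i y hy).symm
  · have h2 : ∀ v, nabla (A i) v (fun z => P.pouMul k a i z ![]) y = 0 := fun v =>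
      nabla_of_eventuallyEq_zero v (by filter_upwards [h] with z hz; rw [hz]; rfl)
    simp only [R, h2, h.eq_of_nhds, cyc, pair_zero_right]
    simp [pair_zero_right]
  · have ha' := ha.pouMul k
    -- In one chart the integrand is `d⟨Y, a⟩`, the divergence of the functions `⟨Y (e b, e c), a⟩`
    -- in the remaining directions.
    rw [← setIntegral_divergence_eq_zero (P.isOpen_target k) (P.isCompact_pouSupport k)
      (P.pouSupport_subset k) (f := fun b c _ y => pair (Y k y ![e b, e c]) (P.pouMul k a k y ![]))
      (fun b c _ => contDiffOn_pair (hY.contDiffOn_apply k _) (ha'.contDiffOn_apply k _))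
      (fun b c _ y hy => by simp only [hk y hy]; exact pair_zero_right _)]
    refine setIntegral_congr_fun (P.isOpen_target k).measurableSet fun y hy => ?_
    have hd := fun b c d => fderiv_pair_nabla (A := A k) (hY.differentiableAt_apply hy ![e b, e c])
      (ha'.differentiableAt_apply hy ![]) (e d)
    have hs : (fun z => Y k z ![e 0, e 2]) = fun z => - Y k z ![e 2, e 0] := by
      ext1 z; exact form_swap _ _ _
    have hn : nabla (A k) (e 1) (fun z => Y k z ![e 0, e 2]) y =
        - nabla (A k) (e 1) (fun z => Y k z ![e 2, e 0]) y := by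
      rw [hs, nabla, nabla, fderiv_fun_neg, lie_neg]
      simp; abel
    simp only [R, cyc, hd, covD_two (hY.differentiableAt hy), pair_add_left, pair_sub_left, hn,
      pair_neg_left]
    ring

/-- Integration by parts for two one-forms. -/
theorem integral_covD_one {Y H : ι → LocalForm 1} (hY : P.IsAdForm Φ Y)
    (hH : P.IsAdForm Φ H) : P.integral (fun i y =>
      (cyc fun a b c => pair (covD (A i) (Y i) y ![e a, e b]) (H i y ![e c])) -
      cyc fun a b c => pair (covD (A i) (H i) y ![e a, e b]) (Y i y ![e c])) = 0 := by
  let R : (ι → LocalForm 1) → ι → E3 → ℝ := fun H i y =>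
    (cyc fun a b c => pair (covD (A i) (Y i) y ![e a, e b]) (H i y ![e c])) -
      cyc fun a b c => pair (nabla (A i) (e a) (fun z => H i z ![e b]) y
        - nabla (A i) (e b) (fun z => H i z ![e a]) y) (Y i y ![e c])
  have hR : ∀ {H : ι → LocalForm 1}, P.IsAdForm Φ H → ∀ i, ∀ y ∈ (P.chart i).target,
      ((cyc fun a b c => pair (covD (A i) (Y i) y ![e a, e b]) (H i y ![e c])) -
      cyc fun a b c => pair (covD (A i) (H i) y ![e a, e b]) (Y i y ![e c])) = R H i y := by
    intro H hH i y hy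
    simp only [R, covD_one (hH.differentiableAt hy)]
  rw [P.integral_congr (hR hH)]
  refine integral_eq_zero_of_local (fun i y hy => ?_) (fun k => ?_) (fun k i y h => ?_)
    fun k hk => ?_
  · have h1 : ∀ w, H i y w = ∑ k, P.pouMul k H i y w := fun w => by
      rw [← sum_pouMul (P := P) H i y]; simp
    have h2 : ∀ v w, nabla (A i) v (fun z => H i z w) y =
        ∑ k, nabla (A i) v (fun z => P.pouMul k H i z w) y := fun v w => by
      rw [← nabla_sum _ _ _ fun k _ => (hH.pouMul k).differentiableAt_apply hy _]
      congr 1; ext1 z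
      rw [← sum_pouMul (P := P) H i z]; simp
    simp only [R, h1, h2, cyc, pair_comm _ (Y i y _)]
    simp only [← pairCLM_apply, map_sub, map_sum, Finset.sum_add_distrib, Finset.sum_sub_distrib]
  · have hk := hH.pouMul k
    refine IsDensity.congr (((hY.covD hA).isDensity_cyc hΦ hk).sub
      ((hk.covD hA).isDensity_cyc hΦ hY)) fun i y hy => ?_
    simp only [restrict_apply hy]
    exact (hR hk i y hy).symm
  · have h2 : ∀ v w, nabla (A i) v (fun z => P.pouMul k H i z w) y = 0 := fun v w =>
      nabla_of_eventuallyEq_zero v (by filter_upwards [h] with z hz; rw [hz]; rfl)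
    simp only [R, h2, h.eq_of_nhds, cyc, sub_zero, pair_zero_left]
    simp [pair_zero_right]
  · have hH' := hH.pouMul k
    -- In one chart the integrand is `d⟨Y ∧ H⟩`: the functions differentiated are the
    -- antisymmetrised pairings of components of `Y` and `H`.
    rw [← setIntegral_divergence_eq_zero (P.isOpen_target k) (P.isCompact_pouSupport k)
      (P.pouSupport_subset k) (f := fun a b _ y =>
        pair (Y k y ![e a]) (P.pouMul k H k y ![e b]) - pair (Y k y ![e b]) (P.pouMul k H k y ![e a]))
      (fun a b _ => (contDiffOn_pair (hY.contDiffOn_apply k _) (hH'.contDiffOn_apply k _)).sub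
        (contDiffOn_pair (hY.contDiffOn_apply k _) (hH'.contDiffOn_apply k _)))
      (fun a b _ y hy => by
        simp only [hk y hy]
        have : ∀ X w, pair X ((0 : E3 [⋀^Fin 1]→L[ℝ] 𝔡) w) = 0 := fun X w => pair_zero_right X
        rw [this, this, sub_zero])]
    refine setIntegral_congr_fun (P.isOpen_target k).measurableSet fun y hy => ?_
    have hd := fun a b d => fderiv_pair_nabla (A := A k) (hY.differentiableAt_apply hy ![e a])
      (hH'.differentiableAt_apply hy ![e b]) (e d)
    have hp := fun a b => (pairCLM.isBoundedBilinearMap.differentiableAt _).comp y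
      ((hY.differentiableAt_apply hy ![e a]).prodMk (hH'.differentiableAt_apply hy ![e b]))
    have hd2 := fun a b d => (congrArg (fun L => L (e d)) (fderiv_fun_sub (hp a b) (hp b a)))
    simp only [Function.comp_def, pairCLM_apply, sub_apply] at hd2
    simp only [R, cyc, hd2, hd, covD_one (hY.differentiableAt hy), pair_sub_left]
    simp only [pair_comm (nabla (A k) _ (fun z => P.pouMul k H k z _) y)]
    ring

end BundleAtlas
end Integral
end QEGR
end

open scoped Manifold ContDiff
noncomputable section
namespace QEGR
open Filter Topology MeasureTheory TrivialExt

/-! ### Vanishing of forms whose integrals against all test forms vanish. -/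

section Integral
set_option linter.unusedSectionVars false
variable {E D N ι : Type*} [NormedAddCommGroup E] [NormedSpace ℝ E] [CompleteSpace E]
  [TopologicalSpace D] [ChartedSpace E D] [Group D] [LieGroup 𝓘(ℝ, E) ∞ D]
  [TopologicalSpace N] [ChartedSpace E3 N] [T2Space N] [CompactSpace N]
  [IsManifold (𝓡 3) ∞ N] [Fintype ι]

namespace BundleAtlas
variable {P : BundleAtlas E D N ι} {Φ : GroupLieAlgebra 𝓘(ℝ, E) D ≃ₗ⁅ℝ⁆ 𝔡}
  {m : ℕ}

theorem globalForm_eq_zero {k i : ι} {η : LocalForm m} {y : E3}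
    (h : y ∈ P.overlap k i → P.trans k i y ∉ tsupport η) : P.globalForm Φ k η i y = 0 := by
  by_cases hy : y ∈ P.overlap k i
  · ext1 w
    rw [globalForm_apply hy, image_eq_zero_of_notMem_tsupport (h hy)]
    exact Ad_zero Φ _
  · rw [globalForm, if_neg hy]

/-- A linear functional on forms given by an integral is determined by its integrand. -/
theorem eq_zero_of_integral_eq_zero {R : ι → E3 → (E3 [⋀^Fin m]→L[ℝ] 𝔡) → ℝ}
    (hR : ∀ i y (r : ℝ) η, R i y (r • η) = r * R i y η)
    (hdens : ∀ η, P.IsAdForm Φ η → P.IsDensity fun i y => R i y (η i y))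
    (hint : ∀ η, P.IsAdForm Φ η → P.integral (fun i y => R i y (η i y)) = 0)
    (k : ι) (η₀ : E3 [⋀^Fin m]→L[ℝ] 𝔡)
    (hc : ContinuousOn (fun y => R k y η₀) (P.chart k).target) {y : E3}
    (hy : y ∈ (P.chart k).target) : R k y η₀ = 0 := by
  refine eq_zero_of_setIntegral_mul_eq_zero (P.isOpen_target k) hc (fun g hg hgc hgs => ?_) hy
  -- The scalar test function is turned into a globally defined adjoint form supported in the `k`-th
  -- chart, so its integral is an integral in that chart alone.
  let η : LocalForm m := fun y => g y • η₀
  have hηs : tsupport η ⊆ tsupport g := closure_mono fun z hz => by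
    simp only [Function.mem_support, η] at hz ⊢
    intro h
    rw [h, zero_smul] at hz
    exact hz rfl
  have hηc : HasCompactSupport η := hgc.mono' (subset_closure.trans hηs)
  have had : P.IsAdForm Φ (P.globalForm Φ k η) :=
    isAdForm_globalForm (hg.smul contDiff_const) hηc (hηs.trans hgs)
  have h1 := hint _ had
  rw [(hdens _ had).integral_eq k hηc (hηs.trans hgs)] at h1
  · rw [← h1]
    refine setIntegral_congr_fun (P.isOpen_target k).measurableSet fun y _ => ?_
    simp only [globalForm_self (Φ := Φ) (hηs.trans hgs), η, hR]
  · intro i y hy h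
    have h2 := hR i y 0 0
    rw [zero_smul, zero_mul] at h2
    simp only [globalForm_eq_zero h, h2]

variable (hΦ : ∀ (a : D) (X Y : 𝔡), pair (Ad Φ a X) (Ad Φ a Y) = pair X Y)
include hΦ

theorem eq_zero_of_integral_pair {η : ι → LocalForm 3} (hη : P.IsAdForm Φ η)
    (h : ∀ a, P.IsAdForm Φ a → P.integral (fun i y => pair (η i y ![e 0, e 1, e 2]) (a i y ![])) = 0)
    {i : ι} {y : E3} (hy : y ∈ (P.chart i).target) : η i y ![e 0, e 1, e 2] = 0 := by
  refine eq_zero_of_pair_eq_zero fun X => ?_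
  have := eq_zero_of_integral_eq_zero (P := P) (Φ := Φ)
    (R := fun i y (a : E3 [⋀^Fin 0]→L[ℝ] 𝔡) => pair (η i y ![e 0, e 1, e 2]) (a ![]))
    (fun i y r a => pair_smul_right _ _ _) (fun a ha => hη.isDensity_pair hΦ ha) h i
    (ContinuousAlternatingMap.constOfIsEmpty ℝ E3 (Fin 0) X)
    (contDiffOn_pair (hη.contDiffOn_apply i _) contDiffOn_const).continuousOn hy
  simpa using this

/-- The component of `B` on `e a, e b` is paired with the component of `H` on the third vector, so
test forms with a single nonzero component isolate each of the three; nondegeneracy of the inner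
product does the rest. -/
theorem eq_zero_of_integral_cyc {B : ι → LocalForm 2} (hB : P.IsAdForm Φ B)
    (h : ∀ H, P.IsAdForm Φ H →
      P.integral (fun i y => cyc fun a b c => pair (B i y ![e a, e b]) (H i y ![e c])) = 0)
    (i : ι) {y : E3} (hy : y ∈ (P.chart i).target) :
    B i y ![e 0, e 1] = 0 ∧ B i y ![e 1, e 2] = 0 ∧ B i y ![e 2, e 0] = 0 := by
  have key : ∀ f : Fin 3 → 𝔡, pair (B i y ![e 0, e 1]) (f 2) + pair (B i y ![e 1, e 2]) (f 0) +
      pair (B i y ![e 2, e 0]) (f 1) = 0 := by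
    intro f
    have := eq_zero_of_integral_eq_zero (P := P) (Φ := Φ)
      (R := fun i y (H : E3 [⋀^Fin 1]→L[ℝ] 𝔡) => cyc fun a b c => pair (B i y ![e a, e b]) (H ![e c]))
      (fun i y r H => by
        simp only [cyc, ContinuousAlternatingMap.smul_apply, pair_smul_right]; ring)
      (fun a ha => hB.isDensity_cyc hΦ ha) h i (oneFormOf f)
      (by
        have hc := fun a b c => (contDiffOn_pair (hB.contDiffOn_apply i ![e a, e b])
          (contDiffOn_const (c := oneFormOf f ![e c]))).continuousOn
        exact ((hc 0 1 2).add (hc 1 2 0)).add (hc 2 0 1)) hy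
    simpa only [cyc, oneFormOf_std] using this
  refine ⟨eq_zero_of_pair_eq_zero fun X => ?_, eq_zero_of_pair_eq_zero fun X => ?_,
    eq_zero_of_pair_eq_zero fun X => ?_⟩
  · simpa [pair_zero_right] using key ![0, 0, X]
  · simpa [pair_zero_right] using key ![X, 0, 0]
  · simpa [pair_zero_right] using key ![0, X, 0]

theorem eq_zero_of_integral_cyc' {H : ι → LocalForm 1} (hH : P.IsAdForm Φ H)
    (h : ∀ B, P.IsAdForm Φ B →
      P.integral (fun i y => cyc fun a b c => pair (B i y ![e a, e b]) (H i y ![e c])) = 0)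
    (i : ι) {y : E3} (hy : y ∈ (P.chart i).target) (c : Fin 3) : H i y ![e c] = 0 := by
  have key : ∀ f : Fin 3 → 𝔡, pair (f 2) (H i y ![e 2]) + pair (f 0) (H i y ![e 0]) +
      pair (f 1) (H i y ![e 1]) = 0 := by
    intro f
    have := eq_zero_of_integral_eq_zero (P := P) (Φ := Φ)
      (R := fun i y (B : E3 [⋀^Fin 2]→L[ℝ] 𝔡) => cyc fun a b c => pair (B ![e a, e b]) (H i y ![e c]))
      (fun i y r B => by
        simp only [cyc, ContinuousAlternatingMap.smul_apply, pair_smul_left]; ring)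
      (fun a ha => ha.isDensity_cyc hΦ hH) h i (twoFormOf f)
      (by
        have hc := fun a b c => (contDiffOn_pair (contDiffOn_const (c := twoFormOf f ![e a, e b]))
          (hH.contDiffOn_apply i ![e c])).continuousOn
        exact ((hc 0 1 2).add (hc 1 2 0)).add (hc 2 0 1)) hy
    simpa only [cyc, (twoFormOf_std f).1, (twoFormOf_std f).2.1, (twoFormOf_std f).2.2] using this
  refine eq_zero_of_pair_eq_zero fun X => ?_
  rw [pair_comm]
  fin_cases c
  · simpa [pair_zero_left] using key ![X, 0, 0]
  · simpa [pair_zero_left] using key ![0, X, 0]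
  · simpa [pair_zero_left] using key ![0, 0, X]

end BundleAtlas
end Integral
end QEGR
end

open scoped Manifold ContDiff
noncomputable section
namespace QEGR
open Filter Topology MeasureTheory TrivialExt

/-! ### The curvature two-form and exact expansions along lines of fields. -/

section Curvature
variable {A : LocalForm 1} {B : LocalForm 2} {y : E3} {U : Set E3}

/-- The curvature as a two-form. -/
def curvForm (A : LocalForm 1) : LocalForm 2 := fun y => extDeriv A y +
  (1 / 2 : ℝ) • ContinuousAlternatingMap.alternatizeUncurryFin (adForm (A y) (A y))

theorem curvForm_apply (A : LocalForm 1) (y v w : E3) :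
    curvForm A y ![v, w] = BF.curvature A y v w := by
  -- Alternatizing counts `[A v, A w]` and `-[A w, A v]`, which are equal; this is the factor `½` in
  -- `½[A, A]`.
  have h : ContinuousAlternatingMap.alternatizeUncurryFin (adForm (A y) (A y)) ![v, w] =
      (2 : ℝ) • ⁅A y ![v], A y ![w]⁆ := by
    rw [ContinuousAlternatingMap.alternatizeUncurryFin_apply, Fin.sum_univ_two, removeNth_two_zero,
      removeNth_two_one, adForm_apply, adForm_apply]
    have h1 := lie_skew (A y ![w]) (A y ![v])
    simp only [Matrix.cons_val_zero, Matrix.cons_val_one, ← h1, two_smul]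
    simp
  refine (congrArg (fun X => extDeriv A y ![v, w] + (1 / 2 : ℝ) • X) h).trans ?_
  rw [smul_smul, BF.curvature]
  norm_num

theorem vec_two_eq (w : Fin 2 → E3) : w = ![w 0, w 1] := by
  ext a; fin_cases a <;> rfl

theorem contDiffOn_curvForm (hU : IsOpen U) (hA : ContDiffOn ℝ ∞ A U) :
    ContDiffOn ℝ ∞ (curvForm A) U := by
  rw [contDiffOn_form_iff]
  intro w
  have hc := contDiffOn_form_iff.1 hA
  have hd : ∀ w v, ContDiffOn ℝ ∞ (fun z => fderiv ℝ (fun z => A z w) z v) U := fun w v =>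
    ((hc w).fderiv_of_isOpen hU (m := ∞) (by simp)).clm_apply contDiffOn_const
  refine (((hd ![w 1] (w 0)).sub (hd ![w 0] (w 1))).add
    (contDiffOn_lie (hc ![w 0]) (hc ![w 1]))).congr fun z hz => ?_
  rw [vec_two_eq w, curvForm_apply, BF.curvature,
    extDeriv_one (differentiableAt_of_contDiffOn hU hA hz)]
  rfl

theorem contDiffOn_cyc {F : Type*} [NormedAddCommGroup F] [NormedSpace ℝ F]
    {f : Fin 3 → Fin 3 → Fin 3 → E3 → F} (h : ∀ a b c, ContDiffOn ℝ ∞ (f a b c) U) :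
    ContDiffOn ℝ ∞ (fun y => cyc fun a b c => f a b c y) U :=
  ((h 0 1 2).add (h 1 2 0)).add (h 2 0 1)

/-- The curvature is quadratic in the connection, so the expansion stops at `t ^ 2` and has no
remainder. -/
theorem curvature_add_smul {Y : LocalForm 1} (hA : DifferentiableAt ℝ A y)
    (hY : DifferentiableAt ℝ Y y) (t : ℝ) (v w : E3) :
    BF.curvature (A + t • Y) y v w = BF.curvature A y v w + t • covD A Y y ![v, w] +
      t ^ 2 • ⁅Y y ![v], Y y ![w]⁆ := by
  have hc := differentiableAt_apply hA
  have hy := differentiableAt_apply hY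
  have hd : ∀ u v, fderiv ℝ (fun z => (A + t • Y) z ![u]) y v =
      fderiv ℝ (fun z => A z ![u]) y v + t • fderiv ℝ (fun z => Y z ![u]) y v := by
    intro u v
    have : (fun z => (A + t • Y) z ![u]) = fun z => A z ![u] + t • Y z ![u] := rfl
    rw [this]
    exact congrArg (fun L => L v)
      ((hc ![u]).hasFDerivAt.add ((hy ![u]).hasFDerivAt.const_smul t)).fderiv
  rw [BF.curvature, BF.curvature, extDeriv_one (hA.add (hY.const_smul t)), extDeriv_one hA,
    covD_one hY, hd, hd, nabla, nabla]
  simp only [Pi.add_apply, Pi.smul_apply, ContinuousAlternatingMap.add_apply,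
    ContinuousAlternatingMap.smul_apply, lie_add, add_lie, lie_smul, smul_lie,
    ← lie_skew (A y ![w]) (Y y ![v])]
  module

theorem covDeriv_add_smul {Y : LocalForm 1} {Z : LocalForm 2} 
    (hB : DifferentiableAt ℝ B y) (hZ : DifferentiableAt ℝ Z y) (t : ℝ) :
    BF.covDeriv (A + t • Y) (B + t • Z) y = BF.covDeriv A B y +
      t • (covD A Z y ![e 0, e 1, e 2] + cyc fun a b c => ⁅Y y ![e c], B y ![e a, e b]⁆) +
      t ^ 2 • cyc fun a b c => ⁅Y y ![e c], Z y ![e a, e b]⁆ := by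
  have h : extDeriv (B + t • Z) y = extDeriv B y + t • extDeriv Z y := by
    rw [extDeriv_add hB (hZ.const_smul t)]
    congr 1
    exact extDeriv_smul _ _
  rw [← covDeriv_eq hZ]
  simp only [BF.covDeriv, h, cyc, Pi.add_apply, Pi.smul_apply, ContinuousAlternatingMap.add_apply,
    ContinuousAlternatingMap.smul_apply, lie_add, add_lie, lie_smul, smul_lie]
  module

end Curvature

/-! ### The splitting of `𝔡` into its three summands. -/

section Components

/-- The projection of `𝔡` to `𝔤*`. -/
def projDual : 𝔡 →L[ℝ] 𝔡 := LinearMap.toContinuousLinearMap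
  { toFun := fun X => mk X.dual 0 0
    map_add' := fun X Y => ext' (fun x => by simp) (by simp) (by simp)
    map_smul' := fun r X => ext' (fun x => by simp) (by simp) (by simp) }

/-- The projection of `𝔡` to `V`. -/
def projVec : 𝔡 →L[ℝ] 𝔡 := LinearMap.toContinuousLinearMap
  { toFun := fun X => mk 0 X.vec 0
    map_add' := fun X Y => ext' (fun x => by simp) (by simp) (by simp)
    map_smul' := fun r X => ext' (fun x => by simp) (by simp) (by simp) }

/-- The projection of `𝔡` to `𝔤`. -/
def projAlg : 𝔡 →L[ℝ] 𝔡 := LinearMap.toContinuousLinearMap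
  { toFun := fun X => mk 0 0 X.alg
    map_add' := fun X Y => ext' (fun x => by simp) (by simp) (by simp)
    map_smul' := fun r X => ext' (fun x => by simp) (by simp) (by simp) }

theorem pair_projDual (X Y : 𝔡) : pair X (projDual Y) = Y.dual X.alg := by
  simp [pair, projDual]

theorem pair_projVec (X Y : 𝔡) : pair X (projVec Y) = minkForm X.vec Y.vec := by
  simp [pair, projVec]; rfl

theorem pair_projAlg (X Y : 𝔡) : pair X (projAlg Y) = X.dual Y.alg := by
  simp [pair, projAlg]

/-- Projecting the multiplier, not the field, splits a `BF` constraint. The projection to one of `𝔤`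
and `𝔤*` selects the component of the field in the other. -/
theorem pair_proj_sum (X Y : 𝔡) :
    pair X (projAlg Y) + pair X (projVec Y) + pair X (projDual Y) = pair X Y := by
  rw [pair_projDual, pair_projVec, pair_projAlg, pair, add_comm (X.dual Y.alg)]
  rfl

variable (A : LocalForm 1) (B : LocalForm 2) (y : E3)

theorem covDeriv_dual : (BF.covDeriv A B y).dual = GR.gaussDual A B y := by
  simp only [BF.covDeriv, GR.gaussDual, cyc, dual_add, bracket_def, dual_mk]
  abel

theorem covDeriv_vec : (BF.covDeriv A B y).vec = GR.dTau A B y - GR.cAct A B y := by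
  simp only [BF.covDeriv, GR.dTau, GR.cAct, cyc, vec_add, bracket_def, vec_mk]
  abel

theorem covDeriv_alg : (BF.covDeriv A B y).alg = GR.dC A B y := by
  simp only [BF.covDeriv, GR.dC, cyc, alg_add, bracket_def, alg_mk]

theorem curvature_dual (v w : E3) :
    (BF.curvature A y v w).dual = GR.dS A y v w + GR.halfEE A y v w := by
  simp only [BF.curvature, GR.dS, GR.halfEE, dual_add, bracket_def, dual_mk]
  abel

theorem curvature_vec (v w : E3) : (BF.curvature A y v w).vec = GR.torsion A y v w := rfl

theorem curvature_alg (v w : E3) : (BF.curvature A y v w).alg = GR.F A y v w := rfl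

/-- The scalar cannot be cancelled: for `β = 0` the hypothesis leaves `T` arbitrary. Otherwise `T`
is the identity and conjugation by `killingIso` changes nothing. -/
theorem smul_dualAut {β : ℝ} {T : SO31 ≃ₗ[ℝ] SO31} (hT : β • T.toLinearMap = β • LinearMap.id)
    (z : Module.Dual ℝ SO31) : β • dualAut T z = β • z := by
  have h := LinearMap.congr_fun hT (killingIso.symm z)
  simp only [LinearMap.smul_apply, LinearMap.id_apply, LinearEquiv.coe_coe] at h
  simp only [dualAut, LinearMap.comp_apply, LinearEquiv.coe_coe, ← map_smul, h]
  simp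

end Components

/-! ### The constraints of qeGR as constraints of `BF` theory. -/

section Constraints
set_option linter.unusedSectionVars false
variable {E D N ι : Type*} [NormedAddCommGroup E] [NormedSpace ℝ E] [CompleteSpace E]
  [TopologicalSpace D] [ChartedSpace E D] [Group D] [LieGroup 𝓘(ℝ, E) ∞ D]
  [TopologicalSpace N] [ChartedSpace E3 N] [T2Space N] [CompactSpace N]
  [IsManifold (𝓡 3) ∞ N] [Fintype ι]
  {P : BundleAtlas E D N ι} {Φ : GroupLieAlgebra 𝓘(ℝ, E) D ≃ₗ⁅ℝ⁆ 𝔡}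

namespace BundleAtlas

theorem IsAdForm.contDiffOn_covDeriv (A : ι → LocalForm 1) (hA : P.IsConnection Φ A)
    {B : ι → LocalForm 2} (hB : P.IsAdForm Φ B) (i : ι) :
    ContDiffOn ℝ ∞ (BF.covDeriv (A i) (B i)) (P.chart i).target :=
  (contDiffOn_form_iff.1 (contDiffOn_covD (P.isOpen_target i) (hA.1 i) (hB.1 i))
    ![e 0, e 1, e 2]).congr fun _ hy => covDeriv_eq (hB.differentiableAt hy)

theorem IsConnection.contDiffOn_curvature {A : ι → LocalForm 1} (hA : P.IsConnection Φ A) (i : ι)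
    (v w : E3) : ContDiffOn ℝ ∞ (fun y => BF.curvature (A i) y v w) (P.chart i).target :=
  (contDiffOn_form_iff.1 (contDiffOn_curvForm (P.isOpen_target i) (hA.1 i)) ![v, w]).congr
    fun y _ => (curvForm_apply (A i) y v w).symm

end BundleAtlas

theorem integral_add_add {ρ ρ' ρ'' : ι → E3 → ℝ} (h : ∀ i, ContinuousOn (ρ i) (P.chart i).target)
    (h' : ∀ i, ContinuousOn (ρ' i) (P.chart i).target)
    (h'' : ∀ i, ContinuousOn (ρ'' i) (P.chart i).target) :
    P.integral ρ + P.integral ρ' + P.integral ρ'' =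
      P.integral fun i y => ρ i y + ρ' i y + ρ'' i y := by
  rw [P.integral_add (ρ := fun i y => ρ i y + ρ' i y) (fun i => (h i).add (h' i)) h'',
    P.integral_add h h']

/-- The integrands agree pointwise by `covDeriv_dual`, `covDeriv_vec` and `covDeriv_alg`. Membership
in the phase space is needed for additivity of the integral. -/
theorem gauss_eq {φ : Config ι} (hφ : φ ∈ P.phaseSpace Φ) {l : Multiplier ι}
    (hl : l ∈ P.multipliers Φ) :
    GR.H P l.1 φ + GR.I P l.1 φ + GR.J P l.1 φ = BF.J P l.1 φ := by
  have hc : ∀ (p : 𝔡 →L[ℝ] 𝔡) i, ContinuousOn (fun y =>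
      pair (BF.covDeriv (φ.1 i) (φ.2 i) y) (p (l.1 i y ![]))) (P.chart i).target :=
    fun p i => (contDiffOn_pair (BundleAtlas.IsAdForm.contDiffOn_covDeriv _ hφ.1 hφ.2 i)
    (p.contDiff.comp_contDiffOn (hl.1.contDiffOn_apply i ![]))).continuousOn
  have hH : GR.H P l.1 φ = P.integral fun i y =>
      pair (BF.covDeriv (φ.1 i) (φ.2 i) y) (projAlg (l.1 i y ![])) := by
    simp only [GR.H, pair_projAlg, covDeriv_dual]
  have hI : GR.I P l.1 φ = P.integral fun i y =>
      pair (BF.covDeriv (φ.1 i) (φ.2 i) y) (projVec (l.1 i y ![])) := by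
    simp only [GR.I, pair_projVec, covDeriv_vec, map_sub, LinearMap.sub_apply]
  have hJ : GR.J P l.1 φ = P.integral fun i y =>
      pair (BF.covDeriv (φ.1 i) (φ.2 i) y) (projDual (l.1 i y ![])) := by
    simp only [GR.J, pair_projDual, covDeriv_alg]
  rw [hH, hI, hJ, integral_add_add (hc _) (hc _) (hc _)]
  simp only [pair_proj_sum]
  rfl

theorem curvature_constraint_eq {β : ℝ} {T : SO31 ≃ₗ[ℝ] SO31}
    (hT : β • T.toLinearMap = β • LinearMap.id) {φ : Config ι} (hφ : φ ∈ P.phaseSpace Φ)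
    {l : Multiplier ι} (hl : l ∈ P.multipliers Φ) :
    GR.K P β T l.2 φ + GR.L P β l.2 φ + GR.M P β T l.2 φ = BF.L P (1 + β) l.2 φ := by
  let C : ι → E3 → Fin 3 → Fin 3 → 𝔡 := fun i y a b =>
    BF.curvature (φ.1 i) y (e a) (e b) + (1 + β) • φ.2 i y ![e a, e b]
  have hc : ∀ (p : 𝔡 →L[ℝ] 𝔡) i, ContinuousOn (fun y => cyc fun a b c =>
      pair (C i y a b) (p (l.2 i y ![e c]))) (P.chart i).target :=
    fun p i => (contDiffOn_cyc fun a b c => contDiffOn_pair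
    ((hφ.1.contDiffOn_curvature i (e a) (e b)).add
      ((hφ.2.contDiffOn_apply i ![e a, e b]).const_smul (1 + β)))
    (p.contDiff.comp_contDiffOn (hl.2.contDiffOn_apply i ![e c]))).continuousOn
  have hT' : ∀ x, β • T x = β • x := fun x => by simpa using LinearMap.congr_fun hT x
  have hK : GR.K P β T l.2 φ = P.integral fun i y => cyc fun a b c =>
      pair (C i y a b) (projAlg (l.2 i y ![e c])) := by
    simp only [GR.K, pair_projAlg, C, dual_add, dual_smul, curvature_dual, smul_dualAut hT]
    congr 1; ext i y; congr 1; ext a b c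
    congr 1
    module
  have hL : GR.L P β l.2 φ = P.integral fun i y => cyc fun a b c =>
      pair (C i y a b) (projVec (l.2 i y ![e c])) := by
    simp only [GR.L, pair_projVec, C, vec_add, vec_smul, curvature_vec]
  have hM : GR.M P β T l.2 φ = P.integral fun i y => cyc fun a b c =>
      pair (C i y a b) (projDual (l.2 i y ![e c])) := by
    simp only [GR.M, pair_projDual, C, alg_add, alg_smul, curvature_alg, hT', add_smul, one_smul,
      add_assoc]
  rw [hK, hL, hM, integral_add_add (hc _) (hc _) (hc _)]
  have h : ∀ f g h : Fin 3 → Fin 3 → Fin 3 → ℝ, cyc f + cyc g + cyc h =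
      cyc fun a b c => f a b c + g a b c + h a b c := fun f g h => by simp only [cyc]; ring
  simp only [h, pair_proj_sum]
  rfl

end Constraints
end QEGR
end

open scoped Manifold ContDiff
noncomputable section
namespace QEGR
open Filter Topology MeasureTheory TrivialExt

/-! ### First variation of the constraints and their Hamiltonian vectors. -/

section Constraints
set_option linter.unusedSectionVars false
variable {E D N ι : Type*} [NormedAddCommGroup E] [NormedSpace ℝ E] [CompleteSpace E]
  [TopologicalSpace D] [ChartedSpace E D] [Group D] [LieGroup 𝓘(ℝ, E) ∞ D]
  [TopologicalSpace N] [ChartedSpace E3 N] [T2Space N] [CompactSpace N]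
  [IsManifold (𝓡 3) ∞ N] [Fintype ι]
  {P : BundleAtlas E D N ι} {Φ : GroupLieAlgebra 𝓘(ℝ, E) D ≃ₗ⁅ℝ⁆ 𝔡}

namespace BundleAtlas

theorem isAdForm_zero (m : ℕ) : P.IsAdForm Φ (0 : ι → LocalForm m) := by
  refine ⟨fun i => contDiffOn_const, fun i y _ => rfl, fun i j y _ v => ?_⟩
  exact (Ad_zero Φ _).symm

theorem IsAdForm.sub {m : ℕ} {η η' : ι → LocalForm m} (h : P.IsAdForm Φ η)
    (h' : P.IsAdForm Φ η') : P.IsAdForm Φ (η - η') := by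
  have := h.add (h'.smul (-1))
  rwa [neg_one_smul, ← sub_eq_add_neg] at this

theorem IsConnection.add_smul {A Y : ι → LocalForm 1} (hA : P.IsConnection Φ A)
    (hY : P.IsAdForm Φ Y) (t : ℝ) : P.IsConnection Φ (A + t • Y) := by
  have h := hY.smul t
  refine ⟨fun i => (hA.1 i).add (h.1 i), fun i y hy => ?_, fun i j y hy v => ?_⟩
  · simp only [Pi.add_apply, hA.2.1 i y hy, h.2.1 i y hy, add_zero]
  · have h1 := h.2.2 i j y hy ![v]
    have h2 : (fun a => fderiv ℝ (P.trans i j) y ((![v] : Fin 1 → E3) a)) =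
        ![fderiv ℝ (P.trans i j) y v] := by ext a; fin_cases a; rfl
    simp only [Pi.add_apply, ContinuousAlternatingMap.add_apply, hA.2.2 i j y hy v, h1, Ad_add, h2]
    abel

theorem IsConnection.isAdForm_curvForm {A : ι → LocalForm 1} (hA : P.IsConnection Φ A) :
    P.IsAdForm Φ (P.restrict fun i => curvForm (A i)) := by
  refine isAdForm_restrict (fun i => contDiffOn_curvForm (P.isOpen_target i) (hA.1 i))
    fun i j y hy v => ?_
  have h : (fun a => fderiv ℝ (P.trans i j) y (v a)) =
      ![fderiv ℝ (P.trans i j) y (v 0), fderiv ℝ (P.trans i j) y (v 1)] := vec_two_eq _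
  rw [h, vec_two_eq v, curvForm_apply, curvForm_apply,
    (hA.isGaugeChange i j).curvature_rel hy]
  rfl

theorem phaseSpace_add_smul {φ Y : Config ι} (hφ : φ ∈ P.phaseSpace Φ) (hY : Y ∈ P.tangent Φ)
    (t : ℝ) : φ + t • Y ∈ P.phaseSpace Φ :=
  ⟨hφ.1.add_smul hY.1 t, hφ.2.add (hY.2.smul t)⟩

variable {Λ : ℝ} {l : Multiplier ι} {φ : Config ι} {i : ι} {y : E3}

theorem flow_fst_apply (hy : y ∈ (P.chart i).target) (w : Fin 1 → E3) :
    (P.flow Λ l φ).1 i y w = covD (φ.1 i) (l.1 i) y w - Λ • l.2 i y w := by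
  have : (P.flow Λ l φ).1 i y = covD (φ.1 i) (l.1 i) y + (-Λ) • l.2 i y :=
    congrArg (· + _) (restrict_apply hy)
  rw [this, neg_smul, ← sub_eq_add_neg]; rfl

theorem flow_snd_apply (hy : y ∈ (P.chart i).target) (w : Fin 2 → E3) :
    (P.flow Λ l φ).2 i y w = ⁅φ.2 i y w, l.1 i y ![]⁆ + covD (φ.1 i) (l.2 i) y w := by
  have : (P.flow Λ l φ).2 i y = BundleAtlas.bracketRight (φ.2 i y) (l.1 i y ![]) +
      covD (φ.1 i) (l.2 i) y := congrArg (_ + ·) (restrict_apply hy)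
  rw [this, ← bracketRight_apply]; rfl

end BundleAtlas

variable (P) in
/-- The constraint of `BF + Λ BB` theory with given multipliers. -/
def bfConstraint (Λ : ℝ) (l : Multiplier ι) (φ : Config ι) : ℝ := BF.J P l.1 φ + BF.L P Λ l.2 φ

/-- The density of a constraint. -/
def constraintDensity (Λ : ℝ) (l : Multiplier ι) (φ : Config ι) (i : ι) (y : E3) : ℝ :=
  pair (BF.covDeriv (φ.1 i) (φ.2 i) y) (l.1 i y ![]) + cyc fun a b c =>
    pair (BF.curvature (φ.1 i) y (e a) (e b) + Λ • φ.2 i y ![e a, e b]) (l.2 i y ![e c])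

/-- The density of the first variation of a constraint. -/
def firstVariation (Λ : ℝ) (l : Multiplier ι) (φ Y : Config ι) (i : ι) (y : E3) : ℝ :=
  pair (covD (φ.1 i) (Y.2 i) y ![e 0, e 1, e 2] +
      cyc fun a b c => ⁅Y.1 i y ![e c], φ.2 i y ![e a, e b]⁆) (l.1 i y ![]) +
    cyc fun a b c => pair (covD (φ.1 i) (Y.1 i) y ![e a, e b] + Λ • Y.2 i y ![e a, e b])
      (l.2 i y ![e c])

/-- Half the density of the second variation of a constraint. -/
def secondVariation (l : Multiplier ι) (Y : Config ι) (i : ι) (y : E3) : ℝ :=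
  pair (cyc fun a b c => ⁅Y.1 i y ![e c], Y.2 i y ![e a, e b]⁆) (l.1 i y ![]) +
    cyc fun a b c => pair ⁅Y.1 i y ![e a], Y.1 i y ![e b]⁆ (l.2 i y ![e c])

variable {Λ : ℝ} {l : Multiplier ι} {φ Y : Config ι}

theorem continuousOn_constraintDensity (hl : l ∈ P.multipliers Φ) (hφ : φ ∈ P.phaseSpace Φ)
    (i : ι) : ContinuousOn (constraintDensity Λ l φ i) (P.chart i).target :=
  ((contDiffOn_pair (BundleAtlas.IsAdForm.contDiffOn_covDeriv _ hφ.1 hφ.2 i)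
    (hl.1.contDiffOn_apply i ![])).add (contDiffOn_cyc fun a b c => contDiffOn_pair
      ((hφ.1.contDiffOn_curvature i (e a) (e b)).add
        ((hφ.2.contDiffOn_apply i ![e a, e b]).const_smul Λ))
      (hl.2.contDiffOn_apply i ![e c]))).continuousOn

theorem continuousOn_firstVariation (hl : l ∈ P.multipliers Φ) (hφ : φ ∈ P.phaseSpace Φ)
    (hY : Y ∈ P.tangent Φ) (i : ι) :
    ContinuousOn (firstVariation Λ l φ Y i) (P.chart i).target := by
  have h2 := contDiffOn_form_iff.1 (contDiffOn_covD (P.isOpen_target i) (hφ.1.1 i) (hY.2.1 i))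
  have h1 := contDiffOn_form_iff.1 (contDiffOn_covD (P.isOpen_target i) (hφ.1.1 i) (hY.1.1 i))
  exact ((contDiffOn_pair ((h2 ![e 0, e 1, e 2]).add (contDiffOn_cyc fun a b c =>
      contDiffOn_lie (hY.1.contDiffOn_apply i ![e c]) (hφ.2.contDiffOn_apply i ![e a, e b])))
    (hl.1.contDiffOn_apply i ![])).add (contDiffOn_cyc fun a b c => contDiffOn_pair
      ((h1 ![e a, e b]).add ((hY.2.contDiffOn_apply i ![e a, e b]).const_smul Λ))
      (hl.2.contDiffOn_apply i ![e c]))).continuousOn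

theorem continuousOn_secondVariation (hl : l ∈ P.multipliers Φ) (hY : Y ∈ P.tangent Φ) (i : ι) :
    ContinuousOn (secondVariation l Y i) (P.chart i).target :=
  ((contDiffOn_pair (contDiffOn_cyc fun a b c =>
      contDiffOn_lie (hY.1.contDiffOn_apply i ![e c]) (hY.2.contDiffOn_apply i ![e a, e b]))
    (hl.1.contDiffOn_apply i ![])).add (contDiffOn_cyc fun a b c => contDiffOn_pair
      (contDiffOn_lie (hY.1.contDiffOn_apply i ![e a]) (hY.1.contDiffOn_apply i ![e b]))
      (hl.2.contDiffOn_apply i ![e c]))).continuousOn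

theorem bfConstraint_eq (hl : l ∈ P.multipliers Φ) (hφ : φ ∈ P.phaseSpace Φ) :
    bfConstraint P Λ l φ = P.integral (constraintDensity Λ l φ) :=
  (P.integral_add
    (fun i => (contDiffOn_pair (BundleAtlas.IsAdForm.contDiffOn_covDeriv _ hφ.1 hφ.2 i)
      (hl.1.contDiffOn_apply i ![])).continuousOn)
    (fun i => (contDiffOn_cyc fun a b c => contDiffOn_pair
      ((hφ.1.contDiffOn_curvature i (e a) (e b)).add
        ((hφ.2.contDiffOn_apply i ![e a, e b]).const_smul Λ))
      (hl.2.contDiffOn_apply i ![e c])).continuousOn)).symm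

theorem constraintDensity_add_smul (hφ : φ ∈ P.phaseSpace Φ) (hY : Y ∈ P.tangent Φ) (t : ℝ) {i : ι}
    {y : E3} (hy : y ∈ (P.chart i).target) : constraintDensity Λ l (φ + t • Y) i y =
      constraintDensity Λ l φ i y + t * firstVariation Λ l φ Y i y +
        t ^ 2 * secondVariation l Y i y := by
  have hA : DifferentiableAt ℝ (φ.1 i) y :=
    differentiableAt_of_contDiffOn (P.isOpen_target i) (hφ.1.1 i) hy
  have h1 : BF.covDeriv ((φ + t • Y).1 i) ((φ + t • Y).2 i) y = _ :=
    covDeriv_add_smul (A := φ.1 i) (Y := Y.1 i) (hφ.2.differentiableAt hy)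
      (hY.2.differentiableAt hy) t
  have h2 : ∀ v w, BF.curvature ((φ + t • Y).1 i) y v w = _ :=
    curvature_add_smul hA (hY.1.differentiableAt hy) t
  have h3 : ∀ w, (φ + t • Y).2 i y w = φ.2 i y w + t • Y.2 i y w := fun w => rfl
  simp only [constraintDensity, firstVariation, secondVariation, h1, h2, h3, pair_add_left,
    pair_smul_left, cyc]
  ring

/-- The derivative of a constraint is the integral of its first variation. -/
theorem hasDerivAt_bfConstraint (hl : l ∈ P.multipliers Φ) (hφ : φ ∈ P.phaseSpace Φ)
    (hY : Y ∈ P.tangent Φ) : HasDerivAt (fun t : ℝ => bfConstraint P Λ l (φ + t • Y))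
      (P.integral (firstVariation Λ l φ Y)) 0 := by
  -- Along a line the constraint is a polynomial in `t` whose coefficients are integrals, so no
  -- differentiation under the integral sign is required.
  have h : (fun t : ℝ => bfConstraint P Λ l (φ + t • Y)) = fun t =>
      P.integral (constraintDensity Λ l φ) + t * P.integral (firstVariation Λ l φ Y) +
        t ^ 2 * P.integral (secondVariation l Y) := by
    ext1 t
    rw [bfConstraint_eq hl (BundleAtlas.phaseSpace_add_smul hφ hY t),
      P.integral_congr fun i y hy => constraintDensity_add_smul hφ hY t hy,
      ← P.integral_const_mul, ← P.integral_const_mul]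
    exact (integral_add_add (continuousOn_constraintDensity hl hφ)
      (fun i => continuousOn_const.mul (continuousOn_firstVariation hl hφ hY i))
      (fun i => continuousOn_const.mul (continuousOn_secondVariation hl hY i))).symm
  rw [h]
  have h1 := ((hasDerivAt_id (0 : ℝ)).mul_const (P.integral (firstVariation Λ l φ Y))).const_add
    (P.integral (constraintDensity Λ l φ))
  have h2 := ((hasDerivAt_id (0 : ℝ)).pow 2).mul_const (P.integral (secondVariation l Y))
  refine (h1.add h2).congr_deriv ?_
  simp

variable (hΦ : ∀ (a : D) (X Y : 𝔡), pair (Ad Φ a X) (Ad Φ a Y) = pair X Y)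
include hΦ

/-- The first variation of a constraint is the symplectic product with the flow. -/
theorem integral_firstVariation (hl : l ∈ P.multipliers Φ) (hφ : φ ∈ P.phaseSpace Φ)
    (hY : Y ∈ P.tangent Φ) :
    P.integral (firstVariation Λ l φ Y) = P.symplectic (P.flow Λ l φ) Y := by
  have hX := BundleAtlas.flow_mem_tangent Λ hl hφ
  -- Two vanishing integrals move `d_A` from the variation to the multipliers; adding them to the
  -- symplectic product yields the first variation pointwise.
  have e0 := BundleAtlas.integral_covD_two hΦ hφ.1 hY.2 hl.1
  have e1 := BundleAtlas.integral_covD_one hΦ hφ.1 hY.1 hl.2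
  have hco := fun {m : ℕ} {η : ι → LocalForm m} (h : P.IsAdForm Φ η) i =>
    contDiffOn_form_iff.1 (contDiffOn_covD (P.isOpen_target i) (hφ.1.1 i) (h.1 i))
  have c0 : ∀ i, ContinuousOn (fun y =>
      pair (covD (φ.1 i) (Y.2 i) y ![e 0, e 1, e 2]) (l.1 i y ![]) +
      cyc fun b c d => pair (Y.2 i y ![e b, e c]) (covD (φ.1 i) (l.1 i) y ![e d]))
      (P.chart i).target := fun i =>
    ((contDiffOn_pair (hco hY.2 i _) (hl.1.contDiffOn_apply i _)).add
      (contDiffOn_cyc fun a b c => contDiffOn_pair (hY.2.contDiffOn_apply i _)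
        (hco hl.1 i _))).continuousOn
  have c1 : ∀ i, ContinuousOn (fun y =>
      (cyc fun a b c => pair (covD (φ.1 i) (Y.1 i) y ![e a, e b]) (l.2 i y ![e c])) -
      cyc fun a b c => pair (covD (φ.1 i) (l.2 i) y ![e a, e b]) (Y.1 i y ![e c]))
      (P.chart i).target := fun i =>
    ((contDiffOn_cyc fun a b c => contDiffOn_pair (hco hY.1 i _)
        (hl.2.contDiffOn_apply i _)).sub
      (contDiffOn_cyc fun a b c => contDiffOn_pair (hco hl.2 i _)
        (hY.1.contDiffOn_apply i _))).continuousOn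
  have c2 : ∀ i, ContinuousOn (fun y => cyc fun a b c =>
      pair ((P.flow Λ l φ).2 i y ![e a, e b]) (Y.1 i y ![e c]) -
        pair (Y.2 i y ![e a, e b]) ((P.flow Λ l φ).1 i y ![e c])) (P.chart i).target := fun i =>
    (contDiffOn_cyc fun a b c => (contDiffOn_pair (hX.2.contDiffOn_apply i _)
        (hY.1.contDiffOn_apply i _)).sub
      (contDiffOn_pair (hY.2.contDiffOn_apply i _)
        (hX.1.contDiffOn_apply i _))).continuousOn
  have h := integral_add_add c2 c0 c1
  rw [e0, e1, add_zero, add_zero] at h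
  refine Eq.trans (P.integral_congr fun i y hy => ?_) h.symm
  have f1 := fun w => BundleAtlas.flow_fst_apply (Λ := Λ) (l := l) (φ := φ) hy w
  have f2 := fun w => BundleAtlas.flow_snd_apply (Λ := Λ) (l := l) (φ := φ) hy w
  -- Invariance of the inner product moves the bracket from the variation of the connection onto
  -- `[𝔹, 𝕒]`, the algebraic part of the flow.
  have hp : ∀ a b c, pair ⁅Y.1 i y ![e c], φ.2 i y ![e a, e b]⁆ (l.1 i y ![]) =
      pair ⁅φ.2 i y ![e a, e b], l.1 i y ![]⁆ (Y.1 i y ![e c]) := fun a b c => by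
    rw [pair_lie, pair_comm]
  simp only [firstVariation, f1, f2, cyc, pair_add_left, pair_sub_right, pair_smul_left,
    pair_smul_right, hp]
  ring

end Constraints
end QEGR
end

open scoped Manifold ContDiff
noncomputable section
namespace QEGR
open Filter Topology MeasureTheory TrivialExt

section Forms

theorem oneForm_ext {α α' : E3 [⋀^Fin 1]→L[ℝ] 𝔡} (h : ∀ c, α ![e c] = α' ![e c]) : α = α' := by
  apply ContinuousAlternatingMap.toAlternatingMap_injective
  refine stdBasis.ext_alternating fun v _ => ?_
  have hv : (fun a => stdBasis (v a)) = ![e (v 0)] := by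
    ext1 a; fin_cases a; exact stdBasis_apply _
  rw [hv]
  exact h (v 0)

theorem twoForm_ext {α α' : E3 [⋀^Fin 2]→L[ℝ] 𝔡} (h0 : α ![e 0, e 1] = α' ![e 0, e 1])
    (h1 : α ![e 1, e 2] = α' ![e 1, e 2]) (h2 : α ![e 2, e 0] = α' ![e 2, e 0]) : α = α' := by
  apply ContinuousAlternatingMap.toAlternatingMap_injective
  refine stdBasis.ext_alternating fun v hv => ?_
  have he : (fun a => stdBasis (v a)) = ![e (v 0), e (v 1)] := by
    ext1 a; fin_cases a <;> exact stdBasis_apply _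
  rw [he]
  have hne : v 0 ≠ v 1 := fun h => absurd (hv h) (by decide)
  change α ![e (v 0), e (v 1)] = α' ![e (v 0), e (v 1)]
  generalize v 0 = a at *
  generalize v 1 = b at *
  fin_cases a <;> fin_cases b <;> first | exact absurd rfl hne | assumption | skip
  · exact (form_swap α (e 0) (e 2)).trans ((congrArg Neg.neg h2).trans (form_swap α' (e 0) (e 2)).symm)
  · exact (form_swap α (e 1) (e 0)).trans ((congrArg Neg.neg h0).trans (form_swap α' (e 1) (e 0)).symm)
  · exact (form_swap α (e 2) (e 1)).trans ((congrArg Neg.neg h1).trans (form_swap α' (e 2) (e 1)).symm)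

end Forms

/-! ### Field equations, linearised field equations and the first-class property. -/

section Constraints
set_option linter.unusedSectionVars false
variable {E D N ι : Type*} [NormedAddCommGroup E] [NormedSpace ℝ E] [CompleteSpace E]
  [TopologicalSpace D] [ChartedSpace E D] [Group D] [LieGroup 𝓘(ℝ, E) ∞ D]
  [TopologicalSpace N] [ChartedSpace E3 N] [T2Space N] [CompactSpace N]
  [IsManifold (𝓡 3) ∞ N] [Fintype ι]
  {P : BundleAtlas E D N ι} {Φ : GroupLieAlgebra 𝓘(ℝ, E) D ≃ₗ⁅ℝ⁆ 𝔡}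

variable (P) in
/-- The field equations of `BF + Λ BB` theory. -/
structure IsSolution (Λ : ℝ) (φ : Config ι) : Prop where
  curvature : ∀ i, ∀ y ∈ (P.chart i).target, ∀ v w,
    BF.curvature (φ.1 i) y v w + Λ • φ.2 i y ![v, w] = 0
  covD : ∀ i, ∀ y ∈ (P.chart i).target, covD (φ.1 i) (φ.2 i) y ![e 0, e 1, e 2] = 0

variable {Λ : ℝ} {l : Multiplier ι} {φ : Config ι}

section Onshell
variable (hΦ : ∀ (a : D) (X Y : 𝔡), pair (Ad Φ a X) (Ad Φ a Y) = pair X Y)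
include hΦ

/-- Multipliers `(0, H)` and `(a, 0)` separate the two field equations; each then follows from the
vanishing of integrals against all test forms. -/
theorem isSolution_of_bfConstraint_eq_zero (hφ : φ ∈ P.phaseSpace Φ)
    (h : ∀ l ∈ P.multipliers Φ, bfConstraint P Λ l φ = 0) : IsSolution P Λ φ := by
  have hcurv := hφ.1.isAdForm_curvForm.add (hφ.2.smul Λ)
  have hval : ∀ i, ∀ y ∈ (P.chart i).target, ∀ v w,
      ((P.restrict fun i => curvForm (φ.1 i)) + Λ • φ.2) i y ![v, w] =
      BF.curvature (φ.1 i) y v w + Λ • φ.2 i y ![v, w] := fun i y hy v w => by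
    rw [← curvForm_apply]
    have : ((P.restrict fun i => curvForm (φ.1 i)) + Λ • φ.2) i y =
        curvForm (φ.1 i) y + Λ • φ.2 i y := congrArg (· + _) (BundleAtlas.restrict_apply hy)
    rw [this]; rfl
  have h1 : ∀ H, P.IsAdForm Φ H → BF.L P Λ H φ = 0 := by
    intro H hH
    have h2 := h (0, H) ⟨BundleAtlas.isAdForm_zero 0, hH⟩
    have h3 : BF.J P 0 φ = 0 := by
      rw [BF.J, ← P.integral_zero]
      exact P.integral_congr fun i y _ => pair_zero_right _
    rwa [bfConstraint, h3, zero_add] at h2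
  have h0 : ∀ a, P.IsAdForm Φ a → BF.J P a φ = 0 := by
    intro a ha
    have h2 := h (a, 0) ⟨ha, BundleAtlas.isAdForm_zero 1⟩
    have h3 : BF.L P Λ 0 φ = 0 := by
      rw [BF.L, ← P.integral_zero]
      refine P.integral_congr fun i y _ => ?_
      have : ∀ X w, pair X ((0 : E3 [⋀^Fin 1]→L[ℝ] 𝔡) w) = 0 := fun X w => pair_zero_right X
      simp only [Pi.zero_apply, this, cyc, add_zero]
    rwa [bfConstraint, h3, add_zero] at h2
  refine ⟨fun i y hy v w => ?_, fun i y hy => ?_⟩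
  · obtain ⟨h01, h12, h20⟩ := BundleAtlas.eq_zero_of_integral_cyc hΦ hcurv (fun H hH => by
      rw [← h1 H hH]
      refine P.integral_congr fun i y hy => ?_
      simp only [hval i y hy]) i hy
    rw [← hval i y hy, twoForm_ext (α' := 0) h01 h12 h20]
    rfl
  · have := BundleAtlas.eq_zero_of_integral_pair hΦ (hφ.2.covD hφ.1) (fun a ha => by
      rw [← h0 a ha]
      refine P.integral_congr fun i y hy => ?_
      rw [BundleAtlas.restrict_apply hy, covDeriv_eq (hφ.2.differentiableAt hy)]) hy
    rwa [BundleAtlas.restrict_apply hy] at this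

/-- Tangent vectors are determined by their symplectic products. -/
theorem eq_of_symplectic_eq {X X' : Config ι} (hX : X ∈ P.tangent Φ) (hX' : X' ∈ P.tangent Φ)
    (h : ∀ Y ∈ P.tangent Φ, P.symplectic X Y = P.symplectic X' Y) : X = X' := by
  have z1 : ∀ (X : 𝔡) w, pair X ((0 : E3 [⋀^Fin 1]→L[ℝ] 𝔡) w) = 0 := fun X w => pair_zero_right X
  have z2 : ∀ (X : 𝔡) w, pair ((0 : E3 [⋀^Fin 2]→L[ℝ] 𝔡) w) X = 0 := fun X w => pair_zero_left X
  have hc : ∀ {B : ι → LocalForm 2} {H : ι → LocalForm 1}, P.IsAdForm Φ B → P.IsAdForm Φ H → ∀ i,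
      ContinuousOn (fun y => cyc fun a b c => pair (B i y ![e a, e b]) (H i y ![e c]))
        (P.chart i).target := fun hB hH i => (hB.isDensity_cyc hΦ hH).continuousOn i
  have h1 := BundleAtlas.eq_zero_of_integral_cyc' hΦ (hX.1.sub hX'.1) fun B hB => by
    have h2 := h (0, B) ⟨BundleAtlas.isAdForm_zero 1, hB⟩
    have h3 : ∀ X : Config ι, P.symplectic X (0, B) = - P.integral (fun i y =>
        cyc fun a b c => pair (B i y ![e a, e b]) (X.1 i y ![e c])) := fun X => by
      rw [← neg_one_mul, ← P.integral_const_mul]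
      refine P.integral_congr fun i y _ => ?_
      simp only [Pi.zero_apply, z1, cyc]; ring
    rw [h3, h3, neg_inj, ← sub_eq_zero, ← P.integral_sub (hc hB hX.1) (hc hB hX'.1)] at h2
    rw [← h2]
    refine P.integral_congr fun i y _ => ?_
    simp only [Pi.sub_apply, ContinuousAlternatingMap.sub_apply, pair_sub_right, cyc]; ring
  have h2 := BundleAtlas.eq_zero_of_integral_cyc hΦ (hX.2.sub hX'.2) fun H hH => by
    have h2 := h (H, 0) ⟨hH, BundleAtlas.isAdForm_zero 2⟩
    have h3 : ∀ X : Config ι, P.symplectic X (H, 0) = P.integral (fun i y =>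
        cyc fun a b c => pair (X.2 i y ![e a, e b]) (H i y ![e c])) := fun X => by
      refine P.integral_congr fun i y _ => ?_
      simp only [Pi.zero_apply, z2, cyc]; ring
    rw [h3, h3, ← sub_eq_zero, ← P.integral_sub (hc hX.2 hH) (hc hX'.2 hH)] at h2
    rw [← h2]
    refine P.integral_congr fun i y _ => ?_
    simp only [Pi.sub_apply, ContinuousAlternatingMap.sub_apply, pair_sub_left, cyc]; ring
  refine Prod.ext (funext fun i => funext fun y => ?_) (funext fun i => funext fun y => ?_)
  · by_cases hy : y ∈ (P.chart i).target
    · exact oneForm_ext fun c => sub_eq_zero.1 (h1 i hy c)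
    · rw [hX.1.2.1 i y hy, hX'.1.2.1 i y hy]
  · by_cases hy : y ∈ (P.chart i).target
    · obtain ⟨h01, h12, h20⟩ := h2 i hy
      exact twoForm_ext (sub_eq_zero.1 h01) (sub_eq_zero.1 h12) (sub_eq_zero.1 h20)
    · rw [hX.2.2.1 i y hy, hX'.2.2.1 i y hy]

end Onshell

section Linearized
variable (hl : l ∈ P.multipliers Φ) (hφ : φ ∈ P.phaseSpace Φ) (hs : IsSolution P Λ φ) {i : ι} {y : E3}
  (hy : y ∈ (P.chart i).target)
include hl hφ hs hy

/-- The flow solves the linearised curvature equation. -/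
theorem covD_flow_fst (v w : E3) : covD (φ.1 i) ((P.flow Λ l φ).1 i) y ![v, w] +
    Λ • (P.flow Λ l φ).2 i y ![v, w] = 0 := by
  have hX := BundleAtlas.flow_mem_tangent Λ hl hφ
  have hU := P.isOpen_target i
  have hAa := contDiffOn_form_iff.1 (contDiffOn_covD hU (hφ.1.1 i) (hl.1.1 i))
  have hn : ∀ v w, nabla (φ.1 i) v (fun z => (P.flow Λ l φ).1 i z ![w]) y =
      nabla (φ.1 i) v (fun z => covD (φ.1 i) (l.1 i) z ![w]) y -
        Λ • nabla (φ.1 i) v (fun z => l.2 i z ![w]) y := fun v w => by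
    rw [← nabla_smul _ _ (hl.2.differentiableAt_apply hy _),
      ← nabla_sub _ (differentiableAt_of_contDiffOn hU (hAa _) hy)
      (show DifferentiableAt ℝ (fun z => Λ • l.2 i z ![w]) y from
        (hl.2.differentiableAt_apply hy _).const_smul Λ)]
    refine nabla_congr _ ?_
    filter_upwards [hU.mem_nhds hy] with z hz using BundleAtlas.flow_fst_apply hz _
  have h1 := covD_covD_zero hU (hφ.1.1 i) (hl.1.1 i) hy v w
  rw [covD_one (differentiableAt_of_contDiffOn hU (contDiffOn_covD hU (hφ.1.1 i) (hl.1.1 i)) hy)] at h1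
  rw [covD_one (hX.1.differentiableAt hy), hn, hn, BundleAtlas.flow_snd_apply hy,
    covD_one (hl.2.differentiableAt hy)]
  -- The left side of the goal reduces to `[F + Λ𝔹, 𝕒]`: the two terms with `Λ d_A ℍ` cancel, and
  -- the field equation removes the bracket.
  have h2 : ⁅BF.curvature (φ.1 i) y v w, l.1 i y ![]⁆ + Λ • ⁅φ.2 i y ![v, w], l.1 i y ![]⁆ = 0 := by
    rw [← smul_lie, ← add_lie, hs.curvature i y hy, zero_lie]
  rw [← h1] at h2
  rw [← h2]
  module

/-- The flow solves the linearised Gauss equation. -/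
theorem covD_flow_snd : covD (φ.1 i) ((P.flow Λ l φ).2 i) y ![e 0, e 1, e 2] +
    (cyc fun a b c => ⁅(P.flow Λ l φ).1 i y ![e c], φ.2 i y ![e a, e b]⁆) = 0 := by
  have hX := BundleAtlas.flow_mem_tangent Λ hl hφ
  have hU := P.isOpen_target i
  have hAH := contDiffOn_form_iff.1 (contDiffOn_covD hU (hφ.1.1 i) (hl.2.1 i))
  have hn : ∀ u w, nabla (φ.1 i) u (fun z => (P.flow Λ l φ).2 i z w) y =
      ⁅nabla (φ.1 i) u (fun z => φ.2 i z w) y, l.1 i y ![]⁆ +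
      ⁅φ.2 i y w, nabla (φ.1 i) u (fun z => l.1 i z ![]) y⁆ +
        nabla (φ.1 i) u (fun z => covD (φ.1 i) (l.2 i) z w) y := fun u w => by
    rw [← nabla_lie _ (hφ.2.differentiableAt_apply hy _) (hl.1.differentiableAt_apply hy _),
      ← nabla_add _ (differentiableAt_lie (hφ.2.differentiableAt_apply hy _)
        (hl.1.differentiableAt_apply hy _)) (differentiableAt_of_contDiffOn hU (hAH _) hy)]
    refine nabla_congr _ ?_
    filter_upwards [hU.mem_nhds hy] with z hz using BundleAtlas.flow_snd_apply hz _
  have h1 := covD_covD_one hU (hφ.1.1 i) (hl.2.1 i) hy (e 0) (e 1) (e 2)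
  rw [covD_two (differentiableAt_of_contDiffOn hU (contDiffOn_covD hU (hφ.1.1 i) (hl.2.1 i)) hy)] at h1
  have h2 : ⁅covD (φ.1 i) (φ.2 i) y ![e 0, e 1, e 2], l.1 i y ![]⁆ = 0 := by
    rw [hs.covD i y hy, zero_lie]
  rw [covD_two (hφ.2.differentiableAt hy)] at h2
  -- In `d_A d_A ℍ = [F, ℍ]` the field equation replaces `F` by `-Λ𝔹`, which cancels the
  -- contribution of `-Λℍ` to `[X, 𝔹]`, with `X` the one-form part of the flow. The terms with `𝕒`
  -- combine into `[d_A 𝔹, 𝕒] = 0`.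
  have hF : ∀ v w, BF.curvature (φ.1 i) y v w = -(Λ • φ.2 i y ![v, w]) := fun v w =>
    eq_neg_of_add_eq_zero_left (hs.curvature i y hy v w)
  rw [hF, hF, hF, form_swap _ (e 0) (e 2)] at h1
  rw [covD_two (hX.2.differentiableAt hy), hn, hn, hn, form_swap _ (e 0) (e 2)]
  simp only [cyc, BundleAtlas.flow_fst_apply hy, covD_zero (hl.1.differentiableAt hy)]
  have h3 : ∀ X Y : 𝔡, ⁅X, Y⁆ = - ⁅Y, X⁆ := fun X Y => (lie_skew X Y).symm
  simp only [sub_lie, add_lie, neg_lie, smul_lie, smul_neg, neg_neg] at h1 h2 ⊢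
  simp only [h3 (nabla _ _ (fun z => l.1 i z ![]) y), h3 (l.2 i y _)] at h1 h2 ⊢
  rw [← sub_eq_zero] at h1
  have h4 := congrArg₂ (· + ·) h1 h2
  simp only [add_zero] at h4
  rw [← h4]
  module

theorem firstVariation_flow (l' : Multiplier ι) :
    firstVariation Λ l' φ (P.flow Λ l φ) i y = 0 := by
  rw [firstVariation, covD_flow_snd hl hφ hs hy]
  simp only [covD_flow_fst hl hφ hs hy, pair_zero_left, cyc, add_zero]

end Linearized

section FirstClass
variable (hΦ : ∀ (a : D) (X Y : 𝔡), pair (Ad Φ a X) (Ad Φ a Y) = pair X Y)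
  {C : Multiplier ι → Config ι → ℝ}
  (hC : ∀ φ ∈ P.phaseSpace Φ, ∀ l ∈ P.multipliers Φ, C l φ = bfConstraint P Λ l φ)

include hC in
theorem hasDerivAt_constraint {Y : Config ι} (hl : l ∈ P.multipliers Φ) (hφ : φ ∈ P.phaseSpace Φ)
    (hY : Y ∈ P.tangent Φ) : HasDerivAt (fun t : ℝ => C l (φ + t • Y))
      (P.integral (firstVariation Λ l φ Y)) 0 := by
  have h : (fun t : ℝ => C l (φ + t • Y)) = fun t : ℝ => bfConstraint P Λ l (φ + t • Y) :=
    funext fun t => hC _ (BundleAtlas.phaseSpace_add_smul hφ hY t) l hl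
  rw [h]
  exact hasDerivAt_bfConstraint hl hφ hY

include hΦ hC

theorem isHamiltonianVector_flow (hl : l ∈ P.multipliers Φ) (hφ : φ ∈ P.phaseSpace Φ) :
    P.IsHamiltonianVector Φ (C l) φ (P.flow Λ l φ) :=
  ⟨BundleAtlas.flow_mem_tangent Λ hl hφ, fun _ hY =>
    integral_firstVariation (Λ := Λ) hΦ hl hφ hY ▸ hasDerivAt_constraint hC hl hφ hY⟩

/-- Uniqueness comes from the weak nondegeneracy of the symplectic form, `eq_of_symplectic_eq`. It
turns the existential descriptions of Hamiltonian vectors into the image of the linear map `l ↦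
flow`. -/
theorem isHamiltonianVector_iff (hl : l ∈ P.multipliers Φ) (hφ : φ ∈ P.phaseSpace Φ)
    {X : Config ι} : P.IsHamiltonianVector Φ (C l) φ X ↔ X = P.flow Λ l φ := by
  have h := isHamiltonianVector_flow hΦ hC hl hφ
  refine ⟨fun hX => eq_of_symplectic_eq hΦ hX.1 h.1 fun Y hY => (hX.2 Y hY).unique (h.2 Y hY), ?_⟩
  rintro rfl
  exact h

theorem isSolution_of_mem_constraintSurface (hφ : φ ∈ P.constraintSurface Φ C) :
    IsSolution P Λ φ :=
  isSolution_of_bfConstraint_eq_zero hΦ hφ.1 fun l hl => (hC φ hφ.1 l hl) ▸ hφ.2 l hl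

/-- The bracket of two constraints is the integral of the first variation of one along the flow of
the other; on shell that integrand vanishes pointwise. -/
theorem isFirstClassVector_iff (hl : l ∈ P.multipliers Φ) (hφ : φ ∈ P.constraintSurface Φ C)
    {X : Config ι} : P.IsFirstClassVector Φ C l φ X ↔ X = P.flow Λ l φ := by
  refine ⟨fun h => (isHamiltonianVector_iff hΦ hC hl hφ.1).1 h.1, ?_⟩
  rintro rfl
  refine ⟨isHamiltonianVector_flow hΦ hC hl hφ.1, fun l' hl' => ?_⟩
  have h := hasDerivAt_constraint hC hl' hφ.1 (BundleAtlas.flow_mem_tangent Λ hl hφ.1)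
  rwa [P.integral_congr (ρ' := fun _ _ => 0) fun i y hy => firstVariation_flow hl hφ.1
    (isSolution_of_mem_constraintSurface hΦ hC hφ) hy l', P.integral_zero] at h

theorem isFirstClass : P.IsFirstClass Φ C := fun _ hφ _ hl =>
  ⟨_, (isFirstClassVector_iff hΦ hC hl hφ).2 rfl⟩

end FirstClass
end Constraints
end QEGR
end

open scoped Manifold ContDiff
noncomputable section
namespace QEGR
open Filter Topology TrivialExt

/-! ### Finite codimension as a tool for bounding ranks. -/

section Codimension
variable {M M' V : Type*} [AddCommGroup M] [Module ℝ M] [AddCommGroup M'] [Module ℝ M']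
  [AddCommGroup V] [Module ℝ V]

/-- The subspace `N` contains the kernel of `n` linear functionals. -/
def CodimLE (N : Submodule ℝ M) (n : ℕ) : Prop :=
  ∃ R : M →ₗ[ℝ] (Fin n → ℝ), LinearMap.ker R ≤ N

theorem CodimLE.mono {N N' : Submodule ℝ M} {n : ℕ} (h : CodimLE N n) (hN : N ≤ N') :
    CodimLE N' n :=
  h.imp fun _ hR => hR.trans hN

theorem CodimLE.comap {N : Submodule ℝ M} {n : ℕ} (h : CodimLE N n) (f : M' →ₗ[ℝ] M) :
    CodimLE (N.comap f) n :=
  let ⟨R, hR⟩ := h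
  ⟨R ∘ₗ f, fun _ hx => hR hx⟩

theorem codimLE_ker [FiniteDimensional ℝ V] (R : M →ₗ[ℝ] V) {n : ℕ} (hn : Module.finrank ℝ V = n) :
    CodimLE (LinearMap.ker R) n := by
  subst hn
  refine ⟨(Module.finBasis ℝ V).equivFun.toLinearMap ∘ₗ R, fun x hx => ?_⟩
  simpa using hx

theorem CodimLE.inf {N N' : Submodule ℝ M} {n n' : ℕ} (h : CodimLE N n) (h' : CodimLE N' n') :
    CodimLE (N ⊓ N') (n + n') := by
  obtain ⟨R, hR⟩ := h
  obtain ⟨R', hR'⟩ := h'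
  refine (codimLE_ker (R.prod R') (by simp)).mono fun x hx => ?_
  rw [LinearMap.ker_prod] at hx
  exact ⟨hR hx.1, hR' hx.2⟩

theorem CodimLE.iInf_fin {m n : ℕ} {N : Fin m → Submodule ℝ M} (h : ∀ j, CodimLE (N j) n) :
    CodimLE (⨅ j, N j) (m * n) := by
  choose R hR using h
  refine (codimLE_ker (LinearMap.pi R) (n := m * n)
    (by rw [Module.finrank_pi_fintype]; simp)).mono fun x hx => ?_
  rw [Submodule.mem_iInf]
  intro j
  exact hR j (congrFun hx j)

/-- Modulo its kernel, `f` depends only on the `n` functionals. This bounds the rank although `M`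
may be infinite-dimensional. -/
theorem CodimLE.finrank_range_le {f : M →ₗ[ℝ] V} {n : ℕ} (h : CodimLE (LinearMap.ker f) n) :
    Module.Finite ℝ (LinearMap.range f) ∧ Module.finrank ℝ (LinearMap.range f) ≤ n := by
  obtain ⟨R, hR⟩ := h
  obtain ⟨s, hs⟩ := R.rangeRestrict.exists_rightInverse_of_surjective R.range_rangeRestrict
  have h1 : LinearMap.range f = LinearMap.range (f ∘ₗ s) := by
    refine le_antisymm ?_ (LinearMap.range_comp_le_range s f)
    rintro _ ⟨x, rfl⟩
    refine ⟨R.rangeRestrict x, ?_⟩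
    have h2 : s (R.rangeRestrict x) - x ∈ LinearMap.ker R := by
      have h3 := congrArg Subtype.val (LinearMap.congr_fun hs (R.rangeRestrict x))
      simp only [LinearMap.comp_apply, LinearMap.id_apply, LinearMap.codRestrict_apply,
        LinearMap.rangeRestrict] at h3
      rw [LinearMap.mem_ker, map_sub, sub_eq_zero]
      exact h3
    have h4 := hR h2
    rw [LinearMap.mem_ker, map_sub, sub_eq_zero] at h4
    exact h4
  rw [h1]
  refine ⟨inferInstance, (LinearMap.finrank_range_le _).trans ?_⟩
  exact (Submodule.finrank_le _).trans (by simp)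

/-- The lower bound on ranks: `Q` embeds into the range of `f` times the `r` functionals that cut
out a subspace of `N`. -/
theorem finrank_le_finrank_range_add {Q : Type*} [AddCommGroup Q] [Module ℝ Q]
    [FiniteDimensional ℝ Q] {f : M →ₗ[ℝ] V} [Module.Finite ℝ (LinearMap.range f)]
    {N : Submodule ℝ M} {r : ℕ} (hN : CodimLE N r) (g : Q →ₗ[ℝ] M)
    (h : ∀ q, f (g q) = 0 → g q ∈ N → q = 0) :
    Module.finrank ℝ Q ≤ Module.finrank ℝ (LinearMap.range f) + r := by
  obtain ⟨R, hR⟩ := hN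
  have hi : Function.Injective ((f.rangeRestrict ∘ₗ g).prod (R ∘ₗ g)) := by
    rw [← LinearMap.ker_eq_bot, LinearMap.ker_prod, eq_bot_iff]
    intro q hq
    exact h q (congrArg Subtype.val hq.1) (hR hq.2)
  have := LinearMap.finrank_le_finrank_of_injective hi
  simpa using this

end Codimension

/-! ### Smooth functions on an open set and jets in chosen directions. -/

section SmoothFunctions
open TopologicalSpace (Opens)
variable (U : Opens E3) (F : Type*) [NormedAddCommGroup F] [NormedSpace ℝ F]

/-- Smooth functions on an open set, extended by zero. -/
def smoothOn : Submodule ℝ (E3 → F) where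
  carrier := {f | ContDiffOn ℝ ∞ f U ∧ ∀ z ∉ U, f z = 0}
  add_mem' h h' := ⟨h.1.add h'.1, fun z hz => by simp [h.2 z hz, h'.2 z hz]⟩
  zero_mem' := ⟨contDiffOn_const, fun _ _ => rfl⟩
  smul_mem' r f h := ⟨h.1.const_smul r, fun z hz => by simp [h.2 z hz]⟩

variable {U F}

/-- The restriction of a smooth function to an open set. -/
def toSmoothOn (U : Opens E3) (f : E3 → F) (hf : ContDiffOn ℝ ∞ f U) : smoothOn U F :=
  ⟨(U : Set E3).indicator f, hf.congr fun _ hz => Set.indicator_of_mem hz f,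
    fun _ hz => Set.indicator_of_notMem hz f⟩

theorem toSmoothOn_apply {f : E3 → F} (hf : ContDiffOn ℝ ∞ f U) {z : E3} (hz : z ∈ U) :
    (toSmoothOn U f hf).1 z = f z := Set.indicator_of_mem hz f

theorem smoothOn_ext {f g : smoothOn U F} (h : ∀ z ∈ U, f.1 z = g.1 z) : f = g := by
  refine Subtype.ext (funext fun z => ?_)
  by_cases hz : z ∈ U
  · exact h z hz
  · rw [f.2.2 z hz, g.2.2 z hz]

theorem smoothOn_differentiableAt (f : smoothOn U F) {z : E3} (hz : z ∈ U) :
    DifferentiableAt ℝ f.1 z := differentiableAt_of_contDiffOn U.isOpen f.2.1 hz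

theorem contDiffOn_fderiv_apply {f : E3 → F} (hf : ContDiffOn ℝ ∞ f U) (v : E3) :
    ContDiffOn ℝ ∞ (fun z => fderiv ℝ f z v) U :=
  (hf.fderiv_of_isOpen U.isOpen (m := ∞) (by simp)).clm_apply contDiffOn_const

/-- Partial derivatives of smooth functions on an open set. -/
def partialDeriv (c : Fin 3) : smoothOn U F →ₗ[ℝ] smoothOn U F where
  toFun f := toSmoothOn U (fun z => fderiv ℝ f.1 z (e c)) (contDiffOn_fderiv_apply f.2.1 _)
  map_add' f g := smoothOn_ext fun z hz => by
    have h : fderiv ℝ (f + g).1 z = fderiv ℝ f.1 z + fderiv ℝ g.1 z :=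
      fderiv_add (smoothOn_differentiableAt f hz) (smoothOn_differentiableAt g hz)
    have h' := fun f : smoothOn U F => toSmoothOn_apply (contDiffOn_fderiv_apply f.2.1 (e c)) hz
    rw [h', h]
    exact (congrArg₂ (fun X Y : F => X + Y) (h' f) (h' g)).symm
  map_smul' r f := smoothOn_ext fun z hz => by
    have h : fderiv ℝ (r • f).1 z = r • fderiv ℝ f.1 z :=
      fderiv_const_smul (smoothOn_differentiableAt f hz) r
    have h' := fun f : smoothOn U F => toSmoothOn_apply (contDiffOn_fderiv_apply f.2.1 (e c)) hz
    rw [h', h]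
    exact (congrArg (fun X : F => r • X) (h' f)).symm

theorem partialDeriv_apply (c : Fin 3) (f : smoothOn U F) {z : E3} (hz : z ∈ U) :
    (partialDeriv c f).1 z = fderiv ℝ f.1 z (e c) :=
  toSmoothOn_apply (contDiffOn_fderiv_apply f.2.1 (e c)) hz

theorem partialDeriv_toSmoothOn (c : Fin 3) {f : E3 → F} (hf : ContDiffOn ℝ ∞ f U) :
    partialDeriv c (toSmoothOn U f hf) =
      toSmoothOn U (fun z => fderiv ℝ f z (e c)) (contDiffOn_fderiv_apply hf _) := by
  refine smoothOn_ext fun z hz => ?_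
  have h : (toSmoothOn U f hf).1 =ᶠ[𝓝 z] f := by
    filter_upwards [U.isOpen.mem_nhds hz] with w hw using toSmoothOn_apply hf hw
  rw [partialDeriv_apply c _ hz, toSmoothOn_apply _ hz, h.fderiv_eq]

theorem partialDeriv_comm (c d : Fin 3) (f : smoothOn U F) :
    partialDeriv c (partialDeriv d f) = partialDeriv d (partialDeriv c f) := by
  have key : ∀ c d, ∀ z ∈ U, (partialDeriv c (partialDeriv d f)).1 z =
      fderiv ℝ (fderiv ℝ f.1) z (e c) (e d) := fun c d z hz => by
    have h : (partialDeriv d f).1 =ᶠ[𝓝 z] fun w => fderiv ℝ f.1 w (e d) := by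
      filter_upwards [U.isOpen.mem_nhds hz] with w hw using partialDeriv_apply d f hw
    have hfd : DifferentiableAt ℝ (fderiv ℝ f.1) z := differentiableAt_of_contDiffOn U.isOpen
      (f.2.1.fderiv_of_isOpen U.isOpen (m := ∞) (by simp)) hz
    rw [partialDeriv_apply c _ hz, h.fderiv_eq,
      fderiv_clm_apply hfd (differentiableAt_const _)]
    simp
  refine smoothOn_ext fun z hz => ?_
  have hs : IsSymmSndFDerivAt ℝ f.1 z :=
    (f.2.1.contDiffAt (U.isOpen.mem_nhds hz)).isSymmSndFDerivAt
      (by rw [minSmoothness_of_isRCLikeNormedField]; exact ENat.LEInfty.out)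
  rw [key _ _ z hz, key _ _ z hz, hs.eq]

/-- Evaluation at a point. -/
def evalAt (y : E3) : smoothOn U F →ₗ[ℝ] F where
  toFun f := f.1 y
  map_add' _ _ := rfl
  map_smul' _ _ := rfl

/-- Functions whose iterated partial derivatives in the given directions vanish up to a given order
at a point. -/
def vanishing (L : List (Fin 3)) (y : E3) : ℕ → Submodule ℝ (smoothOn U F)
  | 0 => LinearMap.ker (evalAt y)
  | k + 1 => LinearMap.ker (evalAt y) ⊓
      ⨅ c : {c // c ∈ L}, (vanishing L y k).comap (partialDeriv c.1)

variable {L : List (Fin 3)} {y : E3} {k : ℕ} {f : smoothOn U F}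

theorem mem_vanishing_zero : f ∈ vanishing L y 0 ↔ f.1 y = 0 := Iff.rfl

theorem mem_vanishing_succ : f ∈ vanishing L y (k + 1) ↔
    f.1 y = 0 ∧ ∀ c ∈ L, partialDeriv c f ∈ vanishing L y k := by
  rw [vanishing, Submodule.mem_inf, Submodule.mem_iInf]
  simp only [Submodule.mem_comap, Subtype.forall]
  rfl

theorem eval_eq_zero_of_mem_vanishing (h : f ∈ vanishing L y k) : f.1 y = 0 := by
  cases k with
  | zero => exact h
  | succ k => exact (mem_vanishing_succ.1 h).1

theorem mem_vanishing_of_succ (h : f ∈ vanishing L y (k + 1)) : f ∈ vanishing L y k := by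
  induction k generalizing f with
  | zero => exact (mem_vanishing_succ.1 h).1
  | succ k ih =>
    rw [mem_vanishing_succ] at h ⊢
    exact ⟨h.1, fun c hc => ih (h.2 c hc)⟩

theorem mem_vanishing_of_le {m : ℕ} (hm : m ≤ k) (h : f ∈ vanishing L y k) :
    f ∈ vanishing L y m := by
  induction k with
  | zero => rwa [Nat.le_zero.1 hm]
  | succ k ih =>
    rcases Nat.lt_or_ge k m with h' | h'
    · rwa [le_antisymm hm h']
    · exact ih h' (mem_vanishing_of_succ h)

/-- Vanishing of derivatives in one more direction. -/
theorem mem_vanishing_cons {c : Fin 3} (h : partialDeriv c f ∈ vanishing (c :: L) y k)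
    (h' : f ∈ vanishing L y (k + 1)) : f ∈ vanishing (c :: L) y (k + 1) := by
  induction k generalizing f with
  | zero =>
    rw [mem_vanishing_succ] at h' ⊢
    refine ⟨h'.1, fun d hd => ?_⟩
    rcases List.mem_cons.1 hd with rfl | hd
    · exact h
    · exact h'.2 d hd
  | succ k ih =>
    rw [mem_vanishing_succ] at h' ⊢
    refine ⟨h'.1, fun d hd => ?_⟩
    rcases List.mem_cons.1 hd with rfl | hd
    · exact h
    · refine ih ?_ (h'.2 d hd)
      rw [partialDeriv_comm]
      exact (mem_vanishing_succ.1 h).2 d (List.mem_cons_of_mem c hd)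

/-- A jet of order `k + 1` in the directions `c :: L` is determined by the jet of order `k` of the
derivative along `c` and by the jet of order `k + 1` in the directions `L`. The counts satisfy
Pascal's rule. -/
theorem codimLE_vanishing [FiniteDimensional ℝ F] (L : List (Fin 3)) (y : E3) (k : ℕ) :
    CodimLE (vanishing (U := U) (F := F) L y k)
      ((L.length + k).choose k * Module.finrank ℝ F) := by
  have hev : CodimLE (LinearMap.ker (evalAt (U := U) (F := F) y)) (Module.finrank ℝ F) :=
    codimLE_ker _ rfl
  induction L generalizing k with
  | nil =>
    simp only [List.length_nil, zero_add, Nat.choose_self, one_mul]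
    refine hev.mono fun f hf => ?_
    cases k with
    | zero => exact hf
    | succ k => exact mem_vanishing_succ.2 ⟨hf, by simp⟩
  | cons c L ihL =>
    induction k with
    | zero =>
      rw [Nat.choose_zero_right, one_mul]
      exact hev
    | succ k ih =>
      have h := (ih.comap (partialDeriv c)).inf (ihL (k + 1))
      rw [← add_mul] at h
      have hn : ((c :: L).length + k).choose k + (L.length + (k + 1)).choose (k + 1) =
          ((c :: L).length + (k + 1)).choose (k + 1) := by
        have e1 : (c :: L).length + (k + 1) = ((c :: L).length + k) + 1 := rfl
        have e2 : L.length + (k + 1) = (c :: L).length + k := by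
          rw [List.length_cons]; ring
        rw [e1, e2, Nat.choose_succ_succ]
      rw [hn] at h
      exact h.mono fun f hf => mem_vanishing_cons hf.1 hf.2

/-- The pointwise Lie bracket of smooth functions. -/
def lieSmooth (f g : smoothOn U 𝔡) : smoothOn U 𝔡 :=
  ⟨fun z => ⁅f.1 z, g.1 z⁆, contDiffOn_lie f.2.1 g.2.1, fun z hz =>
    (congrArg (fun X => ⁅X, g.1 z⁆) (f.2.2 z hz)).trans (zero_lie _)⟩

theorem partialDeriv_lie (c : Fin 3) (f g : smoothOn U 𝔡) : partialDeriv c (lieSmooth f g) =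
    lieSmooth (partialDeriv c f) g + lieSmooth f (partialDeriv c g) := by
  refine smoothOn_ext fun z hz => ?_
  rw [partialDeriv_apply c _ hz]
  refine (fderiv_lie (smoothOn_differentiableAt f hz) (smoothOn_differentiableAt g hz) _).trans ?_
  rw [← partialDeriv_apply c f hz, ← partialDeriv_apply c g hz]
  rfl

/-- By the Leibniz rule the functions vanishing to a given order behave as an ideal, so terms of
order zero in the equations cost no derivatives. -/
theorem lieSmooth_mem_vanishing (f : smoothOn U 𝔡) {g : smoothOn U 𝔡}
    (h : g ∈ vanishing L y k) : lieSmooth f g ∈ vanishing L y k := by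
  induction k generalizing f g with
  | zero =>
    have : g.1 y = 0 := h
    rw [mem_vanishing_zero]
    exact (congrArg (fun X => ⁅f.1 y, X⁆) this).trans (lie_zero _)
  | succ k ih =>
    rw [mem_vanishing_succ]
    refine ⟨(congrArg (fun X => ⁅f.1 y, X⁆) (mem_vanishing_succ.1 h).1).trans (lie_zero _),
      fun c hc => ?_⟩
    rw [partialDeriv_lie]
    exact add_mem (ih _ (mem_vanishing_of_succ h)) (ih _ ((mem_vanishing_succ.1 h).2 c hc))

end SmoothFunctions
end QEGR
end

open scoped Manifold ContDiff
noncomputable section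
namespace QEGR
open Filter Topology TrivialExt
open TopologicalSpace (Opens)

/-! ### Vanishing of iterated Fréchet derivatives in terms of partial derivatives. -/

section Jets
variable {G F : Type*} [NormedAddCommGroup G] [NormedSpace ℝ G] [NormedAddCommGroup F]
  [NormedSpace ℝ F] {f : E3 → G} {y : E3} {k : ℕ}

/-- The derivatives up to order `k` vanish. -/
def JetZero (k : ℕ) (f : E3 → G) (y : E3) : Prop := ∀ m ≤ k, iteratedFDeriv ℝ m f y = 0

theorem jetZero_iff_components {J : Type*} (ev : J → G →L[ℝ] F)
    (hev : ∀ g, (∀ j, ev j g = 0) → g = 0) (hf : ContDiffAt ℝ ∞ f y) :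
    JetZero k f y ↔ ∀ j, JetZero k (fun z => ev j (f z)) y := by
  have h : ∀ j m, iteratedFDeriv ℝ m (fun z => ev j (f z)) y =
      (ev j).compContinuousMultilinearMap (iteratedFDeriv ℝ m f y) := fun j m =>
    (ev j).iteratedFDeriv_comp_left hf (by exact_mod_cast le_top)
  constructor
  · intro h0 j m hm
    rw [h, h0 m hm]
    ext v
    simp
  · intro h0 m hm
    ext v
    refine hev _ fun j => ?_
    have := h0 j m hm
    rw [h] at this
    exact congrArg (fun T => T v) this

/-- Iterated derivatives of `f` and of its derivative have equal norms, which suffices since only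
vanishing matters. -/
theorem jetZero_succ : JetZero (k + 1) f y ↔ f y = 0 ∧ JetZero k (fderiv ℝ f) y := by
  have h : ∀ m, iteratedFDeriv ℝ m (fderiv ℝ f) y = 0 ↔ iteratedFDeriv ℝ (m + 1) f y = 0 := fun m => by
    rw [← norm_eq_zero, norm_iteratedFDeriv_fderiv, norm_eq_zero]
  have h0 : iteratedFDeriv ℝ 0 f y = 0 ↔ f y = 0 := by
    rw [← norm_eq_zero, norm_iteratedFDeriv_zero, norm_eq_zero]
  constructor
  · exact fun H => ⟨h0.1 (H 0 (Nat.zero_le _)), fun m hm => (h m).2 (H (m + 1) (by omega))⟩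
  · rintro ⟨H0, H⟩ m hm
    cases m with
    | zero => exact h0.2 H0
    | succ m => exact (h m).1 (H m (by omega))

theorem clm_eq_zero {T : E3 →L[ℝ] G} (h : ∀ c, T (e c) = 0) : T = 0 := by
  have : (T : E3 →ₗ[ℝ] G) = 0 := stdBasis.ext fun c => by rw [stdBasis_apply]; exact h c
  exact ContinuousLinearMap.coe_injective this

theorem jetZero_iff_mem_vanishing {U : Opens E3} (hf : ContDiffOn ℝ ∞ f U) (hy : y ∈ U) :
    JetZero k f y ↔ toSmoothOn U f hf ∈ vanishing [0, 1, 2] y k := by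
  induction k generalizing f with
  | zero =>
    rw [mem_vanishing_zero, toSmoothOn_apply hf hy]
    have h0 : iteratedFDeriv ℝ 0 f y = 0 ↔ f y = 0 := by
      rw [← norm_eq_zero, norm_iteratedFDeriv_zero, norm_eq_zero]
    rw [← h0]
    exact ⟨fun h => h 0 le_rfl, fun h m hm => by rwa [Nat.le_zero.1 hm]⟩
  | succ k ih =>
    rw [jetZero_succ, mem_vanishing_succ, toSmoothOn_apply hf hy]
    refine and_congr_right fun _ => ?_
    rw [jetZero_iff_components (fun c : Fin 3 => ContinuousLinearMap.apply ℝ G (e c))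
      (fun T hT => clm_eq_zero hT)
      ((hf.fderiv_of_isOpen U.isOpen (m := ∞) (by simp)).contDiffAt (U.isOpen.mem_nhds hy))]
    have hall : ∀ c : Fin 3, c ∈ [(0 : Fin 3), 1, 2] := by decide
    constructor
    · intro h c _
      rw [partialDeriv_toSmoothOn, ← ih]
      exact h c
    · intro h c
      have := h c (hall c)
      rw [partialDeriv_toSmoothOn, ← ih] at this
      exact this

end Jets

/-! ### Polynomials as jets, and their dimension count. -/

section Polynomials
open MvPolynomial

/-- The value of a polynomial in coordinates centred at `y`. -/
def evalPoly (y : E3) (p : MvPolynomial (Fin 3) ℝ) (z : E3) : ℝ := eval (fun c => z c - y c) p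

theorem hasFDerivAt_evalPoly (y : E3) (p : MvPolynomial (Fin 3) ℝ) (z : E3) :
    HasFDerivAt (evalPoly y p)
      (∑ c, evalPoly y (pderiv c p) z • (EuclideanSpace.proj c : E3 →L[ℝ] ℝ)) z := by
  induction p using MvPolynomial.induction_on with
  | C a =>
    have he : evalPoly y (C a) = fun _ => a := by ext z; simp [evalPoly]
    rw [he]
    simpa [evalPoly] using hasFDerivAt_const (𝕜 := ℝ) a z
  | add p q hp hq =>
    have he : evalPoly y (p + q) = evalPoly y p + evalPoly y q := by
      ext z; simp [evalPoly]
    rw [he]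
    refine (hp.add hq).congr_fderiv ?_
    simp only [evalPoly, map_add, add_smul, Finset.sum_add_distrib]
  | mul_X p d hp =>
    have hX : HasFDerivAt (fun z : E3 => z d - y d) (EuclideanSpace.proj d : E3 →L[ℝ] ℝ) z :=
      (EuclideanSpace.proj d : E3 →L[ℝ] ℝ).hasFDerivAt.sub_const _
    have h := hp.mul hX
    have he : evalPoly y (p * X d) = fun z => evalPoly y p z * (z d - y d) := by
      ext z; simp [evalPoly]
    rw [he]
    refine h.congr_fderiv ?_
    simp only [evalPoly, Derivation.leibniz, pderiv_X, smul_eq_mul, map_add, map_mul, eval_X,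
      add_smul, Finset.sum_add_distrib, Finset.smul_sum, smul_smul]
    congr 1
    rw [Finset.sum_eq_single d]
    · simp
    · intro c _ hc
      simp [hc.symm]
    · simp

theorem contDiff_evalPoly (y : E3) (p : MvPolynomial (Fin 3) ℝ) :
    ContDiff ℝ ∞ (evalPoly y p) := by
  induction p using MvPolynomial.induction_on with
  | C a =>
    have he : evalPoly y (C a) = fun _ => a := by ext z; simp [evalPoly]
    rw [he]
    exact contDiff_const
  | add p q hp hq =>
    have he : evalPoly y (p + q) = fun z => evalPoly y p z + evalPoly y q z := by
      ext z; simp [evalPoly]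
    rw [he]; exact hp.add hq
  | mul_X p d hp =>
    have he : evalPoly y (p * X d) = fun z => evalPoly y p z * (z d - y d) := by
      ext z; simp [evalPoly]
    rw [he]
    exact hp.mul ((EuclideanSpace.proj d : E3 →L[ℝ] ℝ).contDiff.sub contDiff_const)

variable {F : Type*} [NormedAddCommGroup F] [NormedSpace ℝ F]

/-- The function with given polynomial components. -/
def polyFun (y : E3) (p : Fin (Module.finrank ℝ F) → MvPolynomial (Fin 3) ℝ)
    [FiniteDimensional ℝ F] (z : E3) : F :=
  ∑ b, evalPoly y (p b) z • Module.finBasis ℝ F b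

variable [FiniteDimensional ℝ F] {p : Fin (Module.finrank ℝ F) → MvPolynomial (Fin 3) ℝ} {y : E3}
  {U : Opens E3} {k : ℕ}

theorem contDiff_polyFun : ContDiff ℝ ∞ (polyFun y p) :=
  ContDiff.sum fun _ _ => (contDiff_evalPoly y _).smul contDiff_const

theorem fderiv_polyFun (c : Fin 3) (z : E3) :
    fderiv ℝ (polyFun y p) z (e c) = polyFun y (fun b => pderiv c (p b)) z := by
  have h : HasFDerivAt (polyFun y p) _ z := HasFDerivAt.fun_sum fun b _ =>
    (hasFDerivAt_evalPoly y (p b) z).smul_const (Module.finBasis ℝ F b)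
  rw [h.fderiv]
  simp [polyFun, e, sum_apply]

/-- A coefficient of positive degree is, up to a nonzero integer factor, a coefficient of lower
degree of a partial derivative, whose jet vanishes to one order less. Coefficients of degree zero
are read off at `y`. -/
theorem coeff_eq_zero_of_mem_vanishing (hy : y ∈ U)
    (h : toSmoothOn U (polyFun y p) contDiff_polyFun.contDiffOn ∈ vanishing [0, 1, 2] y k)
    (b : Fin (Module.finrank ℝ F)) {m : Fin 3 →₀ ℕ} (hm : m.degree ≤ k) : coeff m (p b) = 0 := by
  induction k generalizing p m with
  | zero =>
    have hm0 : m = 0 := (Finsupp.degree_eq_zero_iff m).1 (Nat.le_zero.1 hm)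
    have h0 := eval_eq_zero_of_mem_vanishing h
    rw [toSmoothOn_apply _ hy, polyFun] at h0
    have h1 := Fintype.linearIndependent_iff.1 (Module.finBasis ℝ F).linearIndependent _ h0 b
    rw [evalPoly] at h1
    have h2 : (fun c => y c - y c) = (0 : Fin 3 → ℝ) := by ext c; simp
    rw [h2, eval_zero] at h1
    rw [hm0]; exact h1
  | succ k ih =>
    rcases Nat.lt_or_ge k m.degree with hk | hk
    · have hne : m ≠ 0 := by rintro rfl; simp at hk
      obtain ⟨c, hc⟩ := Finsupp.ne_iff.1 hne
      have hle : Finsupp.single c 1 ≤ m := by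
        rw [Finsupp.single_le_iff]; exact Nat.one_le_iff_ne_zero.2 hc
      obtain ⟨m', rfl⟩ := exists_add_of_le hle
      have h1 := (mem_vanishing_succ.1 h).2 c (by fin_cases c <;> decide)
      rw [partialDeriv_toSmoothOn] at h1
      have h2 : (fun z => fderiv ℝ (polyFun y p) z (e c)) = polyFun y (fun b => pderiv c (p b)) :=
        funext fun z => fderiv_polyFun c z
      simp only [h2] at h1
      have h3 := ih h1 (m := m') (by
        rw [map_add, Finsupp.degree_single] at hm; omega)
      rw [coeff_pderiv] at h3
      rw [add_comm]
      rcases mul_eq_zero.1 h3 with h4 | h4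
      · exact h4
      · exact absurd h4 (by positivity)
    · exact ih (mem_vanishing_of_succ h) hk

/-- The exponents of monomials of degree at most `n` in three variables. -/
def exponents (n : ℕ) : Finset (Fin 3 →₀ ℕ) :=
  (Finset.range (n + 1)).biUnion fun m => Finset.univ.finsuppAntidiag m

theorem mem_exponents {n : ℕ} {m : Fin 3 →₀ ℕ} : m ∈ exponents n ↔ m.degree ≤ n := by
  simp [exponents, Finset.mem_finsuppAntidiag, Finsupp.degree_eq_sum]

/-- Stars and bars in each degree, then the hockey-stick identity. -/
theorem card_exponents (n : ℕ) : (exponents n).card = (n + 3).choose 3 := by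
  rw [exponents, Finset.card_biUnion]
  · have h : ∀ m ∈ Finset.range (n + 1),
        ((Finset.univ : Finset (Fin 3)).finsuppAntidiag m).card = (m + 2).choose 2 := by
      intro m _
      rw [Finset.card_finsuppAntidiag_nat_eq_choose, Finset.card_univ, Fintype.card_fin]
      have : 3 + m - 1 = m + 2 := by omega
      rw [this, Nat.choose_symm_add]
    rw [Finset.sum_congr rfl h, Nat.sum_range_add_choose]
  · intro a _ b _ hab
    rw [Function.onFun, Finset.disjoint_left]
    intro m hm hm'
    rw [Finset.mem_finsuppAntidiag] at hm hm'
    exact hab (hm.1.symm.trans hm'.1)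

/-- The polynomial with given coefficients. -/
def polyOf (n : ℕ) : (exponents n → ℝ) →ₗ[ℝ] MvPolynomial (Fin 3) ℝ :=
  ∑ m, monomial m.1 ∘ₗ LinearMap.proj m

theorem coeff_polyOf {n : ℕ} (v : exponents n → ℝ) (m : exponents n) :
    coeff m.1 (polyOf n v) = v m := by
  simp [polyOf, LinearMap.sum_apply, coeff_sum, coeff_monomial, Subtype.ext_iff.symm]

variable (F) in
/-- The function with polynomial components with given coefficients. -/
def polyMap (y : E3) (n : ℕ) : (Fin (Module.finrank ℝ F) → exponents n → ℝ) →ₗ[ℝ] (E3 → F) where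
  toFun v := polyFun y fun b => polyOf n (v b)
  map_add' v w := by
    ext z; simp [polyFun, evalPoly, add_smul, Finset.sum_add_distrib]
  map_smul' r v := by
    ext z; simp [polyFun, evalPoly, mul_smul, Finset.smul_sum]

theorem contDiff_polyMap (n : ℕ) (v : Fin (Module.finrank ℝ F) → exponents n → ℝ) :
    ContDiff ℝ ∞ (polyMap F y n v) := contDiff_polyFun

theorem polyMap_eq_zero {n : ℕ} (hy : y ∈ U) {v : Fin (Module.finrank ℝ F) → exponents n → ℝ}
    (h : toSmoothOn U (polyMap F y n v) (contDiff_polyMap n v).contDiffOn ∈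
      vanishing [0, 1, 2] y n) : v = 0 := by
  ext b m
  rw [← coeff_polyOf (v b) m]
  exact coeff_eq_zero_of_mem_vanishing hy h b (mem_exponents.1 m.2)

theorem finrank_coeffs (d n : ℕ) :
    Module.finrank ℝ (Fin d → exponents n → ℝ) = d * (n + 3).choose 3 := by
  rw [Module.finrank_pi_fintype]
  simp [card_exponents]

end Polynomials

section Dimension

theorem finrank_so31 : Module.finrank ℝ SO31 = 6 := by
  rw [so31Coord.finrank_eq]; simp

theorem finrank_𝔡 : Module.finrank ℝ 𝔡 = 16 := by
  have : Module.finrank ℝ 𝔡 = Module.finrank ℝ (Module.Dual ℝ SO31 × Mink × SO31) := rfl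
  rw [this]
  simp [Subspace.dual_finrank_eq, finrank_so31]

end Dimension
end QEGR
end

open scoped Manifold ContDiff
noncomputable section
namespace QEGR
open Filter Topology TrivialExt
open TopologicalSpace (Opens)

section CovD
variable {k : ℕ} {A : LocalForm 1} {η η' : LocalForm k} {y : E3}

theorem covD_add (hη : DifferentiableAt ℝ η y) (hη' : DifferentiableAt ℝ η' y) :
    covD A (η + η') y = covD A η y + covD A η' y := by
  ext1 w
  have h : ∀ w, fderiv ℝ (fun z => (η + η') z w) y =
      fderiv ℝ (fun z => η z w) y + fderiv ℝ (fun z => η' z w) y := fun w =>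
    fderiv_add (differentiableAt_apply hη w) (differentiableAt_apply hη' w)
  rw [ContinuousAlternatingMap.add_apply, covD_apply A (hη.add hη'), covD_apply A hη,
    covD_apply A hη', ← Finset.sum_add_distrib]
  refine Finset.sum_congr rfl fun i _ => ?_
  rw [h, ← smul_add]
  simp only [add_apply, Pi.add_apply, ContinuousAlternatingMap.add_apply, lie_add]
  congr 1; abel

theorem covD_smul (r : ℝ) (hη : DifferentiableAt ℝ η y) :
    covD A (r • η) y = r • covD A η y := by
  ext1 w
  have h : ∀ w, fderiv ℝ (fun z => (r • η) z w) y = r • fderiv ℝ (fun z => η z w) y := fun w =>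
    fderiv_const_smul (differentiableAt_apply hη w) r
  rw [ContinuousAlternatingMap.smul_apply, covD_apply A (hη.const_smul r), covD_apply A hη,
    Finset.smul_sum]
  refine Finset.sum_congr rfl fun i _ => ?_
  rw [h, smul_comm r]
  simp only [smul_apply, Pi.smul_apply, ContinuousAlternatingMap.smul_apply, lie_smul, smul_add]

end CovD

/-! ### Linear maps from adjoint forms to jets and from multipliers to flows. -/

section Atlas
set_option linter.unusedSectionVars false
variable {E D N ι : Type*} [NormedAddCommGroup E] [NormedSpace ℝ E] [CompleteSpace E]
  [TopologicalSpace D] [ChartedSpace E D] [Group D] [LieGroup 𝓘(ℝ, E) ∞ D]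
  [TopologicalSpace N] [ChartedSpace E3 N] [T2Space N] [CompactSpace N]
  [IsManifold (𝓡 3) ∞ N] [Fintype ι]
  (P : BundleAtlas E D N ι) (Φ : GroupLieAlgebra 𝓘(ℝ, E) D ≃ₗ⁅ℝ⁆ 𝔡)

/-- The vector space of adjoint-valued forms. -/
def adForms (m : ℕ) : Submodule ℝ (ι → LocalForm m) where
  carrier := {η | P.IsAdForm Φ η}
  add_mem' h h' := h.add h'
  zero_mem' := BundleAtlas.isAdForm_zero m
  smul_mem' r _ h := h.smul r

variable {P Φ}

/-- A component of an adjoint-valued form on an open subset of a chart domain. -/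
def component {m : ℕ} (i : ι) (U : Opens E3) (hU : (U : Set E3) ⊆ (P.chart i).target)
    (w : Fin m → E3) : adForms P Φ m →ₗ[ℝ] smoothOn U 𝔡 where
  toFun η := toSmoothOn U (fun z => η.1 i z w) ((η.2.contDiffOn_apply i w).mono hU)
  map_add' η η' := smoothOn_ext fun z hz => by
    have h := fun η : adForms P Φ m =>
      toSmoothOn_apply ((BundleAtlas.IsAdForm.contDiffOn_apply η.2 i w).mono hU) hz
    exact (h _).trans (congrArg₂ (fun X Y : 𝔡 => X + Y) (h η) (h η')).symm
  map_smul' r η := smoothOn_ext fun z hz => by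
    have h := fun η : adForms P Φ m =>
      toSmoothOn_apply ((BundleAtlas.IsAdForm.contDiffOn_apply η.2 i w).mono hU) hz
    exact (h _).trans (congrArg (fun X : 𝔡 => r • X) (h η)).symm

theorem component_apply {m : ℕ} {i : ι} {U : Opens E3} (hU : (U : Set E3) ⊆ (P.chart i).target)
    (w : Fin m → E3) (η : adForms P Φ m) {z : E3} (hz : z ∈ U) :
    (component i U hU w η).1 z = η.1 i z w :=
  toSmoothOn_apply ((BundleAtlas.IsAdForm.contDiffOn_apply η.2 i w).mono hU) hz

theorem partialDeriv_component {m : ℕ} {i : ι} {U : Opens E3}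
    (hU : (U : Set E3) ⊆ (P.chart i).target) (w : Fin m → E3) (η : adForms P Φ m) (c : Fin 3)
    {z : E3} (hz : z ∈ U) :
    (partialDeriv c (component i U hU w η)).1 z = fderiv ℝ (fun z => η.1 i z w) z (e c) := by
  have h : (component i U hU w η).1 =ᶠ[𝓝 z] fun z => η.1 i z w := by
    filter_upwards [U.isOpen.mem_nhds hz] with x hx using component_apply hU w η hx
  rw [partialDeriv_apply c _ hz, h.fderiv_eq]

/-- The pairs of vectors that give the components of two-forms. -/
def pairVec : Fin 3 → Fin 2 → E3 := ![![e 1, e 2], ![e 2, e 0], ![e 0, e 1]]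

variable (P Φ) in
/-- The linear map to jets. -/
def jetMap (k : ℕ) {i : ι} {y : E3} (hy : y ∈ (P.chart i).target) :
    adForms P Φ 1 × adForms P Φ 2 →ₗ[ℝ]
      (∀ m : Fin (k + 1), E3 [×(m : ℕ)]→L[ℝ] (E3 [⋀^Fin 1]→L[ℝ] 𝔡)) ×
      (∀ m : Fin (k + 1), E3 [×(m : ℕ)]→L[ℝ] (E3 [⋀^Fin 2]→L[ℝ] 𝔡)) where
  toFun X := BundleAtlas.jet k i y (X.1.1, X.2.1)
  map_add' X Y := by
    have h : ∀ {m : ℕ} (η : adForms P Φ m) (j : ℕ), ContDiffAt ℝ j (η.1 i) y := fun η j =>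
      ((η.2.1 i).contDiffAt ((P.isOpen_target i).mem_nhds hy)).of_le (by exact_mod_cast le_top)
    exact Prod.ext (funext fun j => iteratedFDeriv_add_apply (h X.1 _) (h Y.1 _))
      (funext fun j => iteratedFDeriv_add_apply (h X.2 _) (h Y.2 _))
  map_smul' r X := by
    have h : ∀ {m : ℕ} (η : adForms P Φ m) (j : ℕ), ContDiffAt ℝ j (η.1 i) y := fun η j =>
      ((η.2.1 i).contDiffAt ((P.isOpen_target i).mem_nhds hy)).of_le (by exact_mod_cast le_top)
    exact Prod.ext (funext fun j => iteratedFDeriv_const_smul_apply (a := r) (h X.1 j))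
      (funext fun j => iteratedFDeriv_const_smul_apply (a := r) (h X.2 j))

/-- Jets of forms are reduced to jets of the three components of each form, so that the counting
takes place in spaces of functions. -/
theorem jetMap_eq_zero_iff {k : ℕ} {i : ι} {y : E3} (hy : y ∈ (P.chart i).target) (U : Opens E3)
    (hU : (U : Set E3) ⊆ (P.chart i).target) (hyU : y ∈ U) (X : adForms P Φ 1 × adForms P Φ 2) :
    jetMap P Φ k hy X = 0 ↔
      (∀ c, component i U hU ![e c] X.1 ∈ vanishing [0, 1, 2] y k) ∧
      ∀ c, component i U hU (pairVec c) X.2 ∈ vanishing [0, 1, 2] y k := by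
  have h0 : jetMap P Φ k hy X = 0 ↔ JetZero k (X.1.1 i) y ∧ JetZero k (X.2.1 i) y := by
    constructor
    · intro h
      exact ⟨fun m hm => congrFun (congrArg Prod.fst h) ⟨m, Nat.lt_succ_of_le hm⟩,
        fun m hm => congrFun (congrArg Prod.snd h) ⟨m, Nat.lt_succ_of_le hm⟩⟩
    · rintro ⟨h, h'⟩
      exact Prod.ext (funext fun m => h m (Nat.le_of_lt_succ m.2))
        (funext fun m => h' m (Nat.le_of_lt_succ m.2))
  have hs : ∀ {m : ℕ} (η : adForms P Φ m), ContDiffAt ℝ ∞ (η.1 i) y := fun η =>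
    (η.2.1 i).contDiffAt ((P.isOpen_target i).mem_nhds hy)
  rw [h0, jetZero_iff_components (fun c : Fin 3 => evalCLM (F := 𝔡) ![e c])
    (fun g hg => oneForm_ext hg) (hs _),
    jetZero_iff_components (fun c : Fin 3 => evalCLM (F := 𝔡) (pairVec c))
    (fun g hg => twoForm_ext (hg 2) (hg 0) (hg 1)) (hs _)]
  refine and_congr (forall_congr' fun c => ?_) (forall_congr' fun c => ?_)
  · exact jetZero_iff_mem_vanishing ((X.1.2.contDiffOn_apply i _).mono hU) hyU
  · exact jetZero_iff_mem_vanishing ((X.2.2.contDiffOn_apply i _).mono hU) hyU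

/-- The linear map from multipliers to infinitesimal symmetries. -/
def flowMap (Λ : ℝ) {φ : Config ι} (hφ : φ ∈ P.phaseSpace Φ) :
    adForms P Φ 0 × adForms P Φ 1 →ₗ[ℝ] adForms P Φ 1 × adForms P Φ 2 where
  toFun l := (⟨(P.flow Λ (l.1.1, l.2.1) φ).1,
      (BundleAtlas.flow_mem_tangent (l := (l.1.1, l.2.1)) Λ ⟨l.1.2, l.2.2⟩ hφ).1⟩,
    ⟨(P.flow Λ (l.1.1, l.2.1) φ).2,
      (BundleAtlas.flow_mem_tangent (l := (l.1.1, l.2.1)) Λ ⟨l.1.2, l.2.2⟩ hφ).2⟩)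
  map_add' l l' := by
    have hd : ∀ {m : ℕ} (η : adForms P Φ m) {i : ι} {y : E3}, y ∈ (P.chart i).target →
      DifferentiableAt ℝ (η.1 i) y := fun η _ _ hy => η.2.differentiableAt hy
    have hl := fun l : adForms P Φ 0 × adForms P Φ 1 =>
      BundleAtlas.flow_mem_tangent (l := (l.1.1, l.2.1)) Λ ⟨l.1.2, l.2.2⟩ hφ
    refine Prod.ext (Subtype.ext (funext fun i => funext fun y => ?_))
      (Subtype.ext (funext fun i => funext fun y => ?_))
    · by_cases hy : y ∈ (P.chart i).target
      · ext1 w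
        refine (BundleAtlas.flow_fst_apply hy w).trans (Eq.trans ?_ (congrArg₂ (fun X Y : 𝔡 => X + Y)
          (BundleAtlas.flow_fst_apply hy w) (BundleAtlas.flow_fst_apply hy w)).symm)
        have h := congrArg (fun α => α w) (covD_add (A := φ.1 i) (hd l.1 hy) (hd l'.1 hy))
        refine (congrArg₂ (fun X Y : 𝔡 => X - Λ • Y) h rfl).trans ?_
        simp only [ContinuousAlternatingMap.add_apply]
        change _ - Λ • (l.2.1 i y w + l'.2.1 i y w) = _
        module
      · refine ((hl _).1.2.1 i y hy).trans ?_
        exact ((congrArg₂ (· + ·) ((hl l).1.2.1 i y hy) ((hl l').1.2.1 i y hy)).trans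
          (add_zero 0)).symm
    · by_cases hy : y ∈ (P.chart i).target
      · ext1 w
        refine (BundleAtlas.flow_snd_apply (Λ := Λ) hy w).trans (Eq.trans ?_ (congrArg₂ (fun X Y : 𝔡 => X + Y)
          (BundleAtlas.flow_snd_apply (Λ := Λ) hy w) (BundleAtlas.flow_snd_apply (Λ := Λ) hy w)).symm)
        have h := congrArg (fun α => α w) (covD_add (A := φ.1 i) (hd l.2 hy) (hd l'.2 hy))
        refine (congrArg₂ (fun X Y : 𝔡 => X + Y) rfl h).trans ?_
        simp only [ContinuousAlternatingMap.add_apply]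
        change ⁅_, l.1.1 i y ![] + l'.1.1 i y ![]⁆ + _ = _
        rw [lie_add]
        abel
      · refine ((hl _).2.2.1 i y hy).trans ?_
        exact ((congrArg₂ (· + ·) ((hl l).2.2.1 i y hy) ((hl l').2.2.1 i y hy)).trans
          (add_zero 0)).symm
  map_smul' r l := by
    have hd : ∀ {m : ℕ} (η : adForms P Φ m) {i : ι} {y : E3}, y ∈ (P.chart i).target →
      DifferentiableAt ℝ (η.1 i) y := fun η _ _ hy => η.2.differentiableAt hy
    have hl := fun l : adForms P Φ 0 × adForms P Φ 1 =>
      BundleAtlas.flow_mem_tangent (l := (l.1.1, l.2.1)) Λ ⟨l.1.2, l.2.2⟩ hφ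
    refine Prod.ext (Subtype.ext (funext fun i => funext fun y => ?_))
      (Subtype.ext (funext fun i => funext fun y => ?_))
    · by_cases hy : y ∈ (P.chart i).target
      · ext1 w
        refine (BundleAtlas.flow_fst_apply hy w).trans (Eq.trans ?_ (congrArg (fun X : 𝔡 => r • X)
          (BundleAtlas.flow_fst_apply hy w)).symm)
        have h := congrArg (fun α => α w) (covD_smul (A := φ.1 i) r (hd l.1 hy))
        refine (congrArg₂ (fun X Y : 𝔡 => X - Λ • Y) h rfl).trans ?_
        simp only [ContinuousAlternatingMap.smul_apply]
        change _ - Λ • (r • l.2.1 i y w) = _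
        module
      · refine ((hl _).1.2.1 i y hy).trans ?_
        exact ((congrArg (r • ·) ((hl l).1.2.1 i y hy)).trans (smul_zero r)).symm
    · by_cases hy : y ∈ (P.chart i).target
      · ext1 w
        refine (BundleAtlas.flow_snd_apply (Λ := Λ) hy w).trans (Eq.trans ?_ (congrArg (fun X : 𝔡 => r • X)
          (BundleAtlas.flow_snd_apply (Λ := Λ) hy w)).symm)
        have h := congrArg (fun α => α w) (covD_smul (A := φ.1 i) r (hd l.2 hy))
        refine (congrArg₂ (fun X Y : 𝔡 => X + Y) rfl h).trans ?_
        simp only [ContinuousAlternatingMap.smul_apply]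
        change ⁅_, r • l.1.1 i y ![]⁆ + _ = _
        rw [lie_smul, smul_add]
      · refine ((hl _).2.2.1 i y hy).trans ?_
        exact ((congrArg (r • ·) ((hl l).2.2.1 i y hy)).trans (smul_zero r)).symm

end Atlas
end QEGR
end

open scoped Manifold ContDiff
noncomputable section
namespace QEGR
open Filter Topology TrivialExt
open TopologicalSpace (Opens)

theorem eq_of_add_sub_add_add_eq_zero {M : Type*} [AddCommGroup M] {p q r s t : M}
    (h : p + q - (r + s) + t = 0) : p = r + s - q - t := by
  rw [← sub_eq_zero, ← h]; abel

theorem eq_neg_of_add_add_sub_eq_zero {M : Type*} [AddCommGroup M] {p q r s t : M}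
    (h : p + q + r + s - t = 0) : p = -(q + r + s - t) := by
  rw [← sub_eq_zero, ← h]; abel

/-! ### Flows and linearised field equations in components, solved for one derivative. -/

section Atlas
set_option linter.unusedSectionVars false
variable {E D N ι : Type*} [NormedAddCommGroup E] [NormedSpace ℝ E] [CompleteSpace E]
  [TopologicalSpace D] [ChartedSpace E D] [Group D] [LieGroup 𝓘(ℝ, E) ∞ D]
  [TopologicalSpace N] [ChartedSpace E3 N] [T2Space N] [CompactSpace N]
  [IsManifold (𝓡 3) ∞ N] [Fintype ι]
  {P : BundleAtlas E D N ι} {Φ : GroupLieAlgebra 𝓘(ℝ, E) D ≃ₗ⁅ℝ⁆ 𝔡}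
  {Λ : ℝ} {φ : Config ι} (hφ : φ ∈ P.phaseSpace Φ) {i : ι} {U : Opens E3}
  (hU : (U : Set E3) ⊆ (P.chart i).target)

/-- A component of the connection on an open subset of a chart domain. -/
def connComponent {A : ι → LocalForm 1} (hA : P.IsConnection Φ A) (i : ι) (U : Opens E3)
    (hU : (U : Set E3) ⊆ (P.chart i).target) (c : Fin 3) : smoothOn U 𝔡 :=
  toSmoothOn U (fun z => A i z ![e c]) ((contDiffOn_form_iff.1 (hA.1 i) ![e c]).mono hU)

theorem connComponent_apply {A : ι → LocalForm 1} (hA : P.IsConnection Φ A) (c : Fin 3) {z : E3}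
    (hz : z ∈ U) : (connComponent hA i U hU c).1 z = A i z ![e c] := toSmoothOn_apply _ hz

/-- The covariant derivative of a component of a form. -/
theorem nabla_component {m : ℕ} {A : ι → LocalForm 1} (hA : P.IsConnection Φ A)
    (η : adForms P Φ m) (w : Fin m → E3) (c : Fin 3) {z : E3} (hz : z ∈ U) :
    (partialDeriv c (component i U hU w η) +
      lieSmooth (connComponent hA i U hU c) (component i U hU w η)).1 z =
    nabla (A i) (e c) (fun z => η.1 i z w) z := by
  refine (congrArg₂ (fun X Y : 𝔡 => X + Y) (partialDeriv_component hU w η c hz)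
    (congrArg₂ (fun X Y : 𝔡 => ⁅X, Y⁆) (connComponent_apply hU hA c hz)
      (component_apply hU w η hz))).trans ?_
  rfl

/-- The derivatives of the function part of a multiplier in terms of its flow. -/
theorem partialDeriv_multiplier_fst (l : adForms P Φ 0 × adForms P Φ 1) (c : Fin 3) :
    partialDeriv c (component i U hU ![] l.1) =
      component i U hU ![e c] (flowMap Λ hφ l).1 -
        lieSmooth (connComponent hφ.1 i U hU c) (component i U hU ![] l.1) +
        Λ • component i U hU ![e c] l.2 := by
  have h : component i U hU ![e c] (flowMap Λ hφ l).1 =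
      partialDeriv c (component i U hU ![] l.1) +
        lieSmooth (connComponent hφ.1 i U hU c) (component i U hU ![] l.1) -
        Λ • component i U hU ![e c] l.2 := by
    refine smoothOn_ext fun z hz => ?_
    refine Eq.trans ?_ (congrArg₂ (fun X Y : 𝔡 => X - Λ • Y)
      (nabla_component hU hφ.1 l.1 ![] c hz) (component_apply hU ![e c] l.2 hz)).symm
    rw [component_apply hU _ _ hz, ← covD_zero (l.1.2.differentiableAt (hU hz))]
    exact BundleAtlas.flow_fst_apply (Λ := Λ) (l := (l.1.1, l.2.1)) (hU hz) ![e c]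
  rw [h]; abel

/-- The derivatives of the one-form part of a multiplier in terms of its flow. -/
theorem partialDeriv_multiplier_snd (l : adForms P Φ 0 × adForms P Φ 1) (c d : Fin 3) :
    partialDeriv c (component i U hU ![e d] l.2) =
      component i U hU ![e c, e d] (flowMap Λ hφ l).2 -
        lieSmooth (component i U hU ![e c, e d] ⟨φ.2, hφ.2⟩) (component i U hU ![] l.1) -
        lieSmooth (connComponent hφ.1 i U hU c) (component i U hU ![e d] l.2) +
        (partialDeriv d (component i U hU ![e c] l.2) +
        lieSmooth (connComponent hφ.1 i U hU d) (component i U hU ![e c] l.2)) := by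
  have h : component i U hU ![e c, e d] (flowMap Λ hφ l).2 =
      lieSmooth (component i U hU ![e c, e d] ⟨φ.2, hφ.2⟩) (component i U hU ![] l.1) +
      ((partialDeriv c (component i U hU ![e d] l.2) +
        lieSmooth (connComponent hφ.1 i U hU c) (component i U hU ![e d] l.2)) -
      (partialDeriv d (component i U hU ![e c] l.2) +
        lieSmooth (connComponent hφ.1 i U hU d) (component i U hU ![e c] l.2))) := by
    refine smoothOn_ext fun z hz => ?_
    have h1 := congrArg₂ (fun X Y : 𝔡 => ⁅X, Y⁆)
      (component_apply hU ![e c, e d] (⟨φ.2, hφ.2⟩ : adForms P Φ 2) hz)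
      (component_apply hU ![] l.1 hz)
    have h2 := congrArg₂ (fun X Y : 𝔡 => X - Y) (nabla_component hU hφ.1 l.2 ![e d] c hz)
      (nabla_component hU hφ.1 l.2 ![e c] d hz)
    refine Eq.trans ?_ (congrArg₂ (fun X Y : 𝔡 => X + Y) h1 h2).symm
    rw [component_apply hU _ _ hz]
    simp only []
    rw [← covD_one (l.2.2.differentiableAt (hU hz))]
    exact BundleAtlas.flow_snd_apply (Λ := Λ) (l := (l.1.1, l.2.1)) (hU hz) ![e c, e d]
  rw [h]; abel

section Onshell
variable (hs : IsSolution P Λ φ)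
include hs

/-- The linearised curvature equation for the components of a flow. -/
theorem partialDeriv_flow_fst (l : adForms P Φ 0 × adForms P Φ 1) (c d : Fin 3) :
    partialDeriv c (component i U hU ![e d] (flowMap Λ hφ l).1) =
      partialDeriv d (component i U hU ![e c] (flowMap Λ hφ l).1) +
      lieSmooth (connComponent hφ.1 i U hU d) (component i U hU ![e c] (flowMap Λ hφ l).1) -
      lieSmooth (connComponent hφ.1 i U hU c) (component i U hU ![e d] (flowMap Λ hφ l).1) -
      Λ • component i U hU ![e c, e d] (flowMap Λ hφ l).2 := by
  have h : (partialDeriv c (component i U hU ![e d] (flowMap Λ hφ l).1) +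
      lieSmooth (connComponent hφ.1 i U hU c) (component i U hU ![e d] (flowMap Λ hφ l).1)) -
      (partialDeriv d (component i U hU ![e c] (flowMap Λ hφ l).1) +
      lieSmooth (connComponent hφ.1 i U hU d) (component i U hU ![e c] (flowMap Λ hφ l).1)) +
      Λ • component i U hU ![e c, e d] (flowMap Λ hφ l).2 = 0 := by
    refine smoothOn_ext fun z hz => ?_
    have h2 := congrArg₂ (fun X Y : 𝔡 => X - Y)
      (nabla_component hU hφ.1 (flowMap Λ hφ l).1 ![e d] c hz)
      (nabla_component hU hφ.1 (flowMap Λ hφ l).1 ![e c] d hz)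
    refine (congrArg₂ (fun X Y : 𝔡 => X + Λ • Y) h2
      (component_apply hU ![e c, e d] (flowMap Λ hφ l).2 hz)).trans ?_
    have h3 := covD_flow_fst (l := (l.1.1, l.2.1)) ⟨l.1.2, l.2.2⟩ hφ hs (hU hz) (e c) (e d)
    rw [covD_one ((BundleAtlas.flow_mem_tangent (l := (l.1.1, l.2.1)) Λ ⟨l.1.2, l.2.2⟩ hφ).1.differentiableAt
      (hU hz))] at h3
    exact h3
  exact eq_of_add_sub_add_add_eq_zero h

/-- The linearised Gauss equation for the components of a flow. -/
theorem partialDeriv_flow_snd (l : adForms P Φ 0 × adForms P Φ 1) :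
    partialDeriv 0 (component i U hU ![e 1, e 2] (flowMap Λ hφ l).2) =
      - (lieSmooth (connComponent hφ.1 i U hU 0)
          (component i U hU ![e 1, e 2] (flowMap Λ hφ l).2) +
      (partialDeriv 1 (component i U hU ![e 2, e 0] (flowMap Λ hφ l).2) +
        lieSmooth (connComponent hφ.1 i U hU 1)
          (component i U hU ![e 2, e 0] (flowMap Λ hφ l).2)) +
      (partialDeriv 2 (component i U hU ![e 0, e 1] (flowMap Λ hφ l).2) +
        lieSmooth (connComponent hφ.1 i U hU 2)
          (component i U hU ![e 0, e 1] (flowMap Λ hφ l).2)) -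
      cyc fun a b c => lieSmooth (component i U hU ![e a, e b] ⟨φ.2, hφ.2⟩)
        (component i U hU ![e c] (flowMap Λ hφ l).1)) := by
  have h : (partialDeriv 0 (component i U hU ![e 1, e 2] (flowMap Λ hφ l).2) +
        lieSmooth (connComponent hφ.1 i U hU 0)
          (component i U hU ![e 1, e 2] (flowMap Λ hφ l).2)) +
      (partialDeriv 1 (component i U hU ![e 2, e 0] (flowMap Λ hφ l).2) +
        lieSmooth (connComponent hφ.1 i U hU 1)
          (component i U hU ![e 2, e 0] (flowMap Λ hφ l).2)) +
      (partialDeriv 2 (component i U hU ![e 0, e 1] (flowMap Λ hφ l).2) +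
        lieSmooth (connComponent hφ.1 i U hU 2)
          (component i U hU ![e 0, e 1] (flowMap Λ hφ l).2)) -
      (cyc fun a b c => lieSmooth (component i U hU ![e a, e b] ⟨φ.2, hφ.2⟩)
        (component i U hU ![e c] (flowMap Λ hφ l).1)) = 0 := by
    refine smoothOn_ext fun z hz => ?_
    have hn := fun (a : Fin 3) w => nabla_component hU hφ.1 (flowMap Λ hφ l).2 w a hz
    have hc : ∀ a b c, (lieSmooth (component i U hU ![e a, e b] (⟨φ.2, hφ.2⟩ : adForms P Φ 2))
        (component i U hU ![e c] (flowMap Λ hφ l).1)).1 z =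
        ⁅φ.2 i z ![e a, e b], (P.flow Λ (l.1.1, l.2.1) φ).1 i z ![e c]⁆ := fun a b c =>
      congrArg₂ (fun X Y : 𝔡 => ⁅X, Y⁆)
        (component_apply hU ![e a, e b] (⟨φ.2, hφ.2⟩ : adForms P Φ 2) hz)
        (component_apply hU ![e c] (flowMap Λ hφ l).1 hz)
    have h1 := congrArg₂ (fun X Y : 𝔡 => X + Y) (congrArg₂ (fun X Y : 𝔡 => X + Y)
      (hn 0 ![e 1, e 2]) (hn 1 ![e 2, e 0])) (hn 2 ![e 0, e 1])
    have h2 := congrArg₂ (fun X Y : 𝔡 => X + Y) (congrArg₂ (fun X Y : 𝔡 => X + Y)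
      (hc 0 1 2) (hc 1 2 0)) (hc 2 0 1)
    refine (congrArg₂ (fun X Y : 𝔡 => X - Y) h1 h2).trans ?_
    have h3 := covD_flow_snd (l := (l.1.1, l.2.1)) ⟨l.1.2, l.2.2⟩ hφ hs (hU hz)
    rw [covD_two ((BundleAtlas.flow_mem_tangent (l := (l.1.1, l.2.1)) Λ ⟨l.1.2, l.2.2⟩ hφ).2.differentiableAt
      (hU hz))] at h3
    have h4 : (fun z => (flowMap Λ hφ l).2.1 i z ![e 0, e 2]) =
        fun z => (-1 : ℝ) • (flowMap Λ hφ l).2.1 i z ![e 2, e 0] := by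
      ext1 z
      rw [neg_one_smul]
      exact form_swap _ _ _
    have h5 := nabla_smul (A := φ.1 i) (-1) (e 1)
      ((flowMap Λ hφ l).2.2.differentiableAt_apply (hU hz) ![e 2, e 0])
    have h6 : nabla (φ.1 i) (e 1) (fun z => (P.flow Λ (l.1.1, l.2.1) φ).2 i z ![e 0, e 2]) z =
        - nabla (φ.1 i) (e 1) (fun z => (flowMap Λ hφ l).2.1 i z ![e 2, e 0]) z := by
      rw [← neg_one_smul ℝ, ← h5, ← h4]; rfl
    rw [h6, sub_neg_eq_add] at h3
    have h7 : ∀ a b c, ⁅(P.flow Λ (l.1.1, l.2.1) φ).1 i z ![e c], φ.2 i z ![e a, e b]⁆ =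
        - ⁅φ.2 i z ![e a, e b], (P.flow Λ (l.1.1, l.2.1) φ).1 i z ![e c]⁆ := fun a b c =>
      (lie_skew _ _).symm
    simp only [cyc, h7] at h3
    refine Eq.trans ?_ h3
    change _ = nabla (φ.1 i) (e 0) (fun z => (flowMap Λ hφ l).2.1 i z ![e 1, e 2]) z + _ +
      nabla (φ.1 i) (e 2) (fun z => (flowMap Λ hφ l).2.1 i z ![e 0, e 1]) z + _
    abel
  exact eq_neg_of_add_add_sub_eq_zero h

end Onshell
end Atlas
end QEGR
end

open scoped Manifold ContDiff
noncomputable section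
namespace QEGR
open Filter Topology TrivialExt
open TopologicalSpace (Opens)

section Vanishing
variable {U : Opens E3} {y : E3} {k : ℕ} {f : smoothOn U 𝔡}

theorem partialDeriv_mem_vanishing (h : f ∈ vanishing [0, 1, 2] y (k + 1)) (c : Fin 3) :
    partialDeriv c f ∈ vanishing [0, 1, 2] y k :=
  (mem_vanishing_succ.1 h).2 c (by fin_cases c <;> decide)

end Vanishing

/-! ### Propagation of jets off a surface and upper bounds on dimensions. -/

section Atlas
set_option linter.unusedSectionVars false
variable {E D N ι : Type*} [NormedAddCommGroup E] [NormedSpace ℝ E] [CompleteSpace E]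
  [TopologicalSpace D] [ChartedSpace E D] [Group D] [LieGroup 𝓘(ℝ, E) ∞ D]
  [TopologicalSpace N] [ChartedSpace E3 N] [T2Space N] [CompactSpace N]
  [IsManifold (𝓡 3) ∞ N] [Fintype ι]
  {P : BundleAtlas E D N ι} {Φ : GroupLieAlgebra 𝓘(ℝ, E) D ≃ₗ⁅ℝ⁆ 𝔡}
  {Λ : ℝ} {φ : Config ι} (hφ : φ ∈ P.phaseSpace Φ) {i : ι} {U : Opens E3}
  (hU : (U : Set E3) ⊆ (P.chart i).target) {y : E3} {k : ℕ}

theorem component_swap (η : adForms P Φ 2) (v w : E3) :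
    component i U hU ![v, w] η = -component i U hU ![w, v] η := by
  refine smoothOn_ext fun z hz => ?_
  refine ((component_apply hU _ η hz).trans (form_swap _ _ _)).trans ?_
  exact congrArg (fun X : 𝔡 => -X) (component_apply hU ![w, v] η hz).symm

/-- On shell, the jet of a flow is determined by three components and by the restriction of the
other three to a surface. -/
theorem flow_mem_vanishing (hs : IsSolution P Λ φ) (l : adForms P Φ 0 × adForms P Φ 1)
    (h0 : component i U hU ![e 0] (flowMap Λ hφ l).1 ∈ vanishing [0, 1, 2] y k)
    (h20 : component i U hU ![e 2, e 0] (flowMap Λ hφ l).2 ∈ vanishing [0, 1, 2] y k)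
    (h01 : component i U hU ![e 0, e 1] (flowMap Λ hφ l).2 ∈ vanishing [0, 1, 2] y k)
    (h1 : component i U hU ![e 1] (flowMap Λ hφ l).1 ∈ vanishing [1, 2] y k)
    (h2 : component i U hU ![e 2] (flowMap Λ hφ l).1 ∈ vanishing [1, 2] y k)
    (h12 : component i U hU ![e 1, e 2] (flowMap Λ hφ l).2 ∈ vanishing [1, 2] y k) :
    component i U hU ![e 1] (flowMap Λ hφ l).1 ∈ vanishing [0, 1, 2] y k ∧
    component i U hU ![e 2] (flowMap Λ hφ l).1 ∈ vanishing [0, 1, 2] y k ∧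
    component i U hU ![e 1, e 2] (flowMap Λ hφ l).2 ∈ vanishing [0, 1, 2] y k := by
  suffices h : ∀ m ≤ k,
      component i U hU ![e 1] (flowMap Λ hφ l).1 ∈ vanishing [0, 1, 2] y m ∧
      component i U hU ![e 2] (flowMap Λ hφ l).1 ∈ vanishing [0, 1, 2] y m ∧
      component i U hU ![e 1, e 2] (flowMap Λ hφ l).2 ∈ vanishing [0, 1, 2] y m from h k le_rfl
  intro m hm
  induction m with
  | zero =>
    exact ⟨eval_eq_zero_of_mem_vanishing h1, eval_eq_zero_of_mem_vanishing h2,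
      eval_eq_zero_of_mem_vanishing h12⟩
  | succ m ih =>
    obtain ⟨i1, i2, i12⟩ := ih (by omega)
    have j0 := mem_vanishing_of_le hm h0
    have j20 := mem_vanishing_of_le hm h20
    have j01 := mem_vanishing_of_le hm h01
    have i0 := mem_vanishing_of_succ j0
    have i20 := mem_vanishing_of_succ j20
    have i01 := mem_vanishing_of_succ j01
    -- Only derivatives along `e 0` are missing. The linearised equations express them through first
    -- derivatives of the three controlled components and through undifferentiated components, which
    -- vanish to order `m` by induction.
    refine ⟨mem_vanishing_cons ?_ (mem_vanishing_of_le hm h1),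
      mem_vanishing_cons ?_ (mem_vanishing_of_le hm h2),
      mem_vanishing_cons ?_ (mem_vanishing_of_le hm h12)⟩
    · rw [partialDeriv_flow_fst hφ hU hs l 0 1]
      exact sub_mem (sub_mem (add_mem (partialDeriv_mem_vanishing j0 1)
        (lieSmooth_mem_vanishing _ i0)) (lieSmooth_mem_vanishing _ i1))
        (Submodule.smul_mem _ _ i01)
    · rw [partialDeriv_flow_fst hφ hU hs l 0 2, component_swap hU _ (e 0) (e 2)]
      exact sub_mem (sub_mem (add_mem (partialDeriv_mem_vanishing j0 2)
        (lieSmooth_mem_vanishing _ i0)) (lieSmooth_mem_vanishing _ i2))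
        (Submodule.smul_mem _ _ (neg_mem i20))
    · rw [partialDeriv_flow_snd hφ hU hs l]
      exact neg_mem (sub_mem (add_mem (add_mem (lieSmooth_mem_vanishing _ i12)
        (add_mem (partialDeriv_mem_vanishing j20 1) (lieSmooth_mem_vanishing _ i20)))
        (add_mem (partialDeriv_mem_vanishing j01 2) (lieSmooth_mem_vanishing _ i01)))
        (add_mem (add_mem (lieSmooth_mem_vanishing _ i2) (lieSmooth_mem_vanishing _ i0))
          (lieSmooth_mem_vanishing _ i1)))

/-- A multiplier whose one-form part has no component in one direction is determined to a given
order by the jet of its flow and by its restriction to a surface. -/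
theorem multiplier_mem_vanishing (l : adForms P Φ 0 × adForms P Φ 1)
    (h1 : ∀ c, component i U hU ![e c] (flowMap Λ hφ l).1 ∈ vanishing [0, 1, 2] y k)
    (h2 : ∀ c, component i U hU (pairVec c) (flowMap Λ hφ l).2 ∈ vanishing [0, 1, 2] y k)
    (hl0 : component i U hU ![e 0] l.2 = 0)
    (ha : component i U hU ![] l.1 ∈ vanishing [1, 2] y (k + 1))
    (hl1 : component i U hU ![e 1] l.2 ∈ vanishing [1, 2] y (k + 1))
    (hl2 : component i U hU ![e 2] l.2 ∈ vanishing [1, 2] y (k + 1)) :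
    component i U hU ![] l.1 ∈ vanishing [0, 1, 2] y (k + 1) ∧
    component i U hU ![e 1] l.2 ∈ vanishing [0, 1, 2] y (k + 1) ∧
    component i U hU ![e 2] l.2 ∈ vanishing [0, 1, 2] y (k + 1) := by
  suffices h : ∀ m ≤ k + 1,
      component i U hU ![] l.1 ∈ vanishing [0, 1, 2] y m ∧
      component i U hU ![e 1] l.2 ∈ vanishing [0, 1, 2] y m ∧
      component i U hU ![e 2] l.2 ∈ vanishing [0, 1, 2] y m from h _ le_rfl
  intro m hm
  induction m with
  | zero =>
    exact ⟨eval_eq_zero_of_mem_vanishing ha, eval_eq_zero_of_mem_vanishing hl1,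
      eval_eq_zero_of_mem_vanishing hl2⟩
  | succ m ih =>
    obtain ⟨ia, i1, i2⟩ := ih (by omega)
    have i0 : component i U hU ![e 0] l.2 ∈ vanishing [0, 1, 2] y (m + 1) := by
      rw [hl0]; exact zero_mem _
    -- The flow contains one derivative of the multiplier, so order `m + 1` of the multiplier uses
    -- order `m` of the flow; hence the multiplier is controlled up to order `k + 1`.
    have hmk : m ≤ k := by omega
    refine ⟨mem_vanishing_cons ?_ (mem_vanishing_of_le hm ha),
      mem_vanishing_cons ?_ (mem_vanishing_of_le hm hl1),
      mem_vanishing_cons ?_ (mem_vanishing_of_le hm hl2)⟩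
    · rw [partialDeriv_multiplier_fst (Λ := Λ) hφ hU l 0]
      exact add_mem (sub_mem (mem_vanishing_of_le hmk (h1 0)) (lieSmooth_mem_vanishing _ ia))
        (Submodule.smul_mem _ _ (mem_vanishing_of_succ i0))
    · rw [partialDeriv_multiplier_snd (Λ := Λ) hφ hU l 0 1]
      exact add_mem (sub_mem (sub_mem (mem_vanishing_of_le hmk (h2 2))
        (lieSmooth_mem_vanishing _ ia)) (lieSmooth_mem_vanishing _ i1))
        (add_mem (partialDeriv_mem_vanishing i0 1)
          (lieSmooth_mem_vanishing _ (mem_vanishing_of_succ i0)))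
    · rw [partialDeriv_multiplier_snd (Λ := Λ) hφ hU l 0 2,
        component_swap hU (flowMap Λ hφ l).2 (e 0) (e 2)]
      exact add_mem (sub_mem (sub_mem (neg_mem (mem_vanishing_of_le hmk (h2 1)))
        (lieSmooth_mem_vanishing _ ia)) (lieSmooth_mem_vanishing _ i2))
        (add_mem (partialDeriv_mem_vanishing i0 2)
          (lieSmooth_mem_vanishing _ (mem_vanishing_of_succ i0)))

/-- Six components with values in a space of dimension `16`. -/
theorem finrank_jetMap_le (hy : y ∈ (P.chart i).target) :
    Module.Finite ℝ (LinearMap.range (jetMap P Φ k hy)) ∧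
    Module.finrank ℝ (LinearMap.range (jetMap P Φ k hy)) ≤ 96 * (k + 3).choose 3 := by
  let U : Opens E3 := ⟨(P.chart i).target, P.isOpen_target i⟩
  have hU : (U : Set E3) ⊆ (P.chart i).target := subset_rfl
  have hV := codimLE_vanishing (U := U) (F := 𝔡) [0, 1, 2] y k
  have h1 := CodimLE.iInf_fin fun c : Fin 3 =>
    hV.comap (component (Φ := Φ) i U hU ![e c] ∘ₗ LinearMap.fst ℝ _ (adForms P Φ 2))
  have h2 := CodimLE.iInf_fin fun c : Fin 3 =>
    hV.comap (component (Φ := Φ) i U hU (pairVec c) ∘ₗ LinearMap.snd ℝ (adForms P Φ 1) _)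
  have h3 : CodimLE (LinearMap.ker (jetMap P Φ k hy)) _ := (h1.inf h2).mono fun X hX => by
    rw [LinearMap.mem_ker, jetMap_eq_zero_iff hy U hU hy]
    exact ⟨fun c => (Submodule.mem_iInf _).1 hX.1 c, fun c => (Submodule.mem_iInf _).1 hX.2 c⟩
  refine ⟨h3.finrank_range_le.1, h3.finrank_range_le.2.trans_eq ?_⟩
  have h4 : ([0, 1, 2] : List (Fin 3)).length + k = k + 3 := Nat.add_comm 3 k
  rw [h4, Nat.choose_symm_add, finrank_𝔡]
  ring

/-- Three components are counted with full jets, `3 · 16 = 48`, and three only with jets along the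
surface directions `1, 2`; the latter is the lower-order term. -/
theorem finrank_jetMap_flow_le (hs : IsSolution P Λ φ) (hy : y ∈ (P.chart i).target) :
    Module.Finite ℝ (LinearMap.range (jetMap P Φ k hy ∘ₗ flowMap Λ hφ)) ∧
    Module.finrank ℝ (LinearMap.range (jetMap P Φ k hy ∘ₗ flowMap Λ hφ)) ≤
      48 * (k + 3).choose 3 + 48 * (k + 2).choose 2 := by
  let U : Opens E3 := ⟨(P.chart i).target, P.isOpen_target i⟩
  have hU : (U : Set E3) ⊆ (P.chart i).target := subset_rfl
  have hV := codimLE_vanishing (U := U) (F := 𝔡) [0, 1, 2] y k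
  have hV' := codimLE_vanishing (U := U) (F := 𝔡) [1, 2] y k
  let f1 := fun c : Fin 3 => component (Φ := Φ) i U hU ![e c] ∘ₗ LinearMap.fst ℝ _ (adForms P Φ 2)
    ∘ₗ flowMap Λ hφ
  let f2 := fun w : Fin 2 → E3 => component (Φ := Φ) i U hU w ∘ₗ
    LinearMap.snd ℝ (adForms P Φ 1) _ ∘ₗ flowMap Λ hφ
  have h1 := (((((hV.comap (f1 0)).inf (hV.comap (f2 ![e 2, e 0]))).inf
    (hV.comap (f2 ![e 0, e 1]))).inf (hV'.comap (f1 1))).inf (hV'.comap (f1 2))).inf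
    (hV'.comap (f2 ![e 1, e 2]))
  have h3 : CodimLE (LinearMap.ker (jetMap P Φ k hy ∘ₗ flowMap Λ hφ)) _ := h1.mono fun l hl => by
    obtain ⟨⟨⟨⟨⟨h0, h20⟩, h01⟩, h1⟩, h2⟩, h12⟩ := hl
    obtain ⟨i1, i2, i12⟩ := flow_mem_vanishing hφ hU hs l h0 h20 h01 h1 h2 h12
    refine (jetMap_eq_zero_iff hy U hU hy _).2 ⟨fun c => ?_, fun c => ?_⟩
    · fin_cases c
      exacts [h0, i1, i2]
    · fin_cases c
      exacts [i12, h20, h01]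
  refine ⟨h3.finrank_range_le.1, h3.finrank_range_le.2.trans_eq ?_⟩
  have h4 : ([0, 1, 2] : List (Fin 3)).length + k = k + 3 := Nat.add_comm 3 k
  have h5 : ([1, 2] : List (Fin 3)).length + k = k + 2 := Nat.add_comm 2 k
  rw [h4, h5, Nat.choose_symm_add, Nat.choose_symm_add, finrank_𝔡]
  ring

end Atlas
end QEGR
end

open scoped Manifold ContDiff
noncomputable section
namespace QEGR
open Filter Topology TrivialExt
open TopologicalSpace (Opens)

/-! ### Polynomial test fields and lower bounds on dimensions. -/

section Atlas
set_option linter.unusedSectionVars false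
variable {E D N ι : Type*} [NormedAddCommGroup E] [NormedSpace ℝ E] [CompleteSpace E]
  [TopologicalSpace D] [ChartedSpace E D] [Group D] [LieGroup 𝓘(ℝ, E) ∞ D]
  [TopologicalSpace N] [ChartedSpace E3 N] [T2Space N] [CompactSpace N]
  [IsManifold (𝓡 3) ∞ N] [Fintype ι]
  {P : BundleAtlas E D N ι} {Φ : GroupLieAlgebra 𝓘(ℝ, E) D ≃ₗ⁅ℝ⁆ 𝔡}
  {i : ι} {y : E3}

/-- The coefficients of `𝔡`-valued polynomials of degree at most `n`. -/
abbrev Coeffs (n : ℕ) : Type := Fin (Module.finrank ℝ 𝔡) → exponents n → ℝ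

theorem finrank_pi_coeffs (r n : ℕ) :
    Module.finrank ℝ (Fin r → Coeffs n) = r * (16 * (n + 3).choose 3) := by
  have h : Module.finrank ℝ (Coeffs n) = 16 * (n + 3).choose 3 := by
    rw [finrank_coeffs, finrank_𝔡]
  rw [Module.finrank_pi_fintype]
  simp only [h, Finset.sum_const, Finset.card_univ, Fintype.card_fin, smul_eq_mul]

theorem globalForm_add {m : ℕ} (η η' : LocalForm m) :
    P.globalForm Φ i (η + η') = P.globalForm Φ i η + P.globalForm Φ i η' := by
  funext j z
  by_cases hz : z ∈ P.overlap i j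
  · ext1 w
    refine (BundleAtlas.globalForm_apply hz w).trans (Eq.trans ?_
      (congrArg₂ (fun X Y : 𝔡 => X + Y) (BundleAtlas.globalForm_apply hz w)
        (BundleAtlas.globalForm_apply hz w)).symm)
    exact map_add (adMap Φ _) _ _
  · simp [BundleAtlas.globalForm, if_neg hz]

theorem globalForm_smul {m : ℕ} (r : ℝ) (η : LocalForm m) :
    P.globalForm Φ i (r • η) = r • P.globalForm Φ i η := by
  funext j z
  by_cases hz : z ∈ P.overlap i j
  · ext1 w
    refine (BundleAtlas.globalForm_apply hz w).trans (Eq.trans ?_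
      (congrArg (fun X : 𝔡 => r • X) (BundleAtlas.globalForm_apply hz w)).symm)
    exact map_smul (adMap Φ _) _ _
  · simp [BundleAtlas.globalForm, if_neg hz]

/-- Near a given point, all polynomial forms are restrictions of adjoint-valued forms. -/
theorem exists_polynomial_adForms (P : BundleAtlas E D N ι)
    (Φ : GroupLieAlgebra 𝓘(ℝ, E) D ≃ₗ⁅ℝ⁆ 𝔡) (hy : y ∈ (P.chart i).target) :
    ∃ (U : Opens E3) (hU : (U : Set E3) ⊆ (P.chart i).target), y ∈ U ∧
      ∀ (n m r : ℕ) (T : (Fin r → 𝔡) →L[ℝ] E3 [⋀^Fin m]→L[ℝ] 𝔡),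
        ∃ g : (Fin r → Coeffs n) →ₗ[ℝ] adForms P Φ m, ∀ q w z, z ∈ U →
          (component i U hU w (g q)).1 z = T (fun c => polyMap 𝔡 y n (q c) z) w := by
  obtain ⟨R, hR, hRt⟩ := Metric.isOpen_iff.1 (P.isOpen_target i) y hy
  -- The bump function equals `1` on the ball of radius `R / 4`, which becomes `U`, and its support
  -- lies in the ball of radius `R` inside the chart.
  let χ : ContDiffBump y := ⟨R / 4, R / 2, by positivity, by linarith⟩
  have hχ : tsupport χ ⊆ (P.chart i).target := by
    rw [χ.tsupport_eq]
    exact (Metric.closedBall_subset_ball (by change R / 2 < R; linarith)).trans hRt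
  have hU : Metric.ball y (R / 4) ⊆ (P.chart i).target :=
    (Metric.ball_subset_ball (by linarith)).trans hRt
  refine ⟨⟨Metric.ball y (R / 4), Metric.isOpen_ball⟩, hU,
    Metric.mem_ball_self (by positivity), fun n m r T => ?_⟩
  let S : (Fin r → Coeffs n) → LocalForm m := fun q z =>
    χ z • T (fun c => polyMap 𝔡 y n (q c) z)
  have hSs : ∀ q, ContDiff ℝ ∞ (S q) := fun q => χ.contDiff.smul (T.contDiff.comp
    (contDiff_pi.2 fun c => contDiff_polyMap n (q c)))
  have hSt : ∀ q, tsupport (S q) ⊆ tsupport χ := fun q => closure_mono fun z hz => by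
    simp only [Function.mem_support, S] at hz ⊢
    intro h
    rw [h, zero_smul] at hz
    exact hz rfl
  have hS : ∀ q, P.IsAdForm Φ (P.globalForm Φ i (S q)) := fun q =>
    BundleAtlas.isAdForm_globalForm (hSs q)
      (χ.hasCompactSupport.mono' (subset_closure.trans (hSt q))) ((hSt q).trans hχ)
  have hadd : ∀ q q', S (q + q') = S q + S q' := fun q q' => funext fun z => by
    simp only [S, Pi.add_apply, map_add]
    rw [← smul_add, ← map_add]
    rfl
  have hsmul : ∀ (a : ℝ) q, S (a • q) = a • S q := fun a q => funext fun z => by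
    simp only [S, Pi.smul_apply, map_smul]
    exact (congrArg (χ z • ·) (map_smul T a _)).trans (smul_comm _ _ _)
  refine ⟨{ toFun := fun q => ⟨P.globalForm Φ i (S q), hS q⟩
            map_add' := fun q q' => Subtype.ext
              ((congrArg _ (hadd q q')).trans (globalForm_add _ _))
            map_smul' := fun a q => Subtype.ext
              ((congrArg _ (hsmul a q)).trans (globalForm_smul _ _)) }, fun q w z hz => ?_⟩
  refine (component_apply hU w (⟨P.globalForm Φ i (S q), hS q⟩ : adForms P Φ m) hz).trans ?_
  refine (congrArg (fun η : LocalForm m => η z w)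
    (BundleAtlas.globalForm_self (Φ := Φ) ((hSt q).trans hχ))).trans ?_
  have h1 : χ z = 1 := χ.one_of_mem_closedBall (Metric.ball_subset_closedBall hz)
  change (χ z • T _) w = _
  rw [h1, one_smul]

/-- The zero-form with a given value. -/
def zeroFormOf : (Fin 1 → 𝔡) →L[ℝ] E3 [⋀^Fin 0]→L[ℝ] 𝔡 :=
  LinearMap.toContinuousLinearMap
    { toFun := fun f => ContinuousAlternatingMap.constOfIsEmpty ℝ E3 (Fin 0) (f 0)
      map_add' := fun _ _ => rfl
      map_smul' := fun _ _ => rfl }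

/-- The one-form with given last two components and vanishing first component. -/
def transverseFormOf : (Fin 2 → 𝔡) →L[ℝ] E3 [⋀^Fin 1]→L[ℝ] 𝔡 :=
  oneFormOf ∘L ContinuousLinearMap.pi
    ![0, ContinuousLinearMap.proj 0, ContinuousLinearMap.proj 1]

/-- Cut-off polynomials of degree at most `k` in all six components are tangent vectors that are
determined by their `k`-jets. -/
theorem le_finrank_jetMap {k : ℕ} (hy : y ∈ (P.chart i).target) :
    96 * (k + 3).choose 3 ≤ Module.finrank ℝ (LinearMap.range (jetMap P Φ k hy)) := by
  obtain ⟨U, hU, hyU, hp⟩ := exists_polynomial_adForms P Φ hy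
  obtain ⟨g1, hg1⟩ := hp k 1 3 oneFormOf
  obtain ⟨g2, hg2⟩ := hp k 2 3 twoFormOf
  have := (finrank_jetMap_le (P := P) (Φ := Φ) (k := k) hy).1
  have h := finrank_le_finrank_range_add (f := jetMap P Φ k hy) (N := ⊤) (r := 0)
    ⟨0, le_top⟩ (g1.prodMap g2) (fun q hq _ => by
      rw [jetMap_eq_zero_iff hy U hU hyU] at hq
      refine Prod.ext (funext fun c => polyMap_eq_zero (F := 𝔡) hyU ?_)
        (funext fun c => polyMap_eq_zero (F := 𝔡) hyU ?_)
      · refine cast (congrArg (· ∈ vanishing [0, 1, 2] y k)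
          (smoothOn_ext fun z hz => ?_)) (hq.1 c)
        refine (hg1 q.1 ![e c] z hz).trans ((oneFormOf_std _ c).trans ?_)
        exact (toSmoothOn_apply (contDiff_polyMap k (q.1 c)).contDiffOn hz).symm
      · refine cast (congrArg (· ∈ vanishing [0, 1, 2] y k)
          (smoothOn_ext fun z hz => ?_)) (hq.2 c)
        have h3 : ∀ f, twoFormOf f (pairVec c) = f c := fun f => by
          fin_cases c
          exacts [(twoFormOf_std f).2.1, (twoFormOf_std f).2.2, (twoFormOf_std f).1]
        refine (hg2 q.2 (pairVec c) z hz).trans ((h3 _).trans ?_)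
        exact (toSmoothOn_apply (contDiff_polyMap k (q.2 c)).contDiffOn hz).symm)
  rw [Module.finrank_prod, finrank_pi_coeffs] at h
  omega

-- The test multipliers are polynomials of degree at most `k + 1`, one more than the order of the
-- jet because the flow differentiates once. Taking `ℍ(e 0) = 0` fixes the redundancy `𝕒 ↦ 𝕒 + Λf`,
-- `ℍ ↦ ℍ + d_A f`, and leaves `16 + 32 = 48` components. If the jet of the flow and the surface
-- jets of the multiplier vanish, so does the multiplier.
set_option maxHeartbeats 800000 in
theorem le_finrank_jetMap_flow {Λ : ℝ} {φ : Config ι} (hφ : φ ∈ P.phaseSpace Φ)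
    (hs : IsSolution P Λ φ) {k : ℕ} (hy : y ∈ (P.chart i).target) : 48 * (k + 3).choose 3 ≤
    Module.finrank ℝ (LinearMap.range (jetMap P Φ k hy ∘ₗ flowMap Λ hφ)) := by
  obtain ⟨U, hU, hyU, hp⟩ := exists_polynomial_adForms P Φ hy
  obtain ⟨g0, hg0⟩ := hp (k + 1) 0 1 zeroFormOf
  obtain ⟨g1, hg1⟩ := hp (k + 1) 1 2 transverseFormOf
  have := (finrank_jetMap_flow_le hφ (k := k) hs hy).1
  have hV := codimLE_vanishing (U := U) (F := 𝔡) [1, 2] y (k + 1)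
  let f1 := fun c : Fin 3 => component (Φ := Φ) i U hU ![e c] ∘ₗ
    LinearMap.snd ℝ (adForms P Φ 0) _
  have hN := ((hV.comap (component (Φ := Φ) i U hU ![] ∘ₗ
    LinearMap.fst ℝ _ (adForms P Φ 1))).inf (hV.comap (f1 1))).inf (hV.comap (f1 2))
  have h := finrank_le_finrank_range_add (f := jetMap P Φ k hy ∘ₗ flowMap Λ hφ) hN
    (g0.prodMap g1) (fun q hq hq' => by
      obtain ⟨⟨ha, hl1⟩, hl2⟩ := hq'
      have hq := (jetMap_eq_zero_iff hy U hU hyU _).1 hq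
      have hc : ∀ (q : Fin 2 → Coeffs (k + 1)) (c : Fin 3) z, z ∈ U →
          (component i U hU ![e c] (g1 q)).1 z =
          ![0, polyMap 𝔡 y (k + 1) (q 0) z, polyMap 𝔡 y (k + 1) (q 1) z] c := fun q c z hz => by
        refine (hg1 q ![e c] z hz).trans ((oneFormOf_std _ c).trans ?_)
        fin_cases c <;> rfl
      obtain ⟨ia, i1, i2⟩ := multiplier_mem_vanishing hφ hU (g0.prodMap g1 q) hq.1 hq.2
        (smoothOn_ext fun z hz => hc q.2 0 z hz) ha hl1 hl2
      refine Prod.ext (funext fun c => polyMap_eq_zero (F := 𝔡) hyU ?_)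
        (funext fun c => polyMap_eq_zero (F := 𝔡) hyU ?_)
      · refine cast (congrArg (· ∈ vanishing [0, 1, 2] y (k + 1))
          (smoothOn_ext fun z hz => ?_)) ia
        rw [Subsingleton.elim c 0]
        refine (hg0 q.1 ![] z hz).trans ?_
        exact (toSmoothOn_apply (contDiff_polyMap (k + 1) (q.1 0)).contDiffOn hz).symm
      · fin_cases c
        · refine cast (congrArg (· ∈ vanishing [0, 1, 2] y (k + 1))
            (smoothOn_ext fun z hz => ?_)) i1
          refine (hc q.2 1 z hz).trans ?_
          exact (toSmoothOn_apply (contDiff_polyMap (k + 1) (q.2 0)).contDiffOn hz).symm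
        · refine cast (congrArg (· ∈ vanishing [0, 1, 2] y (k + 1))
            (smoothOn_ext fun z hz => ?_)) i2
          refine (hc q.2 2 z hz).trans ?_
          exact (toSmoothOn_apply (contDiff_polyMap (k + 1) (q.2 1)).contDiffOn hz).symm)
  rw [Module.finrank_prod, finrank_pi_coeffs, finrank_pi_coeffs, finrank_𝔡] at h
  have h4 : ([1, 2] : List (Fin 3)).length + (k + 1) = (k + 1) + 2 := Nat.add_comm 2 (k + 1)
  rw [h4, Nat.choose_symm_add] at h
  -- Pascal's rule: the gain from degree `k + 1` is exactly the loss `48 * (k + 3).choose 2` from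
  -- the surface data, which leaves no error term in the lower bound.
  have h5 : (k + 1 + 3).choose 3 = (k + 3).choose 2 + (k + 3).choose 3 :=
    Nat.choose_succ_succ (k + 3) 2
  have h6 : k + 1 + 2 = k + 3 := rfl
  rw [h5, h6] at h
  omega

end Atlas
end QEGR
end

open scoped Manifold ContDiff
noncomputable section
namespace QEGR
open Filter Topology TrivialExt

/-! ### Asymptotics of the dimension counts and the conclusion. -/

section Limits

theorem three_mul_choose_three (k : ℕ) : 3 * (k + 3).choose 3 = (k + 3) * (k + 2).choose 2 := by
  have := Nat.add_one_mul_choose_eq (k + 2) 2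
  linarith

/-- A squeeze: `(k + 2).choose 2 / (k + 3).choose 3 = 3 / (k + 3)` tends to zero. -/
theorem tendsto_div_choose {f : ℕ → ℕ} {n : ℕ} (h : ∀ k, n * (k + 3).choose 3 ≤ f k)
    (h' : ∀ k, f k ≤ n * (k + 3).choose 3 + n * (k + 2).choose 2) :
    Tendsto (fun k : ℕ => (f k : ℝ) / ((k + 3).choose 3 : ℝ)) atTop (𝓝 n) := by
  have hlim : Tendsto (fun k : ℕ => (n : ℝ) + (3 * n : ℝ) / ((k + 3 : ℕ) : ℝ)) atTop (𝓝 n) := by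
    simpa using tendsto_const_nhds.add
      ((tendsto_const_div_atTop_nhds_zero_nat (3 * n : ℝ)).comp (tendsto_add_atTop_nat 3))
  have hpos : ∀ k : ℕ, (0 : ℝ) < ((k + 3).choose 3 : ℝ) := fun k => by
    exact_mod_cast Nat.choose_pos (by omega)
  refine tendsto_of_tendsto_of_tendsto_of_le_of_le tendsto_const_nhds hlim (fun k => ?_) fun k => ?_
  · change (n : ℝ) ≤ _
    rw [le_div_iff₀ (hpos k)]
    exact_mod_cast h k
  · change (f k : ℝ) / _ ≤ _
    rw [div_le_iff₀ (hpos k)]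
    have h1 : (f k : ℝ) ≤ n * (k + 3).choose 3 + n * (k + 2).choose 2 := by exact_mod_cast h' k
    have h2 : (3 : ℝ) * (k + 3).choose 3 = ((k + 3 : ℕ) : ℝ) * (k + 2).choose 2 := by
      exact_mod_cast three_mul_choose_three k
    have h3 : ((k + 3 : ℕ) : ℝ) ≠ 0 := by positivity
    refine h1.trans_eq ?_
    rw [add_mul, div_mul_eq_mul_div, mul_right_comm, h2]
    field_simp

end Limits

section Atlas
set_option linter.unusedSectionVars false
variable {E D N ι : Type*} [NormedAddCommGroup E] [NormedSpace ℝ E] [CompleteSpace E]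
  [TopologicalSpace D] [ChartedSpace E D] [Group D] [LieGroup 𝓘(ℝ, E) ∞ D]
  [TopologicalSpace N] [ChartedSpace E3 N] [T2Space N] [CompactSpace N]
  [IsManifold (𝓡 3) ∞ N] [Fintype ι]
  {P : BundleAtlas E D N ι} {Φ : GroupLieAlgebra 𝓘(ℝ, E) D ≃ₗ⁅ℝ⁆ 𝔡}
  {Λ : ℝ} {φ : Config ι}

theorem finrank_of_coe_eq {V : Type*} [AddCommGroup V] [Module ℝ V] {s : Set V}
    {W : Submodule ℝ V} (h : s = W) : Set.finrank ℝ s = Module.finrank ℝ W := by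
  rw [Set.finrank, h, Submodule.span_eq]

theorem hasLocalDim_tangent : P.HasLocalDim (P.tangent Φ) 96 := by
  intro i y hy
  have h : ∀ k, Set.finrank ℝ (BundleAtlas.jet k i y '' P.tangent Φ) =
      Module.finrank ℝ (LinearMap.range (jetMap P Φ k hy)) := fun k => by
    refine finrank_of_coe_eq (Set.ext fun j => ⟨?_, ?_⟩)
    · rintro ⟨X, hX, rfl⟩
      exact ⟨(⟨X.1, hX.1⟩, ⟨X.2, hX.2⟩), rfl⟩
    · rintro ⟨X, rfl⟩
      exact ⟨(X.1.1, X.2.1), ⟨X.1.2, X.2.2⟩, rfl⟩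
  simp only [h]
  exact tendsto_div_choose (fun k => le_finrank_jetMap hy)
    fun k => (finrank_jetMap_le hy).2.trans (Nat.le_add_right _ _)

/-- The jets of flows form the range of a linear map, so the span in `Set.finrank` adds nothing and
the two bounds on that rank apply. -/
theorem hasLocalDim_flow (hφ : φ ∈ P.phaseSpace Φ) (hs : IsSolution P Λ φ) {W : Set (Config ι)}
    (hW : ∀ X, X ∈ W ↔ ∃ l ∈ P.multipliers Φ, X = P.flow Λ l φ) : P.HasLocalDim W 48 := by
  intro i y hy
  have h : ∀ k, Set.finrank ℝ (BundleAtlas.jet k i y '' W) =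
      Module.finrank ℝ (LinearMap.range (jetMap P Φ k hy ∘ₗ flowMap Λ hφ)) := fun k => by
    refine finrank_of_coe_eq (Set.ext fun j => ⟨?_, ?_⟩)
    · rintro ⟨X, hX, rfl⟩
      obtain ⟨l, hl, rfl⟩ := (hW X).1 hX
      exact ⟨(⟨l.1, hl.1⟩, ⟨l.2, hl.2⟩), rfl⟩
    · rintro ⟨l, rfl⟩
      exact ⟨_, (hW _).2 ⟨(l.1.1, l.2.1), ⟨l.1.2, l.2.2⟩, rfl⟩, rfl⟩
  simp only [h]
  exact tendsto_div_choose (fun k => le_finrank_jetMap_flow hφ hs hy)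
    fun k => (finrank_jetMap_flow_le hφ hs hy).2

variable (hΦ : ∀ (a : D) (X Y : 𝔡), pair (Ad Φ a X) (Ad Φ a Y) = pair X Y)
  {C : Multiplier ι → Config ι → ℝ}
  (hC : ∀ φ ∈ P.phaseSpace Φ, ∀ l ∈ P.multipliers Φ, C l φ = bfConstraint P Λ l φ)
include hΦ hC

/-- The local degrees of freedom and constraints of `BF` theory with a cosmological term. -/
theorem localCounts : P.LocalCounts Φ C 96 48 0 := by
  refine ⟨hasLocalDim_tangent, fun φ hφ => ?_⟩
  have hs := isSolution_of_mem_constraintSurface hΦ hC hφ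
  refine ⟨hasLocalDim_flow hφ.1 hs fun X => exists_congr fun l => and_congr_right fun hl =>
    isFirstClassVector_iff hΦ hC hl hφ, hasLocalDim_flow hφ.1 hs fun X => exists_congr fun l =>
    and_congr_right fun hl => isHamiltonianVector_iff hΦ hC hl hφ.1⟩

end Atlas
end QEGR
end

theorem mainTheorem9 {E D N ι : Type*} [NormedAddCommGroup E] [NormedSpace ℝ E] [CompleteSpace E]
    [TopologicalSpace D] [ChartedSpace E D] [Group D] [LieGroup 𝓘(ℝ, E) ∞ D]
    [TopologicalSpace N] [ChartedSpace QEGR.E3 N] [T2Space N] [CompactSpace N]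
    [IsManifold (𝓡 3) ∞ N] [Fintype ι]
    (Φ : GroupLieAlgebra 𝓘(ℝ, E) D ≃ₗ⁅ℝ⁆ QEGR.𝔡)
    (hΦ : ∀ (a : D) (X Y : QEGR.𝔡),
      QEGR.TrivialExt.pair (QEGR.Ad Φ a X) (QEGR.Ad Φ a Y) = QEGR.TrivialExt.pair X Y)
    (P : QEGR.BundleAtlas E D N ι)
    (β : ℝ) (T : QEGR.SO31 ≃ₗ[ℝ] QEGR.SO31)
    (hT : β • T.toLinearMap = β • LinearMap.id) :
    (∀ φ ∈ P.phaseSpace Φ, ∀ l ∈ P.multipliers Φ,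
      QEGR.GR.H P l.1 φ + QEGR.GR.I P l.1 φ + QEGR.GR.J P l.1 φ = QEGR.BF.J P l.1 φ ∧
      QEGR.GR.K P β T l.2 φ + QEGR.GR.L P β l.2 φ + QEGR.GR.M P β T l.2 φ
        = QEGR.BF.L P (1 + β) l.2 φ) ∧
    P.IsFirstClass Φ (QEGR.GR.constraint P β T) ∧
    P.LocalCounts Φ (QEGR.GR.constraint P β T) 96 48 0 ∧
    P.IsTopological Φ (QEGR.GR.constraint P β T) := by
  have h1 : ∀ φ ∈ P.phaseSpace Φ, ∀ l ∈ P.multipliers Φ,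
      QEGR.GR.H P l.1 φ + QEGR.GR.I P l.1 φ + QEGR.GR.J P l.1 φ = QEGR.BF.J P l.1 φ ∧
      QEGR.GR.K P β T l.2 φ + QEGR.GR.L P β l.2 φ + QEGR.GR.M P β T l.2 φ
        = QEGR.BF.L P (1 + β) l.2 φ := fun φ hφ l hl =>
    ⟨QEGR.gauss_eq hφ hl, QEGR.curvature_constraint_eq hT hφ hl⟩
  -- Agreement on the phase space suffices, since lines through its points in tangent directions
  -- stay inside it and derivatives of the constraints are taken only along these.
  have hC : ∀ φ ∈ P.phaseSpace Φ, ∀ l ∈ P.multipliers Φ,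
      QEGR.GR.constraint P β T l φ = QEGR.bfConstraint P (1 + β) l φ := fun φ hφ l hl => by
    have h := h1 φ hφ l hl
    rw [QEGR.GR.constraint, QEGR.bfConstraint, ← h.1, ← h.2]
    ring
  have hcount := QEGR.localCounts hΦ hC
  exact ⟨h1, QEGR.isFirstClass hΦ hC, hcount, 96, 48, 0, hcount, rfl⟩
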